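/- **Setting.** Let $\mathcal M$ be a $C^*$-algebra. A $C^*$-correspondence $E$ over $\mathcal M$ is a right Hilbert $\mathcal M$-module with a left action given by a $*$-homomorphism $\phi:\mathcal M\to\mathcal L(E)$ into the adjointable operators. All $*$-homomorphisms are essential: $\overline{\operatorname{span}}\,\phi(\mathcal M)E=E$, and $\overline{\operatorname{span}}\,\sigma(\mathcal M)\mathcal H=\mathcal H$ for a representation $\sigma$ of $\mathcal M$ on a Hilbert space $\mathcal H$. The tensor products $E\otimes F$ and $E\otimes\mathcal H$ are the interior ones: $\langle\xi\otimes\eta,\xi'\otimes\eta'\rangle=\langle\eta,\phi(\langle\xi,\xi'\rangle)\eta'\rangle$ and $\langle\xi\otimes h,\xi'\otimes h'\rangle=\langle h,\sigma(\langle\xi,\xi'\rangle)h'\rangle$. A completely bounded covariant representation $(\sigma,T)$ of $E$ on $\mathcal H$ consists of a representation $\sigma$ of $\mathcal M$ on $\mathcal H$ and a completely bounded linear map $T:E\to B(\mathcal H)$ (for the operator space structure of $E$ as a corner of its linking algebra) with $T(a\xi b)=\sigma(a)T(\xi)\sigma(b)$. It determines the bounded operators $\widetilde T:E\otimes\mathcal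 H\to\mathcal H$, $\widetilde T(\xi\otimes h)=T(\xi)h$, and $\widetilde T_n:E^{\otimes n}\otimes\mathcal H\to\mathcal H$, $\widetilde T_n(\xi_1\otimes\cdots\otimes\xi_n\otimes h)=T(\xi_1)\cdots T(\xi_n)h$, $n\ge1$. We say that $(\sigma,T)$ * is *concave* if $\|\widetilde T_2x\|^2+\|x\|^2\le2\|(I_E\otimes\widetilde T)x\|^2$ for all $x\in E^{\otimes2}\otimes\mathcal H$; * satisfies $(\ast)$ if $\|(I_E\otimes\widetilde T)\zeta+\kappa\|^2\le2(\|\zeta\|^2+\|\widetilde T\kappa\|^2)$ for all $\zeta\in E^{\otimes2}\otimes\mathcal H$, $\kappa\in E\otimes\mathcal H$; * is *analytic* if $\bigcap_{n\ge1}\widetilde T_n(E^{\otimes n}\otimes\mathcal H)=\{0\}$. A product system over $\mathbb N_0^k$ is a family $E_1,\dots,E_k$ of $C^*$-correspondences over $\mathcal M$ with unitary isomorphisms of correspondences $t_{i,j}:E_i\otimes E_j\to E_j\otimes E_i$ such that $t_{i,i}=\mathrm{id}$ and $t_{i,j}=t_{j,i}^{-1}$. A completely bounded covariant representation of it on $\mathcal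 H$ is a tuple $(\sigma,T^{(1)},\dots,T^{(k)})$ in which each $(\sigma,T^{(i)})$ is a completely bounded covariant representation of $E_i$ on $\mathcal H$, and $$\widetilde T^{(i)}(I_{E_i}\otimes\widetilde T^{(j)})=\widetilde T^{(j)}(I_{E_j}\otimes\widetilde T^{(i)})(t_{i,j}\otimes I_{\mathcal H})\qquad(1\le i,j\le k).$$ It is *doubly commuting* if $\widetilde T^{(j)*}\widetilde T^{(i)}=(I_{E_j}\otimes\widetilde T^{(i)})(t_{i,j}\otimes I_{\mathcal H})(I_{E_i}\otimes\widetilde T^{(j)*})$ for all $i\ne j$. For $\alpha=\{\alpha_1<\dots<\alpha_n\}\subseteq\{1,\dots,k\}$, $\mathbf m=(m_{\alpha_1},\dots,m_{\alpha_n})\in\mathbb N_0^\alpha$ and a closed $\sigma(\mathcal M)$-invariant subspace $\mathcal K\subseteq\mathcal H$, let $\mathfrak L^\alpha_{\mathbf m}(\mathcal K)$ be the closed linear span of the vectors obtained from $h\in\mathcal K$ by applying a product of $m_{\alpha_1}$ operators from $T^{(\alpha_1)}(E_{\alpha_1})$, followed on the right by $m_{\alpha_2}$ operators from $T^{(\alpha_2)}(E_{\alpha_2})$,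 and so on up to $\alpha_n$. Let $[\mathcal K]_{T_\alpha}=\bigvee_{\mathbf m\in\mathbb N_0^\alpha}\mathfrak L^\alpha_{\mathbf m}(\mathcal K)$, and write $[\mathcal K]_{T^{(i)}}$ if $\alpha=\{i\}$. The subspace $\mathcal K$ is a *generating wandering subspace* for $(\sigma,T^{(\alpha_1)},\dots,T^{(\alpha_n)})$ if $\mathcal K\perp\mathfrak L^\alpha_{\mathbf m}(\mathcal K)$ for all $\mathbf m\in\mathbb N_0^\alpha\setminus\{0\}$ and $[\mathcal K]_{T_\alpha}=\mathcal H$. Put $\mathcal W_\alpha=\bigcap_{i\in\alpha}\bigl(\mathcal H\ominus\widetilde T^{(i)}(E_i\otimes\mathcal H)\bigr)$. **Theorem.** Let $(\sigma,T^{(1)},\dots,T^{(k)})$ be a completely bounded covariant representation on a Hilbert space $\mathcal H$ of a product system $E_1,\dots,E_k$ over $\mathbb N_0^k$. Assume that, for every $i$, the closed linear span of $\{\phi_i(\langle\xi,\eta\rangle)\zeta:\xi,\eta,\zeta\in E_i\}$ is $E_i$ (which is automatic if $E_i$ is full), and that each $(\sigma,T^{(i)})$ is concave or satisfies $(\ast)$.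 Then 1. $(\sigma,T^{(1)},\dots,T^{(k)})$ is doubly commuting, and 2. $(\sigma,T^{(i)})$ is analytic for every $i$ if and only if (a) for every nonempty $\alpha=\{\alpha_1,\dots,\alpha_n\}\subseteq\{1,\dots,k\}$, $\mathcal W_\alpha$ is a generating wandering subspace for $(\sigma,T^{(\alpha_1)},\dots,T^{(\alpha_n)})$ and, if $n\ge2$, $[\mathcal W_\alpha]_{T^{(\alpha_i)}}=\mathcal W_{\alpha\setminus\{\alpha_i\}}$ for every $\alpha_i\in\alpha$; and (b) for all $1\le i<j\le k$, $$(I_{E_j}\otimes\widetilde T^{(i)})(t_{i,j}\otimes I_{\mathcal H})(I_{E_i}\otimes\widetilde T^{(j)*}\widetilde T^{(j)})=\widetilde T^{(j)*}\widetilde T^{(j)}(I_{E_j}\otimes\widetilde T^{(i)})(t_{i,j}\otimes I_{\mathcal H}).$$ -/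

import Mathlib

open scoped TensorProduct InnerProductSpace ComplexOrder

set_option linter.unusedSectionVars false

universe u v v' w w' w''

noncomputable section

namespace CovRep

section CStarAlgebraFacts

variable {A : Type u} [NonUnitalCStarAlgebra A] [PartialOrder A] [StarOrderedRing A]

lemma exists_negPart_aux {G : A} (hG : IsSelfAdjoint G) :
    ∃ N Y : A, star N = N ∧ N * G * N = -(N * N * N) ∧ N * N * N = star Y * Y ∧
      (N = 0 → ∃ S, G = star S * S) := by
  have hN0 : 0 ≤ G⁻ := CFC.negPart_nonneg G
  have hNsa : star G⁻ = G⁻ := IsSelfAdjoint.of_nonneg hN0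
  have h2 : 0 ≤ G⁻ * G⁻ * G⁻ := by
    have := star_left_conjugate_nonneg hN0 G⁻
    rwa [hNsa] at this
  obtain ⟨Y, hY⟩ := CStarAlgebra.nonneg_iff_eq_star_mul_self.1 h2
  refine ⟨G⁻, Y, hNsa, ?_, hY, fun h => ?_⟩
  · have h := CFC.posPart_sub_negPart G
    calc G⁻ * G * G⁻ = G⁻ * (G⁺ - G⁻) * G⁻ := by rw [h]
      _ = _ := by rw [mul_sub, sub_mul, CFC.negPart_mul_posPart]; simp
  · exact CStarAlgebra.nonneg_iff_eq_star_mul_self.1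
      (CStarAlgebra.nonneg_iff_isSelfAdjoint_and_negPart_eq_zero.2 ⟨hG, h⟩)

lemma exists_sub_mul_self {a : A} (ha : ‖a‖ ≤ 1) :
    ∃ d : A, star d = d ∧ star a * a = d + d - d * d := by
  set b := star a * a with hb
  have hb0 : 0 ≤ b := star_mul_self_nonneg a
  have hbsa : IsSelfAdjoint b := IsSelfAdjoint.of_nonneg hb0
  have hbn : ‖b‖ ≤ 1 := by
    rw [hb, CStarRing.norm_star_mul_self]
    nlinarith [norm_nonneg a]
  set f : ℝ → ℝ := fun t => 1 - √(1 - t) with hf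
  have hfc : Continuous f := by fun_prop
  have hf0 : f 0 = 0 := by simp [hf]
  refine ⟨cfcₙ f b, (cfcₙ_predicate f b : IsSelfAdjoint _), ?_⟩
  rw [← cfcₙ_add f f b, ← cfcₙ_mul f f b, ← cfcₙ_sub _ _ b]
  conv_lhs => rw [← cfcₙ_id ℝ b]
  refine cfcₙ_congr fun t ht => ?_
  have ht1 : t ≤ 1 := by
    have := NonUnitalIsometricContinuousFunctionalCalculus.norm_quasispectrum_le b ht
    rw [Real.norm_eq_abs] at this
    exact (le_abs_self t).trans (this.trans hbn)
  have h := Real.sq_sqrt (sub_nonneg.2 ht1)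
  simp only [hf, id]
  nlinarith

lemma exists_approx_factor {G : A} (hG : 0 ≤ G) {ε : ℝ} (hε : 0 < ε) :
    ∃ Y R : A, star Y = Y ∧ star R = R ∧ R * R = G ∧ ‖Y * G * Y‖ ≤ 1 ∧
      ‖G - G * (Y * R) - (R * Y) * G + (R * Y) * G * (Y * R)‖ ≤ ε := by
  have hGsa : IsSelfAdjoint G := IsSelfAdjoint.of_nonneg hG
  set g : ℝ → ℝ := fun t => √t with hg
  set f : ℝ → ℝ := fun t => √t / (|t| + ε) with hf
  have hp (t : ℝ) : |t| + ε ≠ 0 := by positivity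
  have hgc : Continuous g := by fun_prop
  have hfc : Continuous f := by
    have : Continuous fun t : ℝ => |t| + ε := by fun_prop
    exact (Real.continuous_sqrt).div this hp
  have hf0 : f 0 = 0 := by simp [hf]
  have hg0 : g 0 = 0 := by simp [hg]
  have hspec : ∀ t ∈ quasispectrum ℝ G, 0 ≤ t := fun t ht => quasispectrum_nonneg_of_nonneg G hG t ht
  have hYR : cfcₙ f G * cfcₙ g G = cfcₙ (fun t => f t * g t) G := (cfcₙ_mul f g G).symm
  have hRY : cfcₙ g G * cfcₙ f G = cfcₙ (fun t => f t * g t) G := by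
    rw [← cfcₙ_mul g f G]; simp only [mul_comm]
  refine ⟨cfcₙ f G, cfcₙ g G, (cfcₙ_predicate f G : IsSelfAdjoint _),
    (cfcₙ_predicate g G : IsSelfAdjoint _), ?_, ?_, ?_⟩
  · rw [← cfcₙ_mul g g G]
    conv_rhs => rw [← cfcₙ_id' ℝ G]
    refine cfcₙ_congr fun t ht => ?_
    simp only [hg]
    exact Real.mul_self_sqrt (hspec t ht)
  · have : cfcₙ f G * G * cfcₙ f G = cfcₙ (fun t => f t * t * f t) G := by
      rw [cfcₙ_mul (fun t => f t * t) f G, cfcₙ_mul f (fun t => t) G, cfcₙ_id' ℝ G]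
    rw [this]
    refine norm_cfcₙ_le fun t ht => ?_
    have h0 := hspec t ht
    have h1 := Real.sq_sqrt h0
    have h2 : f t * t * f t = (t / (t + ε)) ^ 2 := by
      simp only [hf, abs_of_nonneg h0]
      have : t + ε ≠ 0 := by positivity
      field_simp
      nlinarith
    rw [h2, Real.norm_eq_abs, abs_of_nonneg (by positivity)]
    have h3 : t / (t + ε) ≤ 1 := by
      rw [div_le_one (by positivity)]; linarith
    have h4 : 0 ≤ t / (t + ε) := by positivity
    nlinarith
  · rw [hYR, hRY]
    set u : ℝ → ℝ := fun t => f t * g t with hu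
    have huc : Continuous u := hfc.mul hgc
    have hu0 : u 0 = 0 := by simp [hu, hf0]
    have : G - G * cfcₙ u G - cfcₙ u G * G + cfcₙ u G * G * cfcₙ u G
        = cfcₙ (fun t => t - t * u t - u t * t + u t * t * u t) G := by
      rw [cfcₙ_add (fun t => t - t * u t - u t * t) (fun t => u t * t * u t) G,
        cfcₙ_sub (fun t => t - t * u t) (fun t => u t * t) G,
        cfcₙ_sub (fun t => t) (fun t => t * u t) G,
        cfcₙ_mul (fun t => u t * t) u G, cfcₙ_mul u (fun t => t) G, cfcₙ_mul (fun t => t) u G,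
        cfcₙ_id' ℝ G]
    rw [this]
    refine norm_cfcₙ_le fun t ht => ?_
    have h0 := hspec t ht
    have h1 := Real.mul_self_sqrt h0
    have hpos : 0 < t + ε := by positivity
    have h2 : u t = t / (t + ε) := by
      simp only [hu, hf, hg, abs_of_nonneg h0]
      rw [div_mul_eq_mul_div, h1]
    have h3 : t - t * u t - u t * t + u t * t * u t = t * (ε / (t + ε)) ^ 2 := by
      rw [h2]; field_simp; ring
    rw [h3, Real.norm_eq_abs, abs_of_nonneg (by positivity), div_pow, ← mul_div_assoc,
      div_le_iff₀ (by positivity)]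
    nlinarith [mul_nonneg h0 hε.le, mul_nonneg hε.le (mul_nonneg h0 h0),
      mul_nonneg hε.le (mul_nonneg hε.le h0), pow_pos hε 3]

end CStarAlgebraFacts

section Algebraic

variable {M : Type u} [NonUnitalCStarAlgebra M] [PartialOrder M] [StarOrderedRing M]

/-- The `M`-valued inner product `⟨x, y⟩` of a right Hilbert `M`-module. A right Hilbert module over
`M` is a `CStarModule` over `Mᵐᵒᵖ`; the inner product is linear in the second variable and
`⟨x, y a⟩ = ⟨x, y⟩ a`. -/
def rip (M : Type u) {E : Type v} [Inner Mᵐᵒᵖ E] (x y : E) : M := (inner Mᵐᵒᵖ x y).unop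

section ip

variable {E : Type v} [AddCommGroup E] [Module ℂ E] [SMul Mᵐᵒᵖ E] [Norm E] [CStarModule Mᵐᵒᵖ E]

lemma rip_add_right (x y z : E) : rip M x (y + z) = rip M x y + rip M x z := by simp [rip]
lemma rip_add_left (x y z : E) : rip M (x + y) z = rip M x z + rip M y z := by simp [rip]
lemma rip_smul_right (c : ℂ) (x y : E) : rip M x (c • y) = c • rip M x y := by simp [rip]
lemma rip_smul_left (c : ℂ) (x y : E) : rip M (c • x) y = star c • rip M x y := by simp [rip]
lemma rip_rsmul_right (a : M) (x y : E) :
    rip M x (MulOpposite.op a • y) = rip M x y * a := by simp [rip]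
lemma rip_rsmul_left (a : M) (x y : E) :
    rip M (MulOpposite.op a • x) y = star a * rip M x y := by simp [rip]
lemma star_rip (x y : E) : star (rip M x y) = rip M y x := by
  simp [rip, ← MulOpposite.unop_star]
lemma rip_self_nonneg (x : E) : 0 ≤ rip M x x :=
  (CStarModule.inner_self_nonneg (A := Mᵐᵒᵖ) (x := x))
lemma rip_sum_right {ι : Type*} (s : Finset ι) (x : E) (y : ι → E) :
    rip M x (∑ i ∈ s, y i) = ∑ i ∈ s, rip M x (y i) := by simp [rip]
lemma rip_sum_left {ι : Type*} (s : Finset ι) (x : E) (y : ι → E) :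
    rip M (∑ i ∈ s, y i) x = ∑ i ∈ s, rip M (y i) x := by simp [rip]

/-- The Gram matrix of a finite family in a Hilbert module is positive in the matrix algebra. -/
lemma exists_gram_factor {n : ℕ} (x : Fin n → E) :
    ∃ S : CStarMatrix (Fin n) (Fin n) M,
      (CStarMatrix.ofMatrix fun i j => rip M (x i) (x j)) = star S * S := by
  set G : CStarMatrix (Fin n) (Fin n) M := CStarMatrix.ofMatrix fun i j => rip M (x i) (x j)
  have hGij (i j) : G i j = rip M (x i) (x j) := rfl
  have hsa : IsSelfAdjoint G := by
    ext i j
    rw [CStarMatrix.star_apply, hGij, hGij, star_rip]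
  obtain ⟨N, Y, hNsa, h1, hY, hfin⟩ := exists_negPart_aux hsa
  refine hfin ?_
  have h3 (j : Fin n) : (0 : M) ≤ (N * G * N) j j := by
    have : (N * G * N) j j = rip M (∑ i, MulOpposite.op (N i j) • x i)
        (∑ i, MulOpposite.op (N i j) • x i) := by
      simp only [CStarMatrix.mul_apply, rip_sum_right, rip_sum_left, rip_rsmul_right,
        rip_rsmul_left, Finset.sum_mul, hGij]
      refine Finset.sum_congr rfl fun a _ => Finset.sum_congr rfl fun b _ => ?_
      conv_lhs => rw [← hNsa]
      rw [CStarMatrix.star_apply, hNsa]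
    rw [this]
    exact rip_self_nonneg _
  have h4 (j : Fin n) : (N * N * N) j j = ∑ k, star (Y k j) * Y k j := by
    rw [hY, CStarMatrix.mul_apply]
    simp [CStarMatrix.star_apply]
  have h5 (k j : Fin n) : Y k j = 0 := by
    have h6 : ∑ k, star (Y k j) * Y k j = 0 := by
      refine le_antisymm ?_ (Finset.sum_nonneg fun k _ => star_mul_self_nonneg _)
      have := h3 j
      rw [h1] at this
      rw [← h4]
      simpa using this
    rw [Finset.sum_eq_zero_iff_of_nonneg fun k _ => star_mul_self_nonneg _] at h6
    exact (CStarRing.star_mul_self_eq_zero_iff _).1 (h6 k (Finset.mem_univ _))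
  have h7 : Y = 0 := by ext k j; exact h5 k j
  have h8 : N * N * N = 0 := by rw [hY, h7]; simp
  have h9 : star (N * N) * (N * N) = 0 := by
    rw [star_mul, hNsa, ← mul_assoc, h8, zero_mul]
  have h10 := (CStarRing.star_mul_self_eq_zero_iff _).1 h9
  have h11 : star N * N = 0 := by rw [hNsa, h10]
  exact (CStarRing.star_mul_self_eq_zero_iff _).1 h11

end ip

end Algebraic

section Form

variable {M : Type u} [NonUnitalCStarAlgebra M] [PartialOrder M] [StarOrderedRing M]
variable {B : Type*} [NonUnitalCStarAlgebra B] [PartialOrder B] [StarOrderedRing B]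
variable {E : Type v} [AddCommGroup E] [Module ℂ E] [SMul Mᵐᵒᵖ E] [Norm E] [CStarModule Mᵐᵒᵖ E]
variable {K : Type w} [NormedAddCommGroup K] [NormedSpace ℂ K] [SMul B K] [CStarModule B K]

/-- The `B`-valued form `⟨ξ ⊗ h, η ⊗ g⟩ = ⟨h, π(⟨ξ, η⟩) g⟩` on the algebraic tensor product. -/
def tform (E : Type v) [AddCommGroup E] [Module ℂ E] [SMul Mᵐᵒᵖ E] [Norm E] [CStarModule Mᵐᵒᵖ E]
    (B : Type*) [NonUnitalCStarAlgebra B] [PartialOrder B] [StarOrderedRing B]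
    [SMul B K] [CStarModule B K] (π : M →ₙₐ[ℂ] (K →L[ℂ] K)) :
    (E ⊗[ℂ] K) →ₗ⋆[ℂ] (E ⊗[ℂ] K) →ₗ[ℂ] B :=
  TensorProduct.lift (LinearMap.mk₂'ₛₗ (starRingEnd ℂ) (starRingEnd ℂ)
    (fun ξ h => TensorProduct.lift (LinearMap.mk₂ ℂ
      (fun η g => (inner B h (π (rip M ξ η) g) : B))
      (by intros; simp [rip_add_right]) (by intros; simp [rip_smul_right])
      (by intros; simp) (by intros; simp)))
    (by intros; ext; simp [rip_add_left])
    (by intros; ext; simp [rip_smul_left])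
    (by intros; ext; simp)
    (by intros; ext; simp))

variable (π : M →ₙₐ[ℂ] (K →L[ℂ] K))

@[simp] lemma tform_tmul (ξ η : E) (h g : K) :
    tform E B π (ξ ⊗ₜ h) (η ⊗ₜ g) = inner B h (π (rip M ξ η) g) := rfl

/-- Compatibility of the action of `M` with the adjoint. -/
def IsStarAction (B : Type*) [NonUnitalCStarAlgebra B] [PartialOrder B] [StarOrderedRing B]
    [SMul B K] [CStarModule B K] (π : M →ₙₐ[ℂ] (K →L[ℂ] K)) : Prop :=
  ∀ a x y, (inner B (π a x) y : B) = inner B x (π (star a) y)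

variable {π}

lemma star_tform (hπ : IsStarAction B π) (x y : E ⊗[ℂ] K) :
    star (tform E B π x y) = tform E B π y x := by
  induction x using TensorProduct.induction_on with
  | zero => simp
  | add x₁ x₂ h₁ h₂ => simp [h₁, h₂]
  | tmul ξ h =>
    induction y using TensorProduct.induction_on with
    | zero => simp
    | add x₁ x₂ h₁ h₂ => simp [h₁, h₂]
    | tmul η g => rw [tform_tmul, tform_tmul, CStarModule.star_inner, hπ, star_rip]

lemma tform_sum {n : ℕ} (hπ : IsStarAction B π) (ξ : Fin n → E)
    {S : CStarMatrix (Fin n) (Fin n) M}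
    (hS : (CStarMatrix.ofMatrix fun i j => rip M (ξ i) (ξ j)) = star S * S) (h g : Fin n → K) :
    tform E B π (∑ i, ξ i ⊗ₜ h i) (∑ i, ξ i ⊗ₜ g i)
      = ∑ k, inner B (∑ i, π (S k i) (h i)) (∑ j, π (S k j) (g j)) := by
  have hS' (i j) : rip M (ξ i) (ξ j) = ∑ k, star (S k i) * S k j := by
    have := congrArg (fun X : CStarMatrix (Fin n) (Fin n) M => X i j) hS
    rw [CStarMatrix.mul_apply] at this
    exact this
  simp only [map_sum, LinearMap.sum_apply, tform_tmul, hS', map_mul,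
    sum_apply, mul_apply_eq_comp, CStarModule.inner_sum_right,
    CStarModule.inner_sum_left]
  simp only [hπ _ _ _]
  rw [Finset.sum_comm]
  refine (Finset.sum_congr rfl fun i _ => Finset.sum_comm).trans ?_
  rw [Finset.sum_comm]
  refine Finset.sum_congr rfl fun k _ => ?_
  rw [Finset.sum_comm]

lemma exists_sum_tmul (x : E ⊗[ℂ] K) :
    ∃ (n : ℕ) (ξ : Fin n → E) (h : Fin n → K), x = ∑ i, ξ i ⊗ₜ h i :=
  TensorProduct.exists_sum_tmul_eq x

lemma tform_self_nonneg (hπ : IsStarAction B π) (x : E ⊗[ℂ] K) : 0 ≤ tform E B π x x := by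
  obtain ⟨n, ξ, h, rfl⟩ := exists_sum_tmul x
  obtain ⟨S, hS⟩ := exists_gram_factor (M := M) ξ
  rw [tform_sum hπ ξ hS]
  exact Finset.sum_nonneg fun k _ => CStarModule.inner_self_nonneg

/-- The algebraic left action on `E ⊗ K`. -/
lemma tform_lact_le (hπ : IsStarAction B π) (φ : M →ₙₐ[ℂ] (E →ₗ[ℂ] E))
    (hφ : ∀ a x y, rip M (φ a x) y = rip M x (φ (star a) y)) {a : M} (ha : ‖a‖ ≤ 1)
    (x : E ⊗[ℂ] K) :
    tform E B π ((φ a).rTensor K x) ((φ a).rTensor K x) ≤ tform E B π x x := by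
  have hadj (a : M) (x y : E ⊗[ℂ] K) :
      tform E B π ((φ a).rTensor K x) y = tform E B π x ((φ (star a)).rTensor K y) := by
    induction x using TensorProduct.induction_on with
    | zero => simp
    | add x₁ x₂ h₁ h₂ => simp [h₁, h₂]
    | tmul ξ h =>
      induction y using TensorProduct.induction_on with
      | zero => simp
      | add x₁ x₂ h₁ h₂ => simp only [map_add, h₁, h₂]
      | tmul η g => simp [hφ]
  obtain ⟨d, hd, hda⟩ := exists_sub_mul_self ha
  have hmul (a b : M) (x : E ⊗[ℂ] K) :
      (φ a).rTensor K ((φ b).rTensor K x) = (φ (a * b)).rTensor K x := by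
    rw [map_mul, ← LinearMap.comp_apply, ← LinearMap.rTensor_comp]; rfl
  have hnn := tform_self_nonneg hπ (x - (φ d).rTensor K x)
  have key : tform E B π (x - (φ d).rTensor K x) (x - (φ d).rTensor K x)
      = tform E B π x x - tform E B π ((φ a).rTensor K x) ((φ a).rTensor K x) := by
    have h1 : tform E B π ((φ a).rTensor K x) ((φ a).rTensor K x)
        = tform E B π x ((φ d).rTensor K x) + tform E B π x ((φ d).rTensor K x)
          - tform E B π x ((φ d).rTensor K ((φ d).rTensor K x)) := by
      rw [hadj, hmul, hmul, hda, map_sub, map_add, LinearMap.rTensor_sub, LinearMap.rTensor_add]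
      simp
    rw [h1]
    simp only [map_sub, LinearMap.sub_apply, hadj, hd]
    abel
  rw [key] at hnn
  exact sub_nonneg.1 hnn

end Form

/-- A `C*`-correspondence over `M`: a right Hilbert `M`-module (complete, with the norm coming from
the `M`-valued inner product) with a left action `φ = lact` of `M` by adjointable operators, which
is a `*`-homomorphism: `φ(a)* = φ(a*)`. -/
structure Correspondence (M : Type u) [NonUnitalCStarAlgebra M] [PartialOrder M]
    [StarOrderedRing M] where
  carrier : Type v
  [instNormedAddCommGroup : NormedAddCommGroup carrier]
  [instNormedSpace : NormedSpace ℂ carrier]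
  [instCompleteSpace : CompleteSpace carrier]
  [instSMul : SMul Mᵐᵒᵖ carrier]
  [instCStarModule : CStarModule Mᵐᵒᵖ carrier]
  lact : M →ₙₐ[ℂ] (carrier →L[ℂ] carrier)
  rip_lact : ∀ (a : M) (x y : carrier), rip M (lact a x) y = rip M x (lact (star a) y)

attribute [instance] Correspondence.instNormedAddCommGroup Correspondence.instNormedSpace
  Correspondence.instCompleteSpace Correspondence.instSMul Correspondence.instCStarModule

/-- A `*`-representation of `M` on a Hilbert space. -/
structure HilbertRep (M : Type u) [NonUnitalCStarAlgebra M] [PartialOrder M]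
    [StarOrderedRing M] where
  carrier : Type w
  [instNormedAddCommGroup : NormedAddCommGroup carrier]
  [instInnerProductSpace : InnerProductSpace ℂ carrier]
  [instCompleteSpace : CompleteSpace carrier]
  π : M →⋆ₙₐ[ℂ] (carrier →L[ℂ] carrier)

attribute [instance] HilbertRep.instNormedAddCommGroup HilbertRep.instInnerProductSpace
  HilbertRep.instCompleteSpace

section

variable {M : Type u} [NonUnitalCStarAlgebra M] [PartialOrder M] [StarOrderedRing M]

instance : CoeSort (Correspondence.{u, v} M) (Type v) := ⟨Correspondence.carrier⟩
instance : CoeSort (HilbertRep.{u, w} M) (Type w) := ⟨HilbertRep.carrier⟩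

/-- The left action is essential: the closed linear span of `φ(M)E` is `E`. -/
def Correspondence.IsEssential (E : Correspondence.{u, v} M) : Prop :=
  (Submodule.span ℂ {y : E | ∃ (a : M) (x : E), y = E.lact a x}).topologicalClosure = ⊤

/-- The representation is essential: the closed linear span of `π(M)K` is `K`. -/
def HilbertRep.IsEssential (K : HilbertRep.{u, w} M) : Prop :=
  (Submodule.span ℂ {y : K | ∃ (a : M) (x : K), y = K.π a x}).topologicalClosure = ⊤

lemma HilbertRep.isStarAction (K : HilbertRep.{u, w} M) :
    IsStarAction ℂ (K.π : M →ₙₐ[ℂ] (K →L[ℂ] K)) := by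
  intro a x y
  change inner ℂ (K.π a x) y = inner ℂ x (K.π (star a) y)
  rw [map_star, ContinuousLinearMap.star_eq_adjoint, ContinuousLinearMap.adjoint_inner_right]

/-- The left action, with values in plain linear maps. -/
def Correspondence.lactₗ (E : Correspondence.{u, v} M) : M →ₙₐ[ℂ] (E →ₗ[ℂ] E) where
  toFun a := (E.lact a : E →ₗ[ℂ] E)
  map_smul' c a := by simp
  map_zero' := by simp
  map_add' a b := by simp
  map_mul' a b := by ext; simp

/-! ### The Hilbert space `E ⊗_π K` -/

/-- The algebraic tensor product, with the semi-inner product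
`⟨ξ ⊗ h, η ⊗ g⟩ = ⟨h, π(⟨ξ, η⟩) g⟩`. -/
def PreTensor (E : Correspondence.{u, v} M) (K : HilbertRep.{u, w} M) : Type (max v w) :=
  E ⊗[ℂ] K

variable (E : Correspondence.{u, v} M) (K : HilbertRep.{u, w} M)

instance : AddCommGroup (PreTensor E K) := inferInstanceAs (AddCommGroup (E ⊗[ℂ] K))
instance : Module ℂ (PreTensor E K) := inferInstanceAs (Module ℂ (E ⊗[ℂ] K))

/-- The semi-inner product of `E ⊗ K`. -/
def hform : (E ⊗[ℂ] K) →ₗ⋆[ℂ] (E ⊗[ℂ] K) →ₗ[ℂ] ℂ :=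
  tform E ℂ (K.π : M →ₙₐ[ℂ] (K →L[ℂ] K))

@[reducible] def preTensorCore : PreInnerProductSpace.Core ℂ (PreTensor E K) where
  inner x y := hform E K x y
  conj_inner_symm x y := star_tform K.isStarAction _ _
  re_inner_nonneg x := (Complex.le_def.1 (tform_self_nonneg K.isStarAction x)).1
  add_left x y z := LinearMap.map_add₂ (hform E K) x y z
  smul_left x y c := LinearMap.map_smulₛₗ₂ (hform E K) c x y

instance : SeminormedAddCommGroup (PreTensor E K) :=
  @InnerProductSpace.Core.toSeminormedAddCommGroup ℂ _ _ _ _ (preTensorCore E K)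

instance : InnerProductSpace ℂ (PreTensor E K) := InnerProductSpace.ofCore (preTensorCore E K)

/-- The Hilbert space `E ⊗_π K` (the interior tensor product): the Hausdorff completion of the
algebraic tensor product for the semi-inner product `⟨ξ ⊗ h, η ⊗ g⟩ = ⟨h, π(⟨ξ, η⟩) g⟩`. -/
def HTensor : Type (max v w) := UniformSpace.Completion (PreTensor E K)

instance : NormedAddCommGroup (HTensor E K) :=
  inferInstanceAs (NormedAddCommGroup (UniformSpace.Completion (PreTensor E K)))
instance : InnerProductSpace ℂ (HTensor E K) :=
  inferInstanceAs (InnerProductSpace ℂ (UniformSpace.Completion (PreTensor E K)))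
instance : CompleteSpace (HTensor E K) :=
  inferInstanceAs (CompleteSpace (UniformSpace.Completion (PreTensor E K)))

/-- The canonical map from the algebraic tensor product. -/
def hι : (E ⊗[ℂ] K) →ₗ[ℂ] HTensor E K :=
  (UniformSpace.Completion.toComplL (𝕜 := ℂ) (E := PreTensor E K)).toLinearMap

variable {E K}

lemma denseRange_hι : DenseRange (hι E K) :=
  UniformSpace.Completion.denseRange_coe (α := PreTensor E K)

lemma inner_hι (x y : E ⊗[ℂ] K) : inner ℂ (hι E K x) (hι E K y) = hform E K x y :=
  UniformSpace.Completion.inner_coe (E := PreTensor E K) x y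

lemma norm_hι_sq (x : E ⊗[ℂ] K) : ‖hι E K x‖ ^ 2 = (hform E K x x).re := by
  rw [← inner_hι, ← inner_self_eq_norm_sq (𝕜 := ℂ)]; rfl

/-- The elementary tensor `ξ ⊗ h`. -/
def htmul (ξ : E) (h : K) : HTensor E K := hι E K (ξ ⊗ₜ h)

lemma inner_htmul (ξ η : E) (h g : K) :
    inner ℂ (htmul ξ h : HTensor E K) (htmul η g) = inner ℂ h (K.π (rip M ξ η) g) := by
  rw [htmul, htmul, inner_hι]; rfl

lemma htensor_ext {F : Type*} [NormedAddCommGroup F] [NormedSpace ℂ F]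
    {f g : HTensor E K →L[ℂ] F} (h : ∀ ξ x, f (htmul ξ x) = g (htmul ξ x)) : f = g := by
  have h1 : f.toLinearMap ∘ₗ hι E K = g.toLinearMap ∘ₗ hι E K := TensorProduct.ext' h
  ext x
  exact congrFun (denseRange_hι.equalizer f.continuous g.continuous
    (funext fun y => LinearMap.congr_fun h1 y)) x

/-- Extension of a bounded linear map from the algebraic tensor product. -/
def hlift {F : Type*} [NormedAddCommGroup F] [NormedSpace ℂ F] [CompleteSpace F]
    (f : (E ⊗[ℂ] K) →ₗ[ℂ] F) : HTensor E K →L[ℂ] F :=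
  f.extendOfNorm (hι E K)

lemma hlift_htmul {F : Type*} [NormedAddCommGroup F] [NormedSpace ℂ F] [CompleteSpace F]
    {f : (E ⊗[ℂ] K) →ₗ[ℂ] F} (hf : ∃ C, ∀ x, ‖f x‖ ≤ C * ‖hι E K x‖) (ξ : E) (h : K) :
    hlift f (htmul ξ h) = f (ξ ⊗ₜ h) :=
  LinearMap.extendOfNorm_eq denseRange_hι hf _

lemma norm_lact_hι_le (a : M) (x : E ⊗[ℂ] K) :
    ‖hι E K ((E.lactₗ a).rTensor K x)‖ ≤ ‖a‖ * ‖hι E K x‖ := by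
  rcases eq_or_ne a 0 with rfl | ha
  · simp
  set r : ℝ := ‖a‖ with hr
  have hr0 : 0 < r := norm_pos_iff.2 ha
  set b : M := ((r⁻¹ : ℝ) : ℂ) • a with hb
  have hbn : ‖b‖ ≤ 1 := by
    rw [hb, norm_smul, Complex.norm_real, Real.norm_eq_abs, abs_of_pos (inv_pos.2 hr0),
      inv_mul_cancel₀ hr0.ne']
  have hab : a = ((r : ℝ) : ℂ) • b := by
    rw [hb, smul_smul, ← Complex.ofReal_mul, mul_inv_cancel₀ hr0.ne']; simp
  have h1 := (Complex.le_def.1 (tform_lact_le K.isStarAction E.lactₗ E.rip_lact hbn x)).1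
  have h2 : ‖hι E K ((E.lactₗ b).rTensor K x)‖ ≤ ‖hι E K x‖ := by
    refine le_of_sq_le_sq ?_ (norm_nonneg _)
    rw [norm_hι_sq, norm_hι_sq]
    exact h1
  rw [hab, map_smul, LinearMap.rTensor_smul, LinearMap.smul_apply, map_smul, norm_smul,
    Complex.norm_real, Real.norm_eq_abs, abs_of_pos hr0]
  gcongr

/-- The operator `φ(a) ⊗ I` on `E ⊗_π K`. -/
def hact (a : M) : HTensor E K →L[ℂ] HTensor E K :=
  hlift (hι E K ∘ₗ (E.lactₗ a).rTensor K)

@[simp] lemma hact_htmul (a : M) (ξ : E) (h : K) :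
    hact a (htmul ξ h : HTensor E K) = htmul (E.lact a ξ) h :=
  hlift_htmul ⟨‖a‖, norm_lact_hι_le a⟩ ξ h

lemma htmul_add_left (ξ η : E) (h : K) :
    (htmul (ξ + η) h : HTensor E K) = htmul ξ h + htmul η h := by
  simp [htmul, TensorProduct.add_tmul]
lemma htmul_smul_left (c : ℂ) (ξ : E) (h : K) :
    (htmul (c • ξ) h : HTensor E K) = c • htmul ξ h := by
  rw [htmul, ← TensorProduct.smul_tmul', map_smul]; rfl
lemma htmul_add_right (ξ : E) (h g : K) :
    (htmul ξ (h + g) : HTensor E K) = htmul ξ h + htmul ξ g := by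
  simp [htmul, TensorProduct.tmul_add]
lemma htmul_smul_right (c : ℂ) (ξ : E) (h : K) :
    (htmul ξ (c • h) : HTensor E K) = c • htmul ξ h := by
  simp [htmul]
lemma htmul_zero_left (h : K) : (htmul 0 h : HTensor E K) = 0 := by simp [htmul]

/-- Two vectors with the same inner products against elementary tensors are equal. -/
lemma inner_ext {x y : HTensor E K}
    (h : ∀ ξ g, inner ℂ (htmul ξ g : HTensor E K) x = inner ℂ (htmul ξ g) y) : x = y := by
  have : innerSL ℂ x = innerSL ℂ y := by
    refine htensor_ext fun ξ g => ?_
    rw [innerSL_apply_apply, innerSL_apply_apply, ← inner_conj_symm, h, inner_conj_symm]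
  exact ext_inner_right ℂ fun v => DFunLike.congr_fun this v

variable (E K) in
/-- `E ⊗_π K` with the representation `a ↦ φ(a) ⊗ I` of `M`. -/
def tensorRep : HilbertRep.{u, max v w} M where
  carrier := HTensor E K
  π :=
    { toFun := hact
      map_smul' := fun c a => htensor_ext fun ξ h => by simp [htmul_smul_left]
      map_zero' := htensor_ext fun ξ h => by simp [htmul_zero_left]
      map_add' := fun a b => htensor_ext fun ξ h => by simp [htmul_add_left]
      map_mul' := fun a b => htensor_ext fun ξ h => by simp
      map_star' := fun a => by
        refine htensor_ext fun ξ h => inner_ext fun η g => ?_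
        rw [ContinuousLinearMap.star_eq_adjoint, ContinuousLinearMap.adjoint_inner_right,
          hact_htmul, hact_htmul, inner_htmul, inner_htmul, E.rip_lact] }

end

section

variable {M : Type u} [NonUnitalCStarAlgebra M] [PartialOrder M] [StarOrderedRing M]

section Facts
variable {E : Type v} [NormedAddCommGroup E] [NormedSpace ℂ E] [SMul Mᵐᵒᵖ E] [CStarModule Mᵐᵒᵖ E]

lemma rip_ext {x y : E} (h : ∀ z : E, rip M z x = rip M z y) : x = y := by
  have h1 : (inner Mᵐᵒᵖ (x - y) (x - y) : Mᵐᵒᵖ) = 0 := by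
    have := MulOpposite.unop_injective (h (x - y))
    rw [CStarModule.inner_sub_right, this, sub_self]
  exact sub_eq_zero.1 (CStarModule.inner_self.1 h1)

/-- The right action of `a` as a linear map. -/
def ractₗ (E : Type v) [NormedAddCommGroup E] [NormedSpace ℂ E] [SMul Mᵐᵒᵖ E]
    [CStarModule Mᵐᵒᵖ E] (a : M) : E →ₗ[ℂ] E where
  toFun x := MulOpposite.op a • x
  map_add' x y := rip_ext (M := M) fun z => by simp [rip_rsmul_right, rip_add_right, add_mul]
  map_smul' c x := rip_ext (M := M) fun z => by simp [rip_rsmul_right, rip_smul_right, smul_mul_assoc]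

lemma norm_sq_rip (x : E) : ‖x‖ ^ 2 = ‖rip M x x‖ := CStarModule.norm_sq_eq Mᵐᵒᵖ

end Facts

variable (E : Correspondence.{u, v} M) (F : Correspondence.{u, v'} M)

lemma Correspondence.isStarAction : IsStarAction Mᵐᵒᵖ F.lact :=
  fun a x y => MulOpposite.unop_injective (F.rip_lact a x y)

/-! ### The interior tensor product `E ⊗_φ F` of correspondences -/

/-- The `M`-valued semi-inner product `⟨ξ ⊗ η, ξ' ⊗ η'⟩ = ⟨η, φ(⟨ξ, ξ'⟩) η'⟩`. -/
def mform (x y : E ⊗[ℂ] F) : M := (tform E Mᵐᵒᵖ F.lact x y).unop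

variable {E F}

lemma mform_self_nonneg (x : E ⊗[ℂ] F) : 0 ≤ mform E F x x :=
  tform_self_nonneg F.isStarAction x
lemma star_mform (x y : E ⊗[ℂ] F) : star (mform E F x y) = mform E F y x := by
  rw [mform, mform, ← star_tform F.isStarAction x y]; rfl
lemma mform_add_right (x y z : E ⊗[ℂ] F) :
    mform E F x (y + z) = mform E F x y + mform E F x z := by simp [mform]
lemma mform_add_left (x y z : E ⊗[ℂ] F) :
    mform E F (x + y) z = mform E F x z + mform E F y z := by simp [mform]
lemma mform_smul_right (c : ℂ) (x y : E ⊗[ℂ] F) :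
    mform E F x (c • y) = c • mform E F x y := by simp [mform]
lemma mform_smul_left (c : ℂ) (x y : E ⊗[ℂ] F) :
    mform E F (c • x) y = star c • mform E F x y := by simp [mform]

lemma mform_ract_right (a : M) (x y : E ⊗[ℂ] F) :
    mform E F x ((ractₗ F a).lTensor E y) = mform E F x y * a := by
  induction x using TensorProduct.induction_on with
  | zero => simp [mform]
  | add x₁ x₂ h₁ h₂ => rw [mform_add_left, mform_add_left, h₁, h₂, add_mul]
  | tmul ξ h =>
    induction y using TensorProduct.induction_on with
    | zero => simp [mform]
    | add x₁ x₂ h₁ h₂ => rw [map_add, mform_add_right, mform_add_right, h₁, h₂, add_mul]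
    | tmul η g =>
      change rip M h (F.lact (rip M ξ η) (MulOpposite.op a • g)) = rip M h (F.lact (rip M ξ η) g) * a
      rw [← star_star (rip M ξ η), ← F.rip_lact, rip_rsmul_right, F.rip_lact]

lemma mform_ract_left (a : M) (x y : E ⊗[ℂ] F) :
    mform E F ((ractₗ F a).lTensor E x) y = star a * mform E F x y := by
  rw [← star_mform, mform_ract_right, star_mul, star_mform]

lemma norm_mform_sq_le (x y : E ⊗[ℂ] F) :
    ‖mform E F x y‖ ^ 2 ≤ ‖mform E F x x‖ * ‖mform E F y y‖ := by
  set c := mform E F x y with hc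
  have key : ∀ t : ℝ, ‖mform E F x x‖ < t → ‖c‖ ^ 2 ≤ t * ‖mform E F y y‖ := by
    intro t ht
    have ht0 : 0 < t := (norm_nonneg _).trans_lt ht
    have h1 := mform_self_nonneg ((ractₗ F c).lTensor E x + (-(t : ℂ)) • y)
    simp only [mform_add_left, mform_add_right, mform_smul_left, mform_smul_right,
      mform_ract_left, mform_ract_right, ← hc] at h1
    rw [← star_mform x y, ← hc] at h1
    have h2 : star c * mform E F x x * c ≤ t • (star c * c) := by
      refine (CStarAlgebra.star_left_conjugate_le_norm_smul
        (IsSelfAdjoint.of_nonneg (mform_self_nonneg x))).trans ?_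
      exact smul_le_smul_of_nonneg_right ht.le (star_mul_self_nonneg c)
    have h3 : t • (star c * c) ≤ t • (t • mform E F y y) := by
      rw [← sub_nonneg] at h2 ⊢
      refine (add_nonneg h1 h2).trans_eq ?_
      simp only [star_neg, Complex.star_def, Complex.conj_ofReal, neg_smul, smul_neg, add_mul,
        smul_add, Complex.coe_smul, mul_assoc, smul_mul_assoc, neg_mul, neg_neg]
      abel
    have h4 : star c * c ≤ t • mform E F y y := (smul_le_smul_iff_of_pos_left ht0).1 h3
    have h5 := CStarAlgebra.norm_le_norm_of_nonneg_of_le (star_mul_self_nonneg c) h4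
    rwa [CStarRing.norm_star_mul_self, norm_smul, Real.norm_eq_abs, abs_of_pos ht0, ← sq] at h5
  have hlim : Filter.Tendsto (fun t : ℝ => t * ‖mform E F y y‖)
      (nhdsWithin ‖mform E F x x‖ (Set.Ioi ‖mform E F x x‖))
      (nhds (‖mform E F x x‖ * ‖mform E F y y‖)) :=
    ((continuous_id.mul continuous_const).tendsto _).mono_left nhdsWithin_le_nhds
  exact ge_of_tendsto hlim (Filter.eventually_of_mem self_mem_nhdsWithin key)

variable (E F)

/-- The algebraic tensor product, with the seminorm `‖x‖ = ‖⟨x, x⟩‖^{1/2}`. -/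
def MPreTensor : Type (max v v') := E ⊗[ℂ] F

instance : AddCommGroup (MPreTensor E F) := inferInstanceAs (AddCommGroup (E ⊗[ℂ] F))
instance : Module ℂ (MPreTensor E F) := inferInstanceAs (Module ℂ (E ⊗[ℂ] F))
instance : Norm (MPreTensor E F) := ⟨fun x => √‖mform E F x x‖⟩

variable {E F}

lemma mpre_norm_sq (x : MPreTensor E F) : ‖x‖ ^ 2 = ‖mform E F x x‖ :=
  Real.sq_sqrt (norm_nonneg _)

lemma mpre_norm_mform_le (x y : MPreTensor E F) : ‖mform E F x y‖ ≤ ‖x‖ * ‖y‖ := by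
  refine le_of_sq_le_sq ?_ (mul_nonneg (Real.sqrt_nonneg _) (Real.sqrt_nonneg _))
  rw [mul_pow, mpre_norm_sq, mpre_norm_sq]
  exact norm_mform_sq_le x y

lemma norm_mform_smul (c : ℂ) (x : E ⊗[ℂ] F) :
    ‖mform E F (c • x) (c • x)‖ = ‖c‖ ^ 2 * ‖mform E F x x‖ := by
  rw [mform_smul_left, mform_smul_right, norm_smul, norm_smul, norm_star]
  ring

lemma norm_mform_add (x y : E ⊗[ℂ] F) : ‖mform E F (x + y) (x + y)‖ ≤
    ‖mform E F x x‖ + ‖mform E F x y‖ + ‖mform E F y x‖ + ‖mform E F y y‖ := by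
  rw [mform_add_left, mform_add_right, mform_add_right, ← add_assoc]
  exact norm_add₄_le

lemma mpreCore : SeminormedSpace.Core ℂ (MPreTensor E F) where
  norm_nonneg x := Real.sqrt_nonneg _
  norm_smul c x := by
    refine (sq_eq_sq₀ (Real.sqrt_nonneg _) (mul_nonneg (norm_nonneg _) (Real.sqrt_nonneg _))).1 ?_
    rw [mul_pow]
    have h := norm_mform_smul (E := E) (F := F) c x
    rw [← mpre_norm_sq x] at h
    exact (mpre_norm_sq (c • x)).trans h
  norm_triangle x y := by
    refine le_of_sq_le_sq ?_ (add_nonneg (Real.sqrt_nonneg _) (Real.sqrt_nonneg _))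
    have h1 := norm_mform_add (E := E) (F := F) x y
    have h2 := mpre_norm_mform_le x y
    have h3 := mpre_norm_mform_le y x
    have h4 := mpre_norm_sq x
    have h5 := mpre_norm_sq y
    refine (mpre_norm_sq (x + y)).trans_le (h1.trans ?_)
    rw [← h4, ← h5]
    nlinarith

instance : SeminormedAddCommGroup (MPreTensor E F) := SeminormedAddCommGroup.ofCore mpreCore
instance : NormedSpace ℂ (MPreTensor E F) where
  norm_smul_le c x := (mpreCore.norm_smul c x).le

variable (E F)

/-- The interior tensor product `E ⊗_φ F`: the Hausdorff completion of the algebraic tensor product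
for the `M`-valued semi-inner product `⟨ξ ⊗ η, ξ' ⊗ η'⟩ = ⟨η, φ(⟨ξ, ξ'⟩) η'⟩`. -/
def MTensor : Type (max v v') := UniformSpace.Completion (MPreTensor E F)

instance : NormedAddCommGroup (MTensor E F) :=
  inferInstanceAs (NormedAddCommGroup (UniformSpace.Completion (MPreTensor E F)))
instance : NormedSpace ℂ (MTensor E F) :=
  inferInstanceAs (NormedSpace ℂ (UniformSpace.Completion (MPreTensor E F)))
instance : CompleteSpace (MTensor E F) :=
  inferInstanceAs (CompleteSpace (UniformSpace.Completion (MPreTensor E F)))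

/-- The canonical map from the algebraic tensor product. -/
def mι : (E ⊗[ℂ] F) →ₗ[ℂ] MTensor E F :=
  (UniformSpace.Completion.toComplL (𝕜 := ℂ) (E := MPreTensor E F)).toLinearMap

variable {E F}

lemma denseRange_mι : DenseRange (mι E F) :=
  UniformSpace.Completion.denseRange_coe (α := MPreTensor E F)

lemma norm_mι_sq (x : E ⊗[ℂ] F) : ‖mι E F x‖ ^ 2 = ‖mform E F x x‖ := by
  exact (congrArg (· ^ 2) (UniformSpace.Completion.norm_coe (E := MPreTensor E F) x)).trans
    (mpre_norm_sq x)

end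

section

variable {M : Type u} [NonUnitalCStarAlgebra M] [PartialOrder M] [StarOrderedRing M]
variable {E : Correspondence.{u, v} M} {F : Correspondence.{u, v'} M}

variable (E F) in
/-- The form as a biadditive map. -/
def mformAdd : MPreTensor E F →+ MPreTensor E F →+ Mᵐᵒᵖ where
  toFun x := (tform E Mᵐᵒᵖ F.lact x).toAddMonoidHom
  map_zero' := by ext x; exact LinearMap.map_zero₂ (tform E Mᵐᵒᵖ F.lact) x
  map_add' x y := by ext z; exact LinearMap.map_add₂ (tform E Mᵐᵒᵖ F.lact) x y z

variable (E F) in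
/-- The form as a bounded sesquilinear map. -/
def mformL : MPreTensor E F →L⋆[ℂ] MPreTensor E F →L[ℂ] Mᵐᵒᵖ :=
  LinearMap.mkContinuous₂ (σ₁₃ := starRingEnd ℂ) (tform E Mᵐᵒᵖ F.lact) 1 fun x y => by
    rw [one_mul]; exact mpre_norm_mform_le x y

lemma continuous_mformAdd :
    Continuous fun p : MPreTensor E F × MPreTensor E F => mformAdd E F p.1 p.2 := by
  have : Continuous fun p : MPreTensor E F × MPreTensor E F => mformL E F p.1 p.2 := by fun_prop
  exact this

/-- The `M`-valued inner product of `E ⊗_φ F` (with values in `Mᵐᵒᵖ`). -/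
instance : Inner Mᵐᵒᵖ (MTensor E F) where
  inner := Function.curry (((UniformSpace.Completion.isDenseInducing_toCompl
    (MPreTensor E F)).prodMap (UniformSpace.Completion.isDenseInducing_toCompl
      (MPreTensor E F))).extend fun p => mformAdd E F p.1 p.2)

lemma mrip_mι (x y : E ⊗[ℂ] F) : rip M (mι E F x) (mι E F y) = mform E F x y :=
  congrArg MulOpposite.unop (((UniformSpace.Completion.isDenseInducing_toCompl
    (MPreTensor E F)).prodMap (UniformSpace.Completion.isDenseInducing_toCompl
      (MPreTensor E F))).extend_eq continuous_mformAdd (x, y))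

lemma continuous_minner :
    Continuous fun p : MTensor E F × MTensor E F => (inner Mᵐᵒᵖ p.1 p.2 : Mᵐᵒᵖ) :=
  (UniformSpace.Completion.isDenseInducing_toCompl (MPreTensor E F)).extend_Z_bilin
    (UniformSpace.Completion.isDenseInducing_toCompl (MPreTensor E F)) continuous_mformAdd

lemma continuous_mrip {X : Type*} [TopologicalSpace X] {f g : X → MTensor E F}
    (hf : Continuous f) (hg : Continuous g) : Continuous fun x => rip M (f x) (g x) :=
  MulOpposite.continuous_unop.comp (continuous_minner.comp (hf.prodMk hg))

lemma crl (x : MTensor E F) : Continuous fun y : MTensor E F => rip M x y :=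
  continuous_mrip continuous_const continuous_id
lemma crr (y : MTensor E F) : Continuous fun x : MTensor E F => rip M x y :=
  continuous_mrip continuous_id continuous_const
lemma crd : Continuous fun x : MTensor E F => rip M x x :=
  continuous_mrip continuous_id continuous_id

/-- The right action of `a` on `E ⊗_φ F`, `(ξ ⊗ η) a = ξ ⊗ (η a)`. -/
def mract (a : M) : MTensor E F →L[ℂ] MTensor E F :=
  (mι E F ∘ₗ (ractₗ F a).lTensor E).extendOfNorm (mι E F)

lemma mract_mι (a : M) (x : E ⊗[ℂ] F) :
    mract a (mι E F x) = mι E F ((ractₗ F a).lTensor E x) := by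
  refine LinearMap.extendOfNorm_eq denseRange_mι ⟨‖a‖, fun x => ?_⟩ x
  refine le_of_sq_le_sq ?_ (by positivity)
  rw [mul_pow, LinearMap.comp_apply, norm_mι_sq, norm_mι_sq, mform_ract_left, mform_ract_right]
  calc ‖star a * (mform E F x x * a)‖ ≤ ‖star a‖ * (‖mform E F x x‖ * ‖a‖) :=
        (norm_mul_le _ _).trans (by gcongr; exact norm_mul_le _ _)
    _ = _ := by rw [norm_star]; ring

instance : SMul Mᵐᵒᵖ (MTensor E F) := ⟨fun a x => mract a.unop x⟩

lemma mtensor_ind {p : MTensor E F → Prop} (x : MTensor E F) (hp : IsClosed {x | p x})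
    (h : ∀ x : E ⊗[ℂ] F, p (mι E F x)) : p x :=
  denseRange_mι.induction_on x hp h

lemma mrip_add_right (x y z : MTensor E F) : rip M x (y + z) = rip M x y + rip M x z := by
  refine mtensor_ind (p := fun x => rip M x (y + z) = rip M x y + rip M x z) x
    (isClosed_eq (crr _) ((crr _).add (crr _))) fun x => ?_
  refine mtensor_ind (p := fun y => rip M (mι E F x) (y + z) = rip M (mι E F x) y + rip M _ z) y
    (isClosed_eq ((crl _).comp (continuous_id.add continuous_const))
      ((crl _).add continuous_const)) fun y => ?_
  refine mtensor_ind (p := fun z => rip M (mι E F x) (mι E F y + z) = rip M _ _ + rip M _ z) z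
    (isClosed_eq ((crl _).comp (continuous_const.add continuous_id))
      (continuous_const.add (crl _))) fun z => ?_
  rw [← map_add, mrip_mι, mrip_mι, mrip_mι, mform_add_right]

lemma mrip_self_nonneg (x : MTensor E F) : 0 ≤ rip M x x := by
  refine mtensor_ind (p := fun x => 0 ≤ rip M x x) x (CStarAlgebra.isClosed_nonneg.preimage crd)
    fun x => ?_
  rw [mrip_mι]
  exact mform_self_nonneg x

lemma mnorm_sq (x : MTensor E F) : ‖x‖ ^ 2 = ‖rip M x x‖ := by
  refine mtensor_ind (p := fun x => ‖x‖ ^ 2 = ‖rip M x x‖) x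
    (isClosed_eq (continuous_norm.pow 2) crd.norm) fun x => ?_
  rw [mrip_mι, norm_mι_sq]

lemma mrip_ract (a : M) (x y : MTensor E F) : rip M x (mract a y) = rip M x y * a := by
  refine mtensor_ind (p := fun x => rip M x (mract a y) = rip M x y * a) x
    (isClosed_eq (crr _) ((crr _).mul continuous_const)) fun x => ?_
  refine mtensor_ind (p := fun y => rip M (mι E F x) (mract a y) = rip M _ y * a) y
    (isClosed_eq ((crl _).comp (mract a).continuous) ((crl _).mul continuous_const)) fun y => ?_
  rw [mract_mι, mrip_mι, mrip_mι, mform_ract_right]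

lemma mrip_smul (c : ℂ) (x y : MTensor E F) : rip M x (c • y) = c • rip M x y := by
  refine mtensor_ind (p := fun x => rip M x (c • y) = c • rip M x y) x
    (isClosed_eq (crr _) ((crr _).const_smul c)) fun x => ?_
  refine mtensor_ind (p := fun y => rip M (mι E F x) (c • y) = c • rip M _ y) y
    (isClosed_eq ((crl _).comp (continuous_const_smul c)) ((crl _).const_smul c)) fun y => ?_
  rw [← map_smul, mrip_mι, mrip_mι, mform_smul_right]

lemma mrip_zero_right (x : MTensor E F) : rip M x 0 = 0 := by
  simpa using mrip_smul 0 x 0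

lemma mrip_star (x y : MTensor E F) : star (rip M x y) = rip M y x := by
  refine mtensor_ind (p := fun x => star (rip M x y) = rip M y x) x
    (isClosed_eq (crr _).star (crl _)) fun x => ?_
  refine mtensor_ind (p := fun y => star (rip M (mι E F x) y) = rip M y _) y
    (isClosed_eq (crl _).star (crr _)) fun y => ?_
  rw [mrip_mι, mrip_mι, star_mform]

lemma mrip_add_left (x y z : MTensor E F) : rip M (x + y) z = rip M x z + rip M y z := by
  rw [← mrip_star, mrip_add_right, star_add, mrip_star, mrip_star]
lemma mrip_zero_left (x : MTensor E F) : rip M 0 x = 0 := by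
  rw [← mrip_star, mrip_zero_right, star_zero]

instance : CStarModule Mᵐᵒᵖ (MTensor E F) where
  inner_add_right {x y z} := MulOpposite.unop_injective (mrip_add_right x y z)
  inner_self_nonneg {x} := mrip_self_nonneg x
  inner_self {x} := by
    have h := mnorm_sq x
    refine ⟨fun h0 => ?_, fun h0 => ?_⟩
    · have h1 : rip M x x = 0 := congrArg MulOpposite.unop h0
      rw [h1, norm_zero] at h
      exact norm_eq_zero.1 (pow_eq_zero_iff two_ne_zero |>.1 h)
    · rw [h0, norm_zero, zero_pow two_ne_zero, eq_comm, norm_eq_zero] at h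
      rw [h0]
      exact MulOpposite.unop_injective h
  inner_op_smul_right {a x y} := MulOpposite.unop_injective (mrip_ract a.unop x y)
  inner_smul_right_complex {c x y} := MulOpposite.unop_injective (mrip_smul c x y)
  star_inner x y := MulOpposite.unop_injective (mrip_star x y)
  norm_eq_sqrt_norm_inner_self x := by
    rw [eq_comm, Real.sqrt_eq_iff_mul_self_eq (norm_nonneg _) (norm_nonneg _), ← sq]
    exact (mnorm_sq x).symm

/-- The elementary tensor `ξ ⊗ η`. -/
def mtmul (ξ : E) (η : F) : MTensor E F := mι E F (ξ ⊗ₜ η)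

lemma rip_mtmul (ξ ξ' : E) (η η' : F) :
    rip M (mtmul ξ η : MTensor E F) (mtmul ξ' η') = rip M η (F.lact (rip M ξ ξ') η') :=
  mrip_mι _ _

lemma mtensor_ext {V : Type*} [NormedAddCommGroup V] [NormedSpace ℂ V]
    {f g : MTensor E F →L[ℂ] V} (h : ∀ ξ x, f (mtmul ξ x) = g (mtmul ξ x)) : f = g := by
  have h1 : f.toLinearMap ∘ₗ mι E F = g.toLinearMap ∘ₗ mι E F := TensorProduct.ext' h
  ext x
  exact congrFun (denseRange_mι.equalizer f.continuous g.continuous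
    (funext fun y => LinearMap.congr_fun h1 y)) x

lemma norm_lact_mι_le (a : M) (x : E ⊗[ℂ] F) :
    ‖mι E F ((E.lactₗ a).rTensor F x)‖ ≤ ‖a‖ * ‖mι E F x‖ := by
  rcases eq_or_ne a 0 with rfl | ha
  · simp
  set r : ℝ := ‖a‖ with hr
  have hr0 : 0 < r := norm_pos_iff.2 ha
  set b : M := ((r⁻¹ : ℝ) : ℂ) • a with hb
  have hbn : ‖b‖ ≤ 1 := by
    rw [hb, norm_smul, Complex.norm_real, Real.norm_eq_abs, abs_of_pos (inv_pos.2 hr0),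
      inv_mul_cancel₀ hr0.ne']
  have hab : a = ((r : ℝ) : ℂ) • b := by
    rw [hb, smul_smul, ← Complex.ofReal_mul, mul_inv_cancel₀ hr0.ne']; simp
  have h1 : mform E F ((E.lactₗ b).rTensor F x) ((E.lactₗ b).rTensor F x) ≤ mform E F x x :=
    tform_lact_le F.isStarAction E.lactₗ E.rip_lact hbn x
  have h2 : ‖mι E F ((E.lactₗ b).rTensor F x)‖ ≤ ‖mι E F x‖ := by
    refine le_of_sq_le_sq ?_ (norm_nonneg _)
    rw [norm_mι_sq, norm_mι_sq]
    exact CStarAlgebra.norm_le_norm_of_nonneg_of_le (mform_self_nonneg _) h1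
  rw [hab, map_smul, LinearMap.rTensor_smul, LinearMap.smul_apply, map_smul, norm_smul,
    Complex.norm_real, Real.norm_eq_abs, abs_of_pos hr0]
  gcongr

/-- The left action `φ(a) ⊗ I` on `E ⊗_φ F`. -/
def mlact (a : M) : MTensor E F →L[ℂ] MTensor E F :=
  (mι E F ∘ₗ (E.lactₗ a).rTensor F).extendOfNorm (mι E F)

@[simp] lemma mlact_mtmul (a : M) (ξ : E) (η : F) :
    mlact a (mtmul ξ η : MTensor E F) = mtmul (E.lact a ξ) η :=
  LinearMap.extendOfNorm_eq denseRange_mι ⟨‖a‖, norm_lact_mι_le a⟩ _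

lemma mtmul_add_left (ξ ξ' : E) (η : F) :
    (mtmul (ξ + ξ') η : MTensor E F) = mtmul ξ η + mtmul ξ' η := by
  simp [mtmul, TensorProduct.add_tmul]
lemma mtmul_smul_left (c : ℂ) (ξ : E) (η : F) :
    (mtmul (c • ξ) η : MTensor E F) = c • mtmul ξ η := by
  rw [mtmul, ← TensorProduct.smul_tmul', map_smul]; rfl
lemma mtmul_zero_left (η : F) : (mtmul 0 η : MTensor E F) = 0 := by simp [mtmul]

lemma mtensor_ind₂ {p : MTensor E F → Prop} (x : MTensor E F) (hp : IsClosed {x | p x})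
    (h0 : p 0) (hadd : ∀ x y, p x → p y → p (x + y)) (h : ∀ ξ η, p (mtmul ξ η)) : p x := by
  refine mtensor_ind x hp fun x => ?_
  induction x using TensorProduct.induction_on with
  | zero => simpa using h0
  | add x y hx hy => rw [map_add]; exact hadd _ _ hx hy
  | tmul ξ η => exact h ξ η

lemma mrip_lact (a : M) (x y : MTensor E F) :
    rip M (mlact a x) y = rip M x (mlact (star a) y) := by
  refine mtensor_ind₂ (p := fun x => rip M (mlact a x) y = rip M x (mlact (star a) y)) x
    (isClosed_eq ((crr _).comp (mlact a).continuous) (crr _))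
    (by rw [map_zero, mrip_zero_left, mrip_zero_left])
    (fun x x' h h' => by rw [map_add, mrip_add_left, mrip_add_left, h, h']) fun ξ η => ?_
  refine mtensor_ind₂ (p := fun y => rip M (mlact a (mtmul ξ η)) y = rip M _ (mlact (star a) y)) y
    (isClosed_eq (crl _) ((crl _).comp (mlact _).continuous))
    (by rw [map_zero, mrip_zero_right, mrip_zero_right])
    (fun x x' h h' => by rw [map_add, mrip_add_right, mrip_add_right, h, h']) fun ξ' η' => ?_
  rw [mlact_mtmul, mlact_mtmul, rip_mtmul, rip_mtmul, E.rip_lact]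

variable (E F) in
/-- The left action on `E ⊗_φ F` as an algebra homomorphism. -/
def mlactHom : M →ₙₐ[ℂ] (MTensor E F →L[ℂ] MTensor E F) where
  toFun := mlact
  map_smul' c a := mtensor_ext fun ξ h => by
    rw [smul_apply]; simp [mtmul_smul_left]
  map_zero' := mtensor_ext fun ξ h => by simp [mtmul_zero_left]
  map_add' a b := mtensor_ext fun ξ h => by simp [mtmul_add_left]
  map_mul' a b := mtensor_ext fun ξ h => by simp

variable (E F) in
/-- The correspondence `E ⊗_φ F`. -/
def Correspondence.tensor : Correspondence.{u, max v v'} M where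
  carrier := MTensor E F
  lact := mlactHom E F
  rip_lact := mrip_lact

end

section

variable {M : Type u} [NonUnitalCStarAlgebra M] [PartialOrder M] [StarOrderedRing M]

/-! ### Intertwiners and the operators `I_E ⊗ X` -/

/-- A bounded operator `X` intertwining two representations: `X π(a) = π'(a) X`. -/
structure Intertwiner (K : HilbertRep.{u, w} M) (L : HilbertRep.{u, w'} M) where
  toCLM : K →L[ℂ] L
  comm : ∀ (a : M) (x : K), toCLM (K.π a x) = L.π a (toCLM x)

variable {K : HilbertRep.{u, w} M} {L : HilbertRep.{u, w'} M} {N : HilbertRep.{u, w''} M}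

lemma HilbertRep.inner_π (K : HilbertRep.{u, w} M) (a : M) (x y : K) :
    inner ℂ (K.π a x) y = inner ℂ x (K.π (star a) y) := K.isStarAction a x y

/-- Composition of intertwiners. -/
def Intertwiner.comp (Y : Intertwiner L N) (X : Intertwiner K L) : Intertwiner K N where
  toCLM := Y.toCLM ∘L X.toCLM
  comm a x := by simp [X.comm, Y.comm]

/-- The adjoint of an intertwiner. -/
def Intertwiner.adjoint (X : Intertwiner K L) : Intertwiner L K where
  toCLM := ContinuousLinearMap.adjoint X.toCLM
  comm a x := by
    refine ext_inner_left ℂ fun y => ?_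
    rw [ContinuousLinearMap.adjoint_inner_right, ← star_star a, ← L.inner_π, ← K.inner_π,
      ContinuousLinearMap.adjoint_inner_right, X.comm]

variable (E : Correspondence.{u, v} M) {F : Correspondence.{u, v'} M}

lemma hform_sum {n : ℕ} (ξ : Fin n → E) {S : CStarMatrix (Fin n) (Fin n) M}
    (hS : (CStarMatrix.ofMatrix fun i j => rip M (ξ i) (ξ j)) = star S * S) (h : Fin n → K) :
    ‖hι E K (∑ i, ξ i ⊗ₜ h i)‖ ^ 2 = ∑ k, ‖∑ i, K.π (S k i) (h i)‖ ^ 2 := by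
  have h1 := congrArg Complex.re (tform_sum K.isStarAction ξ hS h h)
  rw [norm_hι_sq]
  refine h1.trans ?_
  rw [Complex.re_sum]
  exact Finset.sum_congr rfl fun k _ => inner_self_eq_norm_sq (𝕜 := ℂ) _

lemma norm_ampliate_le (X : Intertwiner K L) (x : E ⊗[ℂ] K) :
    ‖hι E L (X.toCLM.toLinearMap.lTensor E x)‖ ≤ ‖X.toCLM‖ * ‖hι E K x‖ := by
  obtain ⟨n, ξ, h, rfl⟩ := exists_sum_tmul x
  obtain ⟨S, hS⟩ := exists_gram_factor (M := M) ξ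
  refine le_of_sq_le_sq ?_ (by positivity)
  have h1 : X.toCLM.toLinearMap.lTensor E (∑ i, ξ i ⊗ₜ h i) = ∑ i, ξ i ⊗ₜ X.toCLM (h i) := by
    simp
  rw [h1, mul_pow, hform_sum E ξ hS, hform_sum E ξ hS, Finset.mul_sum]
  refine Finset.sum_le_sum fun k _ => ?_
  have h2 : ∑ i, L.π (S k i) (X.toCLM (h i)) = X.toCLM (∑ i, K.π (S k i) (h i)) := by
    simp [X.comm]
  rw [h2, ← mul_pow]
  exact pow_le_pow_left₀ (norm_nonneg _) (X.toCLM.le_opNorm _) 2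

/-- The operator `I_E ⊗ X : E ⊗ K → E ⊗ L` for an intertwiner `X : K → L`. -/
def Intertwiner.ampliate (X : Intertwiner K L) : Intertwiner (tensorRep E K) (tensorRep E L) where
  toCLM := hlift (hι E L ∘ₗ X.toCLM.toLinearMap.lTensor E)
  comm a x := by
    have h (ξ : E) (h : K) : hlift (hι E L ∘ₗ X.toCLM.toLinearMap.lTensor E) (htmul ξ h)
        = (htmul ξ (X.toCLM h) : HTensor E L) := hlift_htmul ⟨_, norm_ampliate_le E X⟩ ξ h
    refine DFunLike.congr_fun (f := hlift (hι E L ∘ₗ X.toCLM.toLinearMap.lTensor E) ∘L hact a)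
      (g := hact a ∘L hlift (hι E L ∘ₗ X.toCLM.toLinearMap.lTensor E))
      (htensor_ext fun ξ g => ?_) x
    simp [h]

lemma ampliate_htmul (X : Intertwiner K L) (ξ : E) (h : K) :
    (X.ampliate E).toCLM (htmul ξ h : HTensor E K) = (htmul ξ (X.toCLM h) : HTensor E L) :=
  hlift_htmul ⟨_, norm_ampliate_le E X⟩ ξ h

/-! ### Isomorphisms of correspondences and the operators `t ⊗ I_K` -/

/-- A unitary isomorphism of correspondences: a linear bijection preserving the `M`-valued inner
product (hence the right action) and the left action. -/
structure CorrIso (E : Correspondence.{u, v} M) (F : Correspondence.{u, v'} M) where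
  toEquiv : E ≃ₗ[ℂ] F
  rip_map : ∀ x y : E, rip M (toEquiv x) (toEquiv y) = rip M x y
  map_lact : ∀ (a : M) (x : E), toEquiv (E.lact a x) = F.lact a (toEquiv x)

/-- The identity isomorphism. -/
def CorrIso.refl : CorrIso E E := ⟨LinearEquiv.refl ℂ E, fun _ _ => rfl, fun _ _ => rfl⟩

variable {E}

/-- The inverse isomorphism. -/
def CorrIso.symm (t : CorrIso E F) : CorrIso F E where
  toEquiv := t.toEquiv.symm
  rip_map x y := by
    rw [← t.rip_map, LinearEquiv.apply_symm_apply, LinearEquiv.apply_symm_apply]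
  map_lact a x := by
    rw [LinearEquiv.symm_apply_eq, t.map_lact, LinearEquiv.apply_symm_apply]

lemma hform_rTensor (t : CorrIso E F) (x y : E ⊗[ℂ] K) :
    hform F K (t.toEquiv.toLinearMap.rTensor K x) (t.toEquiv.toLinearMap.rTensor K y)
      = hform E K x y := by
  induction x using TensorProduct.induction_on with
  | zero => simp
  | add x₁ x₂ h₁ h₂ => simp only [map_add, LinearMap.add_apply, h₁, h₂]
  | tmul ξ h =>
    induction y using TensorProduct.induction_on with
    | zero => simp
    | add x₁ x₂ h₁ h₂ => simp only [map_add, h₁, h₂]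
    | tmul η g =>
      change inner ℂ h (K.π (rip M (t.toEquiv ξ) (t.toEquiv η)) g) = inner ℂ h (K.π (rip M ξ η) g)
      rw [t.rip_map]

variable (K) in
/-- The operator `t ⊗ I_K : E ⊗ K → F ⊗ K` for an isomorphism `t : E → F`. -/
def CorrIso.ampliate (t : CorrIso E F) : HTensor E K →L[ℂ] HTensor F K :=
  hlift (hι F K ∘ₗ t.toEquiv.toLinearMap.rTensor K)

lemma CorrIso.ampliate_htmul (t : CorrIso E F) (ξ : E) (h : K) :
    t.ampliate K (htmul ξ h) = htmul (t.toEquiv ξ) h :=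
  hlift_htmul ⟨1, fun x => by
    rw [one_mul]
    refine le_of_sq_le_sq ?_ (norm_nonneg _)
    rw [LinearMap.comp_apply, norm_hι_sq, norm_hι_sq, hform_rTensor]⟩ ξ h

lemma norm_htmul_le (ξ : E) (h : K) : ‖(htmul ξ h : HTensor E K)‖ ≤ ‖ξ‖ * ‖h‖ := by
  refine le_of_sq_le_sq ?_ (by positivity)
  rw [← inner_self_eq_norm_sq (𝕜 := ℂ), inner_htmul, mul_pow, norm_sq_rip (M := M) ξ]
  refine (RCLike.re_le_norm _).trans ((norm_inner_le_norm _ _).trans ?_)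
  have h1 := (K.π (rip M ξ ξ)).le_of_opNorm_le
    (NonUnitalStarAlgHom.norm_apply_le K.π (rip M ξ ξ)) h
  nlinarith [mul_le_mul_of_nonneg_left h1 (norm_nonneg h)]

variable (K) in
/-- The creation operator `h ↦ ξ ⊗ h`. -/
def hcreate (ξ : E) : K →L[ℂ] HTensor E K :=
  LinearMap.mkContinuous
    { toFun := fun h => htmul ξ h
      map_add' := htmul_add_right ξ
      map_smul' := fun c h => htmul_smul_right c ξ h } ‖ξ‖ (norm_htmul_le ξ)

/-- The elementary tensors span a dense subspace. -/
lemma htensor_dense {S : Submodule ℂ (HTensor E K)} (hS : IsClosed (S : Set (HTensor E K)))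
    (h : ∀ ξ x, htmul ξ x ∈ S) (x : HTensor E K) : x ∈ S := by
  refine denseRange_hι.induction_on (p := fun x => x ∈ S) x hS fun x => ?_
  induction x using TensorProduct.induction_on with
  | zero => simp
  | add x y hx hy => rw [map_add]; exact S.add_mem hx hy
  | tmul ξ g => exact h ξ g

end

section

variable {M : Type u} [NonUnitalCStarAlgebra M] [PartialOrder M] [StarOrderedRing M]
variable {E : Correspondence.{u, v} M} {F : Correspondence.{u, v'} M} {K : HilbertRep.{u, w} M}

/-! ### The associator `(E ⊗ F) ⊗ K ≃ E ⊗ (F ⊗ K)` -/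

variable (E F) in
/-- For fixed `h`, the map `ξ ⊗ η ↦ ξ ⊗ (η ⊗ h)` on the algebraic tensor product. -/
def assocPre (h : K) : (E ⊗[ℂ] F) →ₗ[ℂ] HTensor E (tensorRep F K) :=
  hι E (tensorRep F K) ∘ₗ LinearMap.lTensor E
    { toFun := fun η => (htmul η h : HTensor F K)
      map_add' := fun _ _ => htmul_add_left _ _ _
      map_smul' := fun _ _ => htmul_smul_left _ _ _ }

lemma assocPre_tmul (h : K) (ξ : E) (η : F) :
    assocPre E F h (ξ ⊗ₜ η) = htmul ξ (htmul η h : HTensor F K) := rfl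

lemma inner_assocPre (h g : K) (x y : E ⊗[ℂ] F) :
    inner ℂ (assocPre E F h x) (assocPre E F g y) = inner ℂ h (K.π (mform E F x y) g) := by
  induction x using TensorProduct.induction_on with
  | zero => simp [mform]
  | add x₁ x₂ h₁ h₂ => rw [map_add, inner_add_left, h₁, h₂, mform_add_left, map_add,
      add_apply, inner_add_right]
  | tmul ξ η =>
    induction y using TensorProduct.induction_on with
    | zero => simp [mform]
    | add x₁ x₂ h₁ h₂ => rw [map_add, inner_add_right, h₁, h₂, mform_add_right, map_add,
        add_apply, inner_add_right]
    | tmul ξ' η' =>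
      refine (inner_htmul (K := tensorRep F K) _ _ _ _).trans ?_
      change inner ℂ (htmul η h : HTensor F K) (hact (rip M ξ ξ') (htmul η' g)) = _
      rw [hact_htmul, inner_htmul]
      rfl

lemma norm_assocPre_le (h : K) (x : E ⊗[ℂ] F) : ‖assocPre E F h x‖ ≤ ‖h‖ * ‖mι E F x‖ := by
  refine le_of_sq_le_sq ?_ (by positivity)
  rw [← inner_self_eq_norm_sq (𝕜 := ℂ), inner_assocPre, mul_pow, norm_mι_sq]
  refine (RCLike.re_le_norm _).trans ((norm_inner_le_norm _ _).trans ?_)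
  have h1 := (K.π (mform E F x x)).le_of_opNorm_le
    (NonUnitalStarAlgHom.norm_apply_le K.π (mform E F x x)) h
  nlinarith [mul_le_mul_of_nonneg_left h1 (norm_nonneg h)]

/-- For fixed `h`, the bounded map `ξ ⊗ η ↦ ξ ⊗ (η ⊗ h)` on `E ⊗_φ F`. -/
def assocAt (h : K) : MTensor E F →L[ℂ] HTensor E (tensorRep F K) :=
  (assocPre E F h).extendOfNorm (mι E F)

lemma assocAt_mι (h : K) (x : E ⊗[ℂ] F) : assocAt h (mι E F x) = assocPre E F h x :=
  LinearMap.extendOfNorm_eq denseRange_mι ⟨_, norm_assocPre_le h⟩ x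

lemma assocAt_mtmul (h : K) (ξ : E) (η : F) :
    assocAt h (mtmul ξ η : MTensor E F) = htmul ξ (htmul η h : HTensor F K) :=
  assocAt_mι h _

lemma inner_assocAt (h g : K) (x y : MTensor E F) :
    inner ℂ (assocAt h x) (assocAt g y) = inner ℂ h (K.π (rip M x y) g) := by
  have hc {f : MTensor E F → M} (hf : Continuous f) :
      Continuous fun x => inner ℂ h (K.π (f x) g) :=
    continuous_const.inner ((((map_continuous K.π).comp hf)).clm_apply continuous_const)
  refine mtensor_ind (p := fun x => inner ℂ (assocAt h x) (assocAt g y)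
    = inner ℂ h (K.π (rip M x y) g)) x (isClosed_eq (by fun_prop) (hc (crr y))) fun x => ?_
  refine mtensor_ind (p := fun y => inner ℂ (assocAt h (mι E F x)) (assocAt g y)
    = inner ℂ h (K.π (rip M _ y) g)) y (isClosed_eq (by fun_prop) (hc (crl _))) fun y => ?_
  rw [assocAt_mι, assocAt_mι, mrip_mι, inner_assocPre]

variable (E F K) in
/-- The associator on the algebraic tensor product `(E ⊗_φ F) ⊗ K`. -/
def assocAlg : (E.tensor F ⊗[ℂ] K) →ₗ[ℂ] HTensor E (tensorRep F K) :=
  TensorProduct.lift (LinearMap.mk₂ ℂ (fun (x : MTensor E F) h => assocAt h x)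
    (fun x y h => map_add _ _ _) (fun c x h => map_smul _ _ _)
    (fun x h g => DFunLike.congr_fun (f := assocAt (h + g)) (g := assocAt h + assocAt g)
      (mtensor_ext fun ξ η => by
        rw [add_apply, assocAt_mtmul, assocAt_mtmul, assocAt_mtmul, htmul_add_right]
        exact htmul_add_right (K := tensorRep F K) _ _ _) x)
    (fun c x h => DFunLike.congr_fun (f := assocAt (c • h)) (g := c • assocAt h)
      (mtensor_ext fun ξ η => by
        rw [smul_apply, assocAt_mtmul, assocAt_mtmul, htmul_smul_right]
        exact htmul_smul_right (K := tensorRep F K) _ _ _) x))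

lemma inner_assocAlg (x y : E.tensor F ⊗[ℂ] K) :
    inner ℂ (assocAlg E F K x) (assocAlg E F K y) = hform (E.tensor F) K x y := by
  induction x using TensorProduct.induction_on with
  | zero => simp
  | add x₁ x₂ h₁ h₂ => rw [map_add, inner_add_left, h₁, h₂, map_add, LinearMap.add_apply]
  | tmul ξ h =>
    induction y using TensorProduct.induction_on with
    | zero => simp
    | add x₁ x₂ h₁ h₂ => rw [map_add, inner_add_right, h₁, h₂, map_add]
    | tmul η g => exact inner_assocAt h g ξ η

lemma norm_assocAlg (x : E.tensor F ⊗[ℂ] K) : ‖assocAlg E F K x‖ = ‖hι (E.tensor F) K x‖ := by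
  refine (sq_eq_sq₀ (norm_nonneg _) (norm_nonneg _)).1 ?_
  rw [← inner_self_eq_norm_sq (𝕜 := ℂ), inner_assocAlg, norm_hι_sq]
  rfl

variable (E F K) in
/-- The associator `(ξ ⊗ η) ⊗ h ↦ ξ ⊗ (η ⊗ h)` as an isometry. -/
def assocIsometry : HTensor (E.tensor F) K →ₗᵢ[ℂ] HTensor E (tensorRep F K) where
  toLinearMap := (hlift (assocAlg E F K)).toLinearMap
  norm_map' x := by
    refine denseRange_hι.induction_on (p := fun x => ‖hlift (assocAlg E F K) x‖ = ‖x‖) x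
      (isClosed_eq (hlift _).continuous.norm continuous_norm) fun x => ?_
    rw [← norm_assocAlg]
    exact congrArg norm (LinearMap.extendOfNorm_eq denseRange_hι
      ⟨1, fun x => by rw [one_mul, norm_assocAlg]⟩ x)

lemma assocIsometry_htmul (ξ : E) (η : F) (h : K) :
    assocIsometry E F K (htmul (E := E.tensor F) (mtmul ξ η) h)
      = htmul ξ (htmul η h : HTensor F K) :=
  (LinearMap.extendOfNorm_eq denseRange_hι
    ⟨1, fun x => by rw [one_mul, norm_assocAlg]⟩ _).trans (assocAt_mtmul h ξ η)

lemma assocIsometry_surjective : Function.Surjective (assocIsometry E F K) := by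
  have hcl : IsClosed ((LinearMap.range (assocIsometry E F K).toLinearMap :
      Submodule ℂ (HTensor E (tensorRep F K))) : Set (HTensor E (tensorRep F K))) :=
    (assocIsometry E F K).isometry.isClosedEmbedding.isClosed_range
  refine fun x => htensor_dense hcl (fun ξ y => ?_) x
  exact htensor_dense (S := (LinearMap.range (assocIsometry E F K).toLinearMap).comap
    (hcreate (tensorRep F K) ξ).toLinearMap) (hcl.preimage (hcreate (tensorRep F K) ξ).continuous)
    (fun η h => ⟨_, assocIsometry_htmul ξ η h⟩) y

variable (E F K) in
/-- The unitary associator `(E ⊗ F) ⊗ K → E ⊗ (F ⊗ K)`, `(ξ ⊗ η) ⊗ h ↦ ξ ⊗ (η ⊗ h)`. -/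
def assoc : HTensor (E.tensor F) K ≃ₗᵢ[ℂ] HTensor E (tensorRep F K) :=
  LinearIsometryEquiv.ofSurjective (assocIsometry E F K) assocIsometry_surjective

end

/-! ### Completely bounded covariant representations -/

section

variable {M : Type u} [NonUnitalCStarAlgebra M] [PartialOrder M] [StarOrderedRing M]

/-- Complete boundedness of `T : E → B(H)`: the maps `T_n : M_n(E) → M_n(B(H)) = B(Hⁿ)` are
uniformly bounded. Here `M_n(E)` carries the norm of the operator space structure of `E` as a corner
of its linking algebra, `‖(x_ij)‖² = ‖(∑_k ⟨x_ki, x_kj⟩)_ij‖` in `M_n(M)`. -/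
def IsCompletelyBounded {E : Correspondence.{u, v} M} {H : HilbertRep.{u, w} M}
    (T : E →ₗ[ℂ] (H →L[ℂ] H)) : Prop :=
  ∃ C : ℝ, ∀ (n : ℕ) (x : Fin n → Fin n → E) (g : Fin n → H),
    ∑ i, ‖∑ j, T (x i j) (g j)‖ ^ 2 ≤
      C ^ 2 * ‖CStarMatrix.ofMatrix fun i j => ∑ k, rip M (x k i) (x k j)‖ * ∑ j, ‖g j‖ ^ 2

/-- A completely bounded covariant representation `(σ, T)` of `E` on `H`; the representation `σ` of
`M` is the one of `H`. -/
structure CBCovRep (E : Correspondence.{u, v} M) (H : HilbertRep.{u, w} M) where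
  T : E →ₗ[ℂ] (H →L[ℂ] H)
  cb : IsCompletelyBounded T
  covariant_left : ∀ (a : M) (ξ : E), T (E.lact a ξ) = H.π a ∘L T ξ
  covariant_right : ∀ (ξ : E) (b : M), T (MulOpposite.op b • ξ) = T ξ ∘L H.π b

lemma gram_smul {E : Correspondence.{u, v} M} {n : ℕ} (ξ : Fin n → E)
    (V W : CStarMatrix (Fin n) (Fin n) M) (a b : Fin n) :
    rip M (∑ j, MulOpposite.op (V j a) • ξ j) (∑ j, MulOpposite.op (W j b) • ξ j)
      = (star V * (CStarMatrix.ofMatrix fun i j => rip M (ξ i) (ξ j)) * W) a b := by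
  simp only [CStarMatrix.mul_apply, rip_sum_right, rip_sum_left, rip_rsmul_right,
    rip_rsmul_left, Finset.sum_mul, CStarMatrix.star_apply]
  rfl

namespace CBCovRep

variable {E : Correspondence.{u, v} M} {H : HilbertRep.{u, w} M} (R : CBCovRep E H)

/-- The map `ξ ⊗ h ↦ T(ξ) h` on the algebraic tensor product. -/
def tildePre : (E ⊗[ℂ] H) →ₗ[ℂ] H :=
  TensorProduct.lift ((ContinuousLinearMap.coeLM ℂ) ∘ₗ R.T)

lemma tildePre_tmul (ξ : E) (h : H) : R.tildePre (ξ ⊗ₜ h) = R.T ξ h := rfl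

variable {R} in
lemma norm_apply_le {C : ℝ} (hC : ∀ (n : ℕ) (x : Fin n → Fin n → E) (g : Fin n → H),
    ∑ i, ‖∑ j, R.T (x i j) (g j)‖ ^ 2 ≤
      C ^ 2 * ‖CStarMatrix.ofMatrix fun i j => ∑ k, rip M (x k i) (x k j)‖ * ∑ j, ‖g j‖ ^ 2)
    (ξ : E) (h : H) : ‖R.T ξ h‖ ≤ |C| * ‖ξ‖ * ‖h‖ := by
  have h1 := hC 1 (fun _ _ => ξ) (fun _ => h)
  have h2 : ‖(CStarMatrix.ofMatrix fun _ _ => rip M ξ ξ : CStarMatrix (Fin 1) (Fin 1) M)‖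
      ≤ ‖rip M ξ ξ‖ := by
    exact NonUnitalStarAlgHom.norm_apply_le (F := M ≃⋆ₐ[ℂ] CStarMatrix (Fin 1) (Fin 1) M)
      (CStarMatrix.toOneByOne (Fin 1) ℂ M) (rip M ξ ξ)
  simp only [Finset.univ_unique, Finset.sum_singleton] at h1
  refine le_of_sq_le_sq ?_ (by positivity)
  rw [mul_pow, mul_pow, sq_abs, norm_sq_rip (M := M) ξ]
  refine h1.trans ?_
  gcongr

lemma norm_tildePre_le : ∃ C, ∀ x, ‖R.tildePre x‖ ≤ C * ‖hι E H x‖ := by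
  obtain ⟨C, hC⟩ := R.cb
  refine ⟨|C|, fun x => ?_⟩
  obtain ⟨n, ξ, h, rfl⟩ := exists_sum_tmul x
  rcases Nat.eq_zero_or_pos n with rfl | hn
  · simp
  have : NeZero n := ⟨hn.ne'⟩
  set G : CStarMatrix (Fin n) (Fin n) M := CStarMatrix.ofMatrix fun i j => rip M (ξ i) (ξ j)
    with hG
  have hGij (i j) : G i j = rip M (ξ i) (ξ j) := rfl
  have hG0 : 0 ≤ G := by
    obtain ⟨S, hS⟩ := exists_gram_factor (M := M) ξ
    rw [hG, hS]
    exact star_mul_self_nonneg S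
  have key (ε : ℝ) (hε : 0 < ε) : ‖R.tildePre (∑ i, ξ i ⊗ₜ h i)‖
      ≤ |C| * ‖hι E H (∑ i, ξ i ⊗ₜ h i)‖ + |C| * √ε * ∑ i, ‖h i‖ := by
    obtain ⟨Y, Q, hY, hQ, hQQ, hn1, hn2⟩ := exists_approx_factor hG0 hε
    set η : Fin n → E := fun k => ∑ j, MulOpposite.op (Y j k) • ξ j with hη
    set g : Fin n → H := fun k => ∑ l, H.π (Q k l) (h l) with hg
    set ζ : Fin n → E := fun l => ∑ j, MulOpposite.op ((Y * Q) j l) • ξ j with hζ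
    have hgram : (CStarMatrix.ofMatrix fun i j => rip M (η i) (η j)) = Y * G * Y := by
      ext i j
      refine (gram_smul ξ Y Y i j).trans ?_
      rw [hY]
    have hgn : ∑ k, ‖g k‖ ^ 2 = ‖hι E H (∑ i, ξ i ⊗ₜ h i)‖ ^ 2 :=
      (hform_sum E ξ (S := Q) (by rw [hQ, hQQ]) h).symm
    have hT : ∑ l, R.T (ζ l) (h l) = ∑ k, R.T (η k) (g k) := by
      simp only [hζ, hη, hg, map_sum, R.covariant_right, sum_apply, CStarMatrix.mul_apply,
        ContinuousLinearMap.comp_apply, map_mul, mul_apply_eq_comp]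
      calc ∑ l, ∑ j, ∑ k, R.T (ξ j) (H.π (Y j k) (H.π (Q k l) (h l)))
          = ∑ l, ∑ k, ∑ j, R.T (ξ j) (H.π (Y j k) (H.π (Q k l) (h l))) :=
            Finset.sum_congr rfl fun l _ => Finset.sum_comm
        _ = ∑ k, ∑ l, ∑ j, R.T (ξ j) (H.π (Y j k) (H.π (Q k l) (h l))) := Finset.sum_comm
    have h1 : ‖∑ l, R.T (ζ l) (h l)‖ ≤ |C| * ‖hι E H (∑ i, ξ i ⊗ₜ h i)‖ := by
      rw [hT]
      refine le_of_sq_le_sq ?_ (by positivity)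
      have h2 := hC n (fun i j => if i = 0 then η j else 0) g
      have h3 : (CStarMatrix.ofMatrix fun i j => ∑ k : Fin n,
          rip M (if k = 0 then η i else 0) (if k = 0 then η j else 0)) = Y * G * Y := by
        rw [← hgram]
        ext i j
        change ∑ k : Fin n, rip M (if k = 0 then η i else 0) (if k = 0 then η j else 0) = _
        rw [Finset.sum_eq_single (0 : Fin n)]
        · rw [if_pos rfl, if_pos rfl]; rfl
        · intro k _ hk
          rw [if_neg hk, if_neg hk]; simp [rip]
        · intro h0; exact absurd (Finset.mem_univ _) h0
      rw [h3, hgn] at h2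
      have h4 := Finset.single_le_sum (s := Finset.univ) (f := fun i : Fin n =>
        ‖∑ j, R.T (if i = 0 then η j else 0) (g j)‖ ^ 2) (fun i _ => by positivity)
        (Finset.mem_univ (0 : Fin n))
      simp only [if_true] at h4
      refine h4.trans (h2.trans ?_)
      rw [mul_pow, sq_abs]
      gcongr
      exact mul_le_of_le_one_right (sq_nonneg C) hn1
    have h5 (l) : ‖ξ l - ζ l‖ ≤ √ε := by
      refine Real.le_sqrt_of_sq_le ?_
      rw [norm_sq_rip (M := M)]
      have h6 : rip M (ξ l - ζ l) (ξ l - ζ l)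
          = (G - G * (Y * Q) - (Q * Y) * G + (Q * Y) * G * (Y * Q)) l l := by
        have h7 : rip M (ζ l) (ζ l) = ((Q * Y) * G * (Y * Q)) l l := by
          refine (gram_smul ξ (Y * Q) (Y * Q) l l).trans ?_
          rw [star_mul, hY, hQ]
        have h8 : rip M (ξ l) (ζ l) = (G * (Y * Q)) l l := by
          simp only [hζ, rip_sum_right, rip_rsmul_right]
          rw [CStarMatrix.mul_apply]
          rfl
        have h9 : rip M (ζ l) (ξ l) = ((Q * Y) * G) l l := by
          rw [← star_rip, h8, ← CStarMatrix.star_apply, star_mul, star_mul, hY, hQ,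
            IsSelfAdjoint.of_nonneg hG0]
        have h10 : rip M (ξ l - ζ l) (ξ l - ζ l) = rip M (ξ l) (ξ l) - rip M (ξ l) (ζ l)
            - rip M (ζ l) (ξ l) + rip M (ζ l) (ζ l) := by
          simp [rip]
          abel
        rw [h10, h7, h8, h9]
        rfl
      rw [h6]
      exact CStarMatrix.norm_entry_le_norm.trans hn2
    have h6 : R.tildePre (∑ i, ξ i ⊗ₜ h i)
        = ∑ l, R.T (ζ l) (h l) + ∑ l, R.T (ξ l - ζ l) (h l) := by
      simp [tildePre_tmul]
    rw [h6]
    refine (norm_add_le _ _).trans (add_le_add h1 ((norm_sum_le _ _).trans ?_))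
    rw [Finset.mul_sum]
    refine Finset.sum_le_sum fun l _ => (norm_apply_le hC _ _).trans ?_
    gcongr
    exact h5 l
  have hlim : Filter.Tendsto (fun ε : ℝ => |C| * ‖hι E H (∑ i, ξ i ⊗ₜ h i)‖
      + |C| * √ε * ∑ i, ‖h i‖) (nhdsWithin 0 (Set.Ioi 0))
      (nhds (|C| * ‖hι E H (∑ i, ξ i ⊗ₜ h i)‖ + |C| * √0 * ∑ i, ‖h i‖)) :=
    ((by fun_prop : Continuous fun ε : ℝ => |C| * ‖hι E H (∑ i, ξ i ⊗ₜ h i)‖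
      + |C| * √ε * ∑ i, ‖h i‖).tendsto 0).mono_left nhdsWithin_le_nhds
  have := ge_of_tendsto hlim (Filter.eventually_of_mem self_mem_nhdsWithin key)
  simpa using this

/-- The operator `T̃ : E ⊗_σ H → H`, `T̃(ξ ⊗ h) = T(ξ) h`. -/
def tilde : Intertwiner (tensorRep E H) H where
  toCLM := hlift R.tildePre
  comm a x := by
    refine DFunLike.congr_fun (f := hlift R.tildePre ∘L hact a)
      (g := H.π a ∘L hlift R.tildePre) (htensor_ext fun ξ g => ?_) x
    simp only [ContinuousLinearMap.comp_apply, hact_htmul, hlift_htmul R.norm_tildePre_le,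
      tildePre_tmul, R.covariant_left]

lemma tilde_htmul (ξ : E) (h : H) : R.tilde.toCLM (htmul ξ h : HTensor E H) = R.T ξ h :=
  hlift_htmul R.norm_tildePre_le ξ h

variable (E H) in
/-- The Hilbert space `E^{⊗(n+1)} ⊗_σ H`, written as `E ⊗ (E ⊗ ⋯ (E ⊗ H))`. -/
def iterSpace : ℕ → HilbertRep.{u, max v w} M
  | 0 => tensorRep E H
  | n + 1 => tensorRep E (iterSpace n)

/-- `R.iter n` is `T̃_{n+1} = T̃ (I_E ⊗ T̃) ⋯ (I_{E^{⊗n}} ⊗ T̃) : E^{⊗(n+1)} ⊗ H → H`. -/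
def iter : (n : ℕ) → Intertwiner (iterSpace E H n) H
  | 0 => R.tilde
  | n + 1 => R.tilde.comp ((iter n).ampliate E)

/-- Concavity: `T̃₂* T̃₂ - I ≤ 2 (I_E ⊗ T̃* T̃ - I)` on `E^{⊗2} ⊗ H`. -/
def IsConcave : Prop :=
  ∀ x : tensorRep E (tensorRep E H),
    ‖(R.iter 1).toCLM x‖ ^ 2 + ‖x‖ ^ 2 ≤ 2 * ‖(R.tilde.ampliate E).toCLM x‖ ^ 2

/-- The inequality `‖(I_E ⊗ T̃) ζ + κ‖² ≤ 2 (‖ζ‖² + ‖T̃ κ‖²)`. -/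
def ShimorinInequality : Prop :=
  ∀ (ζ : tensorRep E (tensorRep E H)) (κ : tensorRep E H),
    ‖(R.tilde.ampliate E).toCLM ζ + κ‖ ^ 2 ≤ 2 * (‖ζ‖ ^ 2 + ‖R.tilde.toCLM κ‖ ^ 2)

/-- Analyticity: the intersection of the ranges of all `T̃_n`, `n ≥ 1`, is zero. -/
def IsAnalytic : Prop := ⋂ n : ℕ, Set.range (R.iter n).toCLM = {0}

end CBCovRep

/-- `φ(⟨E, E⟩)` acts nondegenerately on `E`: the closed linear span of `φ(⟨ξ, η⟩) ζ` is `E`. -/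
def Correspondence.InnerNondegenerate (E : Correspondence.{u, v} M) : Prop :=
  (Submodule.span ℂ {y : E | ∃ ξ η ζ : E, y = E.lact (rip M ξ η) ζ}).topologicalClosure = ⊤

end

/-! ### Product systems over `ℕ₀^k` -/

/-- A product system over `ℕ₀^k`: correspondences `E₁, …, E_k` with unitary isomorphisms
`t_ij : E_i ⊗ E_j → E_j ⊗ E_i`, where `t_ii = id` and `t_ij = t_ji⁻¹`. -/
structure ProductSystem (M : Type u) [NonUnitalCStarAlgebra M] [PartialOrder M]
    [StarOrderedRing M] (k : ℕ) where
  E : Fin k → Correspondence.{u, v} M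
  essential : ∀ i, (E i).IsEssential
  t : ∀ i j, CorrIso ((E i).tensor (E j)) ((E j).tensor (E i))
  t_self : ∀ i, t i i = CorrIso.refl _
  t_symm : ∀ i j, t i j = (t j i).symm

namespace ProductSystem

variable {M : Type u} [NonUnitalCStarAlgebra M] [PartialOrder M] [StarOrderedRing M]
variable {k : ℕ}

/-- The unitary `t_ij ⊗ I_K : E_i ⊗ E_j ⊗ K → E_j ⊗ E_i ⊗ K`. -/
def flip (P : ProductSystem.{u, v} M k) (i j : Fin k) (K : HilbertRep.{u, w} M) :
    tensorRep (P.E i) (tensorRep (P.E j) K) →L[ℂ] tensorRep (P.E j) (tensorRep (P.E i) K) :=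
  (assoc (P.E j) (P.E i) K).toContinuousLinearEquiv.toContinuousLinearMap ∘L
    (P.t i j).ampliate K ∘L
      (assoc (P.E i) (P.E j) K).symm.toContinuousLinearEquiv.toContinuousLinearMap

/-- A completely bounded covariant representation `(σ, T⁽¹⁾, …, T⁽ᵏ⁾)` of a product system on a
Hilbert space `H` (with `σ` the representation of `H`):
`T̃⁽ⁱ⁾ (I ⊗ T̃⁽ʲ⁾) = T̃⁽ʲ⁾ (I ⊗ T̃⁽ⁱ⁾) (t_ij ⊗ I)`. -/
structure Rep (P : ProductSystem.{u, v} M k) where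
  H : HilbertRep.{u, w} M
  essential : H.IsEssential
  rep : ∀ i, CBCovRep (P.E i) H
  comm : ∀ i j, (rep i).tilde.toCLM ∘L ((rep j).tilde.ampliate (P.E i)).toCLM =
    (rep j).tilde.toCLM ∘L ((rep i).tilde.ampliate (P.E j)).toCLM ∘L P.flip i j H

namespace Rep

variable {P : ProductSystem.{u, v} M k} (R : Rep.{u, v, w} P)

/-- `T̃⁽ⁱ⁾ : E_i ⊗ H → H`. -/
def tilde (i : Fin k) : Intertwiner (tensorRep (P.E i) R.H) R.H := (R.rep i).tilde

/-- Double commutation: `T̃⁽ʲ⁾* T̃⁽ⁱ⁾ = (I ⊗ T̃⁽ⁱ⁾) (t_ij ⊗ I) (I ⊗ T̃⁽ʲ⁾*)` for all `i ≠ j`. -/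
def IsDoublyCommuting : Prop :=
  ∀ i j, i ≠ j → (R.tilde j).adjoint.toCLM ∘L (R.tilde i).toCLM =
    ((R.tilde i).ampliate (P.E j)).toCLM ∘L P.flip i j R.H ∘L
      ((R.tilde j).adjoint.ampliate (P.E i)).toCLM

/-- The vectors `T⁽ⁱ¹⁾(ξ₁) ⋯ T⁽ⁱᵐ⁾(ξ_m) h` with `h ∈ K`, for a word `i₁ ⋯ i_m`. -/
def words : List (Fin k) → Set R.H → Set R.H
  | [], K => K
  | i :: l, K => {y | ∃ ξ : P.E i, ∃ x ∈ words l K, y = (R.rep i).T ξ x}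

/-- The word `α₁ ⋯ α₁ α₂ ⋯ α₂ ⋯` in which the elements `α₁ < α₂ < ⋯` of `α` occur
`m_{α₁}, m_{α₂}, …` times. -/
def word (α : Finset (Fin k)) (m : Fin k → ℕ) : List (Fin k) :=
  (α.sort (· ≤ ·)).flatMap fun i => List.replicate (m i) i

/-- `𝔏_m^α(K)`: the closed linear span of all `T⁽ⁱ¹⁾(ξ₁) T⁽ⁱ²⁾(ξ₂) ⋯ h`, `h ∈ K`, where
`i₁ i₂ ⋯` is `word α m`. Only the values of `m` on `α` matter. -/
def L (α : Finset (Fin k)) (m : Fin k → ℕ) (K : Submodule ℂ R.H) : Submodule ℂ R.H :=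
  (Submodule.span ℂ (R.words (word α m) K)).topologicalClosure

/-- `[K]_{T_α} = ⋁_m 𝔏_m^α(K)`. -/
def bracket (α : Finset (Fin k)) (K : Submodule ℂ R.H) : Submodule ℂ R.H :=
  (⨆ m : Fin k → ℕ, R.L α m K).topologicalClosure

/-- `𝒲_α = ⋂_{i ∈ α} (H ⊖ T̃⁽ⁱ⁾(E_i ⊗ H))`. -/
def W (α : Finset (Fin k)) : Submodule ℂ R.H :=
  ⨅ i ∈ α, (LinearMap.range (R.tilde i).toCLM.toLinearMap)ᗮ

/-- `K` is a wandering subspace for `(σ, T⁽ⁱ⁾)_{i ∈ α}`: it is closed, `σ(M)`-invariant, and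
orthogonal to `𝔏_m^α(K)` for every `m ∈ ℕ₀^α`, `m ≠ 0`. -/
structure IsWandering (α : Finset (Fin k)) (K : Submodule ℂ R.H) : Prop where
  isClosed : IsClosed (K : Set R.H)
  invariant : ∀ (a : M), ∀ x ∈ K, R.H.π a x ∈ K
  ortho : ∀ m : Fin k → ℕ, (∃ i ∈ α, m i ≠ 0) → K ⟂ R.L α m K

/-- `K` is a generating wandering subspace for `(σ, T⁽ⁱ⁾)_{i ∈ α}`. -/
def IsGeneratingWandering (α : Finset (Fin k)) (K : Submodule ℂ R.H) : Prop :=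
  R.IsWandering α K ∧ R.bracket α K = ⊤

/-- The relation `(I ⊗ T̃⁽ⁱ⁾) (t_ij ⊗ I) (I ⊗ T̃⁽ʲ⁾* T̃⁽ʲ⁾) = T̃⁽ʲ⁾* T̃⁽ʲ⁾ (I ⊗ T̃⁽ⁱ⁾) (t_ij ⊗ I)`. -/
def Intertwines (i j : Fin k) : Prop :=
  ((R.tilde i).ampliate (P.E j)).toCLM ∘L P.flip i j R.H ∘L
      (((R.tilde j).adjoint.comp (R.tilde j)).ampliate (P.E i)).toCLM =
    (R.tilde j).adjoint.toCLM ∘L (R.tilde j).toCLM ∘L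
      ((R.tilde i).ampliate (P.E j)).toCLM ∘L P.flip i j R.H

end Rep
end ProductSystem

end CovRep

end

/-! The theorem reduces to a Wold-type statement for one representation: under concavity or `(∗)`, a
vector of `H` lies in the range of every `T̃_n` exactly when it is orthogonal to all `T(ξ₁) ⋯ T(ξ_n)
w` with `w` in the wandering subspace `ker T̃*`. Hence analyticity says that the wandering subspace
generates (`isAnalytic_iff_orbit`).

For the single statement, `T̃` is replaced by the tower of operators `I_{E^{⊗n}} ⊗ T̃`, and the
argument is that of Richter and Shimorin. If `z` lies in all ranges, its successive preimages have
squared norms that form a nonnegative, concave and nonincreasing sequence; the sequence is constant,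
so the tower is coisometric along these vectors and `z` is orthogonal to the kernels. Conversely,
project step by step onto the ranges with the Cauchy dual. Concavity keeps a subsequence of the
resulting approximants bounded, and weak approximation shows that a vector orthogonal to all kernels
lies in all ranges. Inequality `(∗)` makes the Cauchy dual concave, and passing to the Cauchy dual
interchanges the two sides of the equivalence (`orthoKernels_iff`), so this case follows from the
concave one.

Concavity gives expansivity only in a weakened form: at level `n` the factor is `n/(n+1)`.
Nondegeneracy of `φ(⟨E, E⟩)` lets a lower bound for `I_E ⊗ Y` descend to `Y`
(`norm_sq_le_of_ampliate`), so every factor `n/(n+1)` holds for `T̃` itself, and `n → ∞` gives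
expansivity.

In several variables, double commutation makes `𝒲_β` a reducing subspace for each `T⁽ⁱ⁾(ξ)` with `i
∉ β`. Projecting the generating property of `𝒲_{i}` onto it gives `[𝒲_α]_{T⁽ⁱ⁾} = 𝒲_{α∖{i}}`
(`bracket_W_eq`), and removing the indices one by one shows that `𝒲_α` generates
(`bracket_W_eq_top`). In the other direction, (a) for a pair makes `𝒲_{j}` invariant under `T⁽ⁱ⁾`.
Double commutation can then be checked separately on the range of `T̃⁽ʲ⁾`, where (b) gives it, and
on `𝒲_{j}`, where both sides vanish (`commutesDoubly_of_intertwines`). -/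

namespace CovRep

open scoped InnerProduct

/-! ### Towers of Hilbert spaces -/

section Tower

variable {G : ℕ → Type*} [∀ n, NormedAddCommGroup (G n)] [∀ n, InnerProductSpace ℂ (G n)]
  [∀ n, CompleteSpace (G n)]

/-- The composition `T₀ T₁ ⋯ Tₙ₋₁ : Gₙ → G₀`. -/
noncomputable def towerComp (T : ∀ n, G (n + 1) →L[ℂ] G n) : ∀ n, G n →L[ℂ] G 0
  | 0 => ContinuousLinearMap.id ℂ (G 0)
  | n + 1 => towerComp T n ∘L T n

lemma towerComp_succ (T : ∀ n, G (n + 1) →L[ℂ] G n) (n : ℕ) (x : G (n + 1)) :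
    towerComp T (n + 1) x = towerComp T n (T n x) := rfl

/-- The vectors of `G₀` in the range of every composition `T₀ ⋯ Tₙ₋₁`. -/
def InAllRanges (T : ∀ n, G (n + 1) →L[ℂ] G n) (z : G 0) : Prop :=
  ∀ n, ∃ x, towerComp T n x = z

/-- The vectors of `G₀` orthogonal to `T₀ ⋯ Tₙ₋₁ (ker Tₙ*)` for every `n`. -/
def OrthoKernels (T : ∀ n, G (n + 1) →L[ℂ] G n) (z : G 0) : Prop :=
  ∀ n w, ((T n)†) w = 0 → inner ℂ (towerComp T n w) z = 0

/-- `S` is the Cauchy dual of `T`: `S* T = 1` and `T S*` is self-adjoint. -/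
structure IsCauchyDual (T S : ∀ n, G (n + 1) →L[ℂ] G n) : Prop where
  left_inv : ∀ n x, ((S n)†) (T n x) = x
  adj_comm : ∀ n x, T n (((S n)†) x) = S n (((T n)†) x)

variable {T S : ∀ n, G (n + 1) →L[ℂ] G n}

lemma IsCauchyDual.symm (h : IsCauchyDual T S) : IsCauchyDual S T where
  left_inv n x := ext_inner_right ℂ fun y => by
    rw [ContinuousLinearMap.adjoint_inner_left, ← ContinuousLinearMap.adjoint_inner_right,
      h.left_inv]
  adj_comm n x := (h.adj_comm n x).symm

lemma IsCauchyDual.adjoint_sub (h : IsCauchyDual T S) (n : ℕ) (x : G n) :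
    ((T n)†) (x - T n (((S n)†) x)) = 0 := by
  rw [map_sub, h.adj_comm, h.symm.left_inv, sub_self]

lemma IsCauchyDual.adjoint_eq_zero (h : IsCauchyDual T S) {n : ℕ} {x : G n} (hx : ((T n)†) x = 0) :
    ((S n)†) x = 0 := by
  rw [← h.left_inv n (((S n)†) x), h.adj_comm, hx, map_zero, map_zero]

lemma IsCauchyDual.norm_proj_le (h : IsCauchyDual T S) (n : ℕ) (x : G n) :
    ‖T n (((S n)†) x)‖ ≤ ‖x‖ := by
  have h0 : inner ℂ (T n (((S n)†) x)) (x - T n (((S n)†) x)) = 0 := by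
    rw [← ContinuousLinearMap.adjoint_inner_right, h.adjoint_sub, inner_zero_right]
  have h1 := norm_add_sq_eq_norm_sq_add_norm_sq_of_inner_eq_zero _ _ h0
  rw [add_sub_cancel] at h1
  nlinarith [norm_nonneg x, norm_nonneg (T n (((S n)†) x)), mul_self_nonneg ‖x - T n (((S n)†) x)‖]

lemma IsCauchyDual.adjoint_towerComp (h : IsCauchyDual T S) (n : ℕ) (x : G n) :
    ((towerComp T n)†) (towerComp S n x) = x := by
  induction n with
  | zero =>
    refine ext_inner_right ℂ fun y => ?_
    rw [ContinuousLinearMap.adjoint_inner_left]; rfl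
  | succ n ih =>
    have : ((towerComp T (n + 1))†) = ((T n)†) ∘L ((towerComp T n)†) :=
      ContinuousLinearMap.adjoint_comp _ _
    rw [this, ContinuousLinearMap.comp_apply, towerComp_succ, ih, h.symm.left_inv]

/-- This is Shimorin's duality. Since `T S*` is the orthogonal projection onto the range of `T`,
which is also the range of `S`, orthogonality to the kernels of the `Tₙ*` says at each level that
the current vector is recovered by `S T*`. -/
lemma IsCauchyDual.orthoKernels_iff (h : IsCauchyDual T S) (z : G 0) :
    OrthoKernels T z ↔ InAllRanges S z := by
  constructor
  · intro hz n
    refine ⟨((towerComp T n)†) z, ?_⟩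
    induction n with
    | zero =>
      refine ext_inner_left ℂ fun y => ?_
      change inner ℂ y (((towerComp T 0)†) z) = _
      rw [ContinuousLinearMap.adjoint_inner_right]; rfl
    | succ n ih =>
      have h1 : ((towerComp T (n + 1))†) = ((T n)†) ∘L ((towerComp T n)†) :=
        ContinuousLinearMap.adjoint_comp _ _
      rw [h1, ContinuousLinearMap.comp_apply, towerComp_succ]
      set y := ((towerComp T n)†) z
      suffices h2 : S n (((T n)†) y) = y by rw [h2, ih]
      -- The difference `y - T S* y` lies in `ker T*`, so `hz` makes it orthogonal to `y`; it is
      -- also orthogonal to the range of `T`, hence to itself.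
      rw [← h.adj_comm]
      have h3 := h.adjoint_sub n y
      have h4 := hz n _ h3
      rw [← ContinuousLinearMap.adjoint_inner_right] at h4
      have h5 : inner ℂ (y - T n (((S n)†) y)) (T n (((S n)†) y)) = 0 := by
        rw [← ContinuousLinearMap.adjoint_inner_left, h3, inner_zero_left]
      have h6 : inner ℂ (y - T n (((S n)†) y)) (y - T n (((S n)†) y)) = 0 := by
        rw [inner_sub_right, h4, h5, sub_zero]
      exact (sub_eq_zero.1 (inner_self_eq_zero.1 h6)).symm
  · intro hz n w hw
    obtain ⟨x, rfl⟩ := hz (n + 1)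
    rw [← ContinuousLinearMap.adjoint_inner_right, towerComp_succ, h.adjoint_towerComp,
      ← ContinuousLinearMap.adjoint_inner_left, h.adjoint_eq_zero hw, inner_zero_left]

/-! ### Concave and expansive towers, and their Wold decomposition -/

/-- Concavity of a tower. -/
def TowerConcave (T : ∀ n, G (n + 1) →L[ℂ] G n) : Prop :=
  ∀ n (x : G (n + 1 + 1)), ‖T n (T (n + 1) x)‖ ^ 2 + ‖x‖ ^ 2 ≤ 2 * ‖T (n + 1) x‖ ^ 2

/-- A tower of expansive operators. -/
def TowerExpansive (T : ∀ n, G (n + 1) →L[ℂ] G n) : Prop :=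
  ∀ n (x : G (n + 1)), ‖x‖ ^ 2 ≤ ‖T n x‖ ^ 2

/-- Only `n + 1` operators can be applied to `x` before level `0` is reached. The squared norms met
on the way form a finite concave sequence with nonnegative last term, and concavity bounds the
second term below by `n/(n+1)` times the first. -/
lemma TowerConcave.almost_expansive (hc : TowerConcave T) (n : ℕ) (x : G (n + 1)) :
    (n : ℝ) * ‖x‖ ^ 2 ≤ (n + 1) * ‖T n x‖ ^ 2 := by
  induction n with
  | zero => simp
  | succ n ih =>
    have h1 := ih (T (n + 1) x)
    have h2 := hc n x
    have h3 : (0 : ℝ) ≤ n + 1 := by positivity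
    push_cast
    nlinarith [mul_le_mul_of_nonneg_left h2 h3]

/-- A concave sequence stays below the line through its first two terms. -/
lemma TowerConcave.norm_towerComp_le (hc : TowerConcave T) (n : ℕ) (x : G (n + 1)) :
    ‖towerComp T (n + 1) x‖ ^ 2 ≤ ‖x‖ ^ 2 + (n + 1) * (‖T n x‖ ^ 2 - ‖x‖ ^ 2) := by
  induction n with
  | zero =>
    have : towerComp T (0 + 1) x = T 0 x := rfl
    simp [this]
  | succ n ih =>
    have h1 := ih (T (n + 1) x)
    have h2 := hc n x
    have h3 : (0 : ℝ) ≤ n + 1 := by positivity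
    rw [towerComp_succ]
    push_cast
    nlinarith [mul_le_mul_of_nonneg_left h2 h3]

lemma TowerExpansive.norm_le_towerComp (he : TowerExpansive T) (n : ℕ) (x : G n) :
    ‖x‖ ≤ ‖towerComp T n x‖ := by
  induction n with
  | zero => exact le_rfl
  | succ n ih =>
    rw [towerComp_succ]
    exact (le_of_sq_le_sq (he n x) (norm_nonneg _)).trans (ih _)

lemma TowerExpansive.injective (he : TowerExpansive T) (n : ℕ) :
    Function.Injective (towerComp T n) := by
  intro x y hxy
  have h := he.norm_le_towerComp n (x - y)
  rw [map_sub, hxy, sub_self, norm_zero] at h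
  exact sub_eq_zero.1 (norm_le_zero_iff.1 h)

lemma TowerExpansive.isClosed_range (he : TowerExpansive T) (n : ℕ) :
    IsClosed ((LinearMap.range (towerComp T n).toLinearMap : Submodule ℂ (G 0)) : Set (G 0)) := by
  have h : AntilipschitzWith 1 (towerComp T n) :=
    ContinuousLinearMap.antilipschitz_of_bound _ fun x => by
      simpa using he.norm_le_towerComp n x
  exact h.isClosed_range (towerComp T n).uniformContinuous

/-- An expansive operator which preserves the norm of `x` satisfies `T* T x = x`. -/
lemma adjoint_apply_eq_of_norm_eq {K L : Type*} [NormedAddCommGroup K] [InnerProductSpace ℂ K]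
    [CompleteSpace K] [NormedAddCommGroup L] [InnerProductSpace ℂ L] [CompleteSpace L]
    {A : K →L[ℂ] L} (hA : ∀ x, ‖x‖ ^ 2 ≤ ‖A x‖ ^ 2) {x : K} (hx : ‖A x‖ ^ 2 = ‖x‖ ^ 2) :
    (A†) (A x) = x := by
  set d := (A†) (A x) - x with hd
  by_contra hne
  have hd0 : d ≠ 0 := sub_ne_zero.2 hne
  -- The nonnegative form `‖A u‖² - ‖u‖²` vanishes at `x`, so it is minimal there; its expansion
  -- along `x + t d` has linear coefficient `2‖d‖²`, which must therefore be zero.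
  have key (t : ℝ) : 0 ≤ 2 * t * ‖d‖ ^ 2 + t ^ 2 * (‖A d‖ ^ 2 - ‖d‖ ^ 2) := by
    have h1 := hA (x + (t : ℂ) • d)
    have e1 : ‖x + (t : ℂ) • d‖ ^ 2 = ‖x‖ ^ 2 + 2 * t * (inner ℂ x d).re + t ^ 2 * ‖d‖ ^ 2 := by
      rw [@norm_add_sq ℂ, inner_smul_right, norm_smul]
      simp [mul_pow]; ring
    have e2 : ‖A (x + (t : ℂ) • d)‖ ^ 2
        = ‖A x‖ ^ 2 + 2 * t * (inner ℂ (A x) (A d)).re + t ^ 2 * ‖A d‖ ^ 2 := by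
      rw [map_add, map_smul, @norm_add_sq ℂ, inner_smul_right, norm_smul]
      simp [mul_pow]; ring
    have e3 : (inner ℂ (A x) (A d)).re = (inner ℂ x d).re + ‖d‖ ^ 2 := by
      rw [← ContinuousLinearMap.adjoint_inner_left, show (A†) (A x) = x + d by rw [hd]; abel,
        inner_add_left, Complex.add_re]
      congr 1
      exact inner_self_eq_norm_sq (𝕜 := ℂ) d
    rw [e1, e2, e3, hx] at h1
    nlinarith
  have hp : 0 < ‖d‖ ^ 2 := by positivity
  set c := ‖A d‖ ^ 2 - ‖d‖ ^ 2 with hc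
  have hc0 : 0 ≤ c := sub_nonneg.2 (hA d)
  -- A negative `t` small enough for the linear term to dominate; the denominator `c + 1` avoids a
  -- separate case `c = 0`.
  have h2 := key (-(‖d‖ ^ 2 / (c + 1)))
  have h3 : c + 1 ≠ 0 := by positivity
  have h4 : 2 * -(‖d‖ ^ 2 / (c + 1)) * ‖d‖ ^ 2 + (-(‖d‖ ^ 2 / (c + 1))) ^ 2 * c
      = -((‖d‖ ^ 2) ^ 2 * (c + 2)) / (c + 1) ^ 2 := by
    field_simp; ring
  rw [h4] at h2
  have h5 : 0 < (‖d‖ ^ 2) ^ 2 * (c + 2) / (c + 1) ^ 2 := by positivity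
  rw [neg_div] at h2
  linarith

/-- A nonnegative real sequence which is concave and nonincreasing is constant. -/
lemma eq_of_concave_of_antitone {b : ℕ → ℝ} (h0 : ∀ n, 0 ≤ b n)
    (hc : ∀ n, b n + b (n + 2) ≤ 2 * b (n + 1)) (ha : ∀ n, b (n + 1) ≤ b n) (n : ℕ) :
    b (n + 1) = b n := by
  refine le_antisymm (ha n) ?_
  by_contra! hlt
  -- After one strict drop, concavity forces a drop at least as large at every later step, and the
  -- sequence would become negative.
  have key (m : ℕ) : b (n + m) ≤ b n - m * (b n - b (n + 1)) ∧
      b (n + m + 1) - b (n + m) ≤ b (n + 1) - b n := by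
    induction m with
    | zero => simp
    | succ m ih =>
      have h1 := hc (n + m)
      have e1 : n + (m + 1) = n + m + 1 := by ring
      have e2 : n + (m + 1) + 1 = n + m + 2 := by ring
      rw [e2, e1]
      push_cast
      constructor <;> nlinarith [ih.1, ih.2]
  have hp : 0 < b n - b (n + 1) := sub_pos.2 hlt
  obtain ⟨m, hm⟩ := exists_nat_gt (b n / (b n - b (n + 1)))
  rw [div_lt_iff₀ hp] at hm
  have := (key m).1
  linarith [h0 (n + m)]

/-- Injectivity makes the preimages `yₙ` of `z` compatible, and their norms are constant. The
equality case of expansivity then gives `Tₙ* yₙ = yₙ₊₁`, so the adjoint of the composition sends `z`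
to `yₙ`, a vector in the range of `Tₙ` and hence orthogonal to `ker Tₙ*`. -/
lemma TowerConcave.orthoKernels_of_inAllRanges (hc : TowerConcave T) (he : TowerExpansive T)
    {z : G 0} (hz : InAllRanges T z) : OrthoKernels T z := by
  choose y hy using hz
  have hs (n) : T n (y (n + 1)) = y n := he.injective n (by rw [hy, ← towerComp_succ, hy])
  have hconst := eq_of_concave_of_antitone (b := fun n => ‖y n‖ ^ 2) (fun n => by positivity)
    (fun n => by
      have := hc n (y (n + 1 + 1))
      rwa [hs, hs] at this)
    (fun n => by
      have := he n (y (n + 1))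
      rwa [hs] at this)
  have hadj (n) : ((T n)†) (y n) = y (n + 1) := by
    have := adjoint_apply_eq_of_norm_eq (he n) (x := y (n + 1)) (by rw [hs]; exact (hconst n).symm)
    rwa [hs] at this
  have hcadj (n) : ((towerComp T n)†) z = y n := by
    induction n with
    | zero =>
      refine ext_inner_left ℂ fun x => ?_
      rw [ContinuousLinearMap.adjoint_inner_right, ← hy 0]; rfl
    | succ n ih =>
      have : ((towerComp T (n + 1))†) = ((T n)†) ∘L ((towerComp T n)†) :=
        ContinuousLinearMap.adjoint_comp _ _
      rw [this, ContinuousLinearMap.comp_apply, ih, hadj]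
  intro n w hw
  rw [← ContinuousLinearMap.adjoint_inner_right, hcadj, ← hs, ← ContinuousLinearMap.adjoint_inner_left,
    hw, inner_zero_left]

/-- If the partial sums of a nonnegative sequence are bounded, then `n aₙ ≤ 1` infinitely often. -/
lemma exists_mul_le_one {d : ℕ → ℝ} {B : ℝ} (h0 : ∀ n, 0 ≤ d n)
    (hB : ∀ n, ∑ k ∈ Finset.range n, d k ≤ B) (N : ℕ) : ∃ n ≥ N, (n + 1) * d n ≤ 1 := by
  by_contra! hcon
  have h1 : Summable d := summable_of_sum_range_le h0 hB
  refine Real.not_summable_one_div_natCast ?_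
  rw [← summable_nat_add_iff (N + 1)]
  refine Summable.of_nonneg_of_le (fun n => by positivity) (fun n => ?_)
    ((summable_nat_add_iff N).2 h1)
  have h2 := hcon (n + N) (by omega)
  push_cast at h2 ⊢
  rw [div_le_iff₀ (by positivity)]
  nlinarith

/-- The sequence `z, L₀ z, L₁ L₀ z, …` for `Lₙ = Sₙ*`. -/
noncomputable def pullback (S : ∀ n, G (n + 1) →L[ℂ] G n) (z : G 0) : ∀ n, G n
  | 0 => z
  | n + 1 => ((S n)†) (pullback S z n)

/-- Each step of the pullback projects onto a range, so the defects `dₙ = ‖Tₙ pₙ₊₁‖² - ‖pₙ₊₁‖²`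
telescope to a total of at most `‖z‖²`. A summable nonnegative sequence has `(n + 1) dₙ ≤ 1`
infinitely often, and this is the error term allowed by concavity. -/
lemma IsCauchyDual.exists_bounded (h : IsCauchyDual T S) (hc : TowerConcave T)
    (he : TowerExpansive T) (z : G 0) (N : ℕ) :
    ∃ n ≥ N, ‖towerComp T n (pullback S z n)‖ ^ 2 ≤ ‖z‖ ^ 2 + 1 := by
  set p := pullback S z
  set d : ℕ → ℝ := fun n => ‖T n (p (n + 1))‖ ^ 2 - ‖p (n + 1)‖ ^ 2 with hd
  have hd0 (n) : 0 ≤ d n := sub_nonneg.2 (he n _)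
  have hsum (n) : ‖p n‖ ^ 2 + ∑ k ∈ Finset.range n, d k ≤ ‖z‖ ^ 2 := by
    induction n with
    | zero => simp [p, pullback]
    | succ n ih =>
      rw [Finset.sum_range_succ]
      have h1 : ‖T n (p (n + 1))‖ ≤ ‖p n‖ := h.norm_proj_le n (p n)
      have h2 : ‖T n (p (n + 1))‖ ^ 2 ≤ ‖p n‖ ^ 2 := by gcongr
      simp only [hd] at ih ⊢
      linarith
  obtain ⟨n, hn, hn1⟩ := exists_mul_le_one hd0
    (fun n => (le_add_of_nonneg_left (by positivity)).trans (hsum n)) N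
  -- The index shifts by one because the defect `dₙ` controls the composition applied to `pₙ₊₁`.
  refine ⟨n + 1, by omega, (hc.norm_towerComp_le n _).trans ?_⟩
  have h1 := hsum (n + 1)
  have h2 : 0 ≤ ∑ k ∈ Finset.range (n + 1), d k := Finset.sum_nonneg fun k _ => hd0 k
  simp only [hd] at hn1 h1 h2
  linarith

/-- What one projection step discards lies in `ker Tₙ*`, and `y` does not see its image in `G 0`. -/
lemma IsCauchyDual.inner_towerComp_pullback (h : IsCauchyDual T S) {y : G 0}
    (hy : OrthoKernels T y) (z : G 0) (n : ℕ) :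
    inner ℂ (towerComp T n (pullback S z n)) y = inner ℂ z y := by
  induction n with
  | zero => rfl
  | succ n ih =>
    rw [← ih, ← sub_eq_zero, ← inner_sub_left, towerComp_succ, ← map_sub, ← neg_sub, map_neg,
      inner_neg_left, neg_eq_zero]
    exact hy n _ (h.adjoint_sub n _)

/-- Subtract from `z` its projection onto the intersection of the ranges. The remainder `z₀` is
still orthogonal to the kernels, so its bounded approximants `y` in the `n`-th ranges satisfy `⟨y,
z₀⟩ = ‖z₀‖²`. Being orthogonal to the intersection, `z₀` is a limit of vectors orthogonal to one of
the ranges, which makes these products arbitrarily small. -/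
lemma IsCauchyDual.inAllRanges_of_orthoKernels (h : IsCauchyDual T S) (hc : TowerConcave T)
    (he : TowerExpansive T) {z : G 0} (hz : OrthoKernels T z) : InAllRanges T z := by
  set V : ℕ → Submodule ℂ (G 0) := fun n => LinearMap.range (towerComp T n).toLinearMap with hV
  have hVc (n) : IsClosed (V n : Set (G 0)) := he.isClosed_range n
  have hVanti : Antitone V := antitone_nat_of_succ_le fun n => by
    rintro _ ⟨x, rfl⟩
    exact ⟨T n x, rfl⟩
  set V' : Submodule ℂ (G 0) := ⨅ n, V n with hV'
  have hV'c : IsClosed (V' : Set (G 0)) := by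
    rw [hV', Submodule.coe_iInf]; exact isClosed_iInter hVc
  have : CompleteSpace V' := hV'c.completeSpace_coe
  have hVr {x : G 0} (hx : x ∈ V') : OrthoKernels T x :=
    hc.orthoKernels_of_inAllRanges he fun n => (Submodule.mem_iInf _).1 hx n
  suffices hmem : z ∈ V' from fun n => (Submodule.mem_iInf _).1 hmem n
  set p := V'.starProjection z with hp
  have hpV : p ∈ V' := V'.starProjection_apply_mem z
  set z₀ := z - p with hz₀
  have hz₀perp : z₀ ∈ V'ᗮ := V'.sub_starProjection_mem_orthogonal z
  have hz₀K : OrthoKernels T z₀ := fun n w hw => by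
    rw [hz₀, inner_sub_right, hz n w hw, hVr hpV n w hw, sub_zero]
  have hdense : z₀ ∈ (⨆ n, (V n)ᗮ).topologicalClosure := by
    rw [← Submodule.orthogonal_orthogonal_eq_closure, ← Submodule.iInf_orthogonal]
    have : ⨅ n, (V n)ᗮᗮ = V' := iInf_congr fun n => by
      rw [Submodule.orthogonal_orthogonal_eq_closure, (hVc n).submodule_topologicalClosure_eq]
    rwa [this]
  have hdir : Directed (· ≤ ·) fun n => (V n)ᗮ :=
    Monotone.directed_le fun a b hab => Submodule.orthogonal_le (hVanti hab)
  have hzero : ‖z₀‖ ^ 2 = 0 := by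
    refine le_antisymm (le_of_forall_pos_le_add fun ε hε => ?_) (by positivity)
    -- The bound on `‖y‖²` serves also as a bound on `‖y‖`, because it is at least `1`.
    set B := ‖z₀‖ ^ 2 + 1 with hB
    have hB0 : 0 < B := by positivity
    obtain ⟨z', hz', hdist⟩ := Metric.mem_closure_iff.1 hdense (ε / B) (by positivity)
    obtain ⟨m, hm⟩ := (Submodule.mem_iSup_of_directed _ hdir).1 hz'
    -- The ranges decrease, so `n ≥ m` ensures that `y` lies in `V m` and is orthogonal to `z'`.
    obtain ⟨n, hn, hbd⟩ := h.exists_bounded hc he z₀ m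
    set y := towerComp T n (pullback S z₀ n) with hy
    have h1 : inner ℂ y z₀ = inner ℂ y (z₀ - z') := by
      rw [inner_sub_right y z₀ z', Submodule.inner_right_of_mem_orthogonal (hVanti hn ⟨_, rfl⟩ : y ∈ V m) hm,
        sub_zero]
    have h2 : inner ℂ y z₀ = inner ℂ z₀ z₀ := h.inner_towerComp_pullback hz₀K z₀ n
    have h3 : ‖z₀‖ ^ 2 = ‖inner ℂ y (z₀ - z')‖ := by
      rw [← h1, h2, inner_self_eq_norm_sq_to_K]
      simp
    have h4 : ‖y‖ ≤ B := by
      have : (1 : ℝ) ≤ B := by rw [hB]; linarith [sq_nonneg ‖z₀‖]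
      nlinarith [norm_nonneg y]
    rw [h3, zero_add]
    refine (norm_inner_le_norm _ _).trans ?_
    rw [dist_eq_norm] at hdist
    calc ‖y‖ * ‖z₀ - z'‖ ≤ B * (ε / B) := by gcongr
      _ = ε := by field_simp
  have h0 : z - p = 0 := norm_eq_zero.1 (pow_eq_zero_iff two_ne_zero |>.1 hzero)
  rwa [sub_eq_zero.1 h0]

/-- The Wold decomposition of a concave expansive tower. -/
theorem IsCauchyDual.inAllRanges_iff (h : IsCauchyDual T S) (hc : TowerConcave T)
    (he : TowerExpansive T) (z : G 0) : InAllRanges T z ↔ OrthoKernels T z :=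
  ⟨hc.orthoKernels_of_inAllRanges he, h.inAllRanges_of_orthoKernels hc he⟩

/-- The Wold decomposition of a tower with a concave expansive Cauchy dual. -/
theorem IsCauchyDual.inAllRanges_iff' (h : IsCauchyDual T S) (hc : TowerConcave S)
    (he : TowerExpansive S) (z : G 0) : InAllRanges T z ↔ OrthoKernels T z := by
  rw [← h.symm.orthoKernels_iff, ← h.symm.inAllRanges_iff hc he, h.orthoKernels_iff]

end Tower

lemma re_inner_self {V : Type*} [NormedAddCommGroup V] [InnerProductSpace ℂ V] (x : V) :
    (inner ℂ x x).re = ‖x‖ ^ 2 :=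
  inner_self_eq_norm_sq (𝕜 := ℂ) x

/-! ### Ampliations `I_E ⊗ X`: transfer of norm inequalities upwards and downwards -/

section Ampliation

variable {M : Type u} [NonUnitalCStarAlgebra M] [PartialOrder M] [StarOrderedRing M]
variable {K : HilbertRep.{u, w} M} {L : HilbertRep.{u, w'} M} {N : HilbertRep.{u, w''} M}
variable (E : Correspondence.{u, v} M)

/-! ### Elementary tensors in `tensorRep E K` -/

section Elementary

variable {E}

/-- The elementary tensor `ξ ⊗ h`, as a vector of the representation `tensorRep E K`. -/
noncomputable def tmk (ξ : E) (h : K) : tensorRep E K := (htmul ξ h : HTensor E K)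

lemma tmk_ext {F : Type*} [NormedAddCommGroup F] [NormedSpace ℂ F]
    {f g : tensorRep E K →L[ℂ] F} (h : ∀ ξ x, f (tmk ξ x) = g (tmk ξ x)) : f = g :=
  htensor_ext (E := E) (K := K) h

lemma tmk_inner_ext {x y : tensorRep E K}
    (h : ∀ (ξ : E) (g : K), inner ℂ (tmk ξ g) x = inner ℂ (tmk ξ g) y) : x = y :=
  inner_ext (E := E) (K := K) h

lemma inner_tmk (ξ η : E) (h g : K) :
    inner ℂ (tmk ξ h) (tmk η g) = inner ℂ h (K.π (rip M ξ η) g) :=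
  inner_htmul ξ η h g

lemma π_tmk (a : M) (ξ : E) (h : K) : (tensorRep E K).π a (tmk ξ h) = tmk (E.lact a ξ) h :=
  hact_htmul a ξ h

lemma ampliate_tmk (X : Intertwiner K L) (ξ : E) (h : K) :
    (X.ampliate E).toCLM (tmk ξ h) = tmk ξ (X.toCLM h) :=
  ampliate_htmul E X ξ h

/-- The map `ξ ↦ ξ ⊗ h`. -/
noncomputable def tmkLeft (E : Correspondence.{u, v} M) (h : K) : E →L[ℂ] tensorRep E K :=
  LinearMap.mkContinuous
    { toFun := fun ξ => tmk ξ h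
      map_add' := fun ξ η => htmul_add_left ξ η h
      map_smul' := fun c ξ => htmul_smul_left c ξ h } ‖h‖
    fun ξ => by rw [mul_comm]; exact norm_htmul_le ξ h

/-- The creation operator `h ↦ ξ ⊗ h`. -/
noncomputable def tmkRight (ξ : E) (K : HilbertRep.{u, w} M) : K →L[ℂ] tensorRep E K := hcreate K ξ

lemma tmkRight_apply (ξ : E) (h : K) : tmkRight ξ K h = tmk ξ h := rfl

/-- Finite sums of elementary tensors are dense. -/
lemma tmk_sum_induction {p : tensorRep E K → Prop} (hp : IsClosed {x | p x})
    (h : ∀ (n : ℕ) (ξ : Fin n → E) (g : Fin n → K), p (∑ i, tmk (ξ i) (g i)))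
    (x : tensorRep E K) : p x := by
  refine denseRange_hι.induction_on (p := fun x : HTensor E K => p x) x hp fun x => ?_
  obtain ⟨n, ξ, g, rfl⟩ := exists_sum_tmul x
  rw [map_sum]
  exact h n ξ g

lemma norm_sum_tmk {n : ℕ} (ξ : Fin n → E) {S : CStarMatrix (Fin n) (Fin n) M}
    (hS : (CStarMatrix.ofMatrix fun i j => rip M (ξ i) (ξ j)) = star S * S) (h : Fin n → K) :
    ‖∑ i, tmk (ξ i) (h i)‖ ^ 2 = ∑ k, ‖∑ i, K.π (S k i) (h i)‖ ^ 2 := by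
  rw [← hform_sum E ξ hS h, map_sum]; rfl

end Elementary

/-! ### Algebra of the operators `I_E ⊗ X` -/

/-- The identity intertwiner. -/
noncomputable def Intertwiner.id (K : HilbertRep.{u, w} M) : Intertwiner K K where
  toCLM := ContinuousLinearMap.id ℂ K
  comm _ _ := rfl

lemma ampliate_id : ((Intertwiner.id K).ampliate E).toCLM =
    ContinuousLinearMap.id ℂ (tensorRep E K) :=
  tmk_ext fun ξ x => ampliate_tmk (Intertwiner.id K) ξ x

lemma ampliate_comp (Y : Intertwiner L N) (X : Intertwiner K L) :
    ((Y.comp X).ampliate E).toCLM = (Y.ampliate E).toCLM ∘L (X.ampliate E).toCLM :=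
  tmk_ext fun ξ x => by
    rw [ContinuousLinearMap.comp_apply, ampliate_tmk, ampliate_tmk, ampliate_tmk]; rfl

lemma ampliate_comp_apply (Y : Intertwiner L N) (X : Intertwiner K L) (x : tensorRep E K) :
    ((Y.comp X).ampliate E).toCLM x = (Y.ampliate E).toCLM ((X.ampliate E).toCLM x) :=
  DFunLike.congr_fun (ampliate_comp E Y X) x

lemma ampliate_congr {X Y : Intertwiner K L} (h : ∀ x, X.toCLM x = Y.toCLM x) (x : tensorRep E K) :
    (X.ampliate E).toCLM x = (Y.ampliate E).toCLM x := by
  refine DFunLike.congr_fun (f := (X.ampliate E).toCLM) (tmk_ext fun ξ x => ?_) x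
  rw [ampliate_tmk, ampliate_tmk, h]

lemma Intertwiner.adjoint_inner_right (X : Intertwiner K L) (x : K) (y : L) :
    inner ℂ x (X.adjoint.toCLM y) = inner ℂ (X.toCLM x) y :=
  ContinuousLinearMap.adjoint_inner_right _ _ _

lemma Intertwiner.adjoint_inner_left (X : Intertwiner K L) (x : K) (y : L) :
    inner ℂ (X.adjoint.toCLM y) x = inner ℂ y (X.toCLM x) :=
  ContinuousLinearMap.adjoint_inner_left _ _ _

lemma ampliate_adjoint (X : Intertwiner K L) :
    (X.adjoint.ampliate E).toCLM = ((X.ampliate E).toCLM†) := by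
  refine tmk_ext fun ξ y => tmk_inner_ext fun η x => ?_
  rw [ContinuousLinearMap.adjoint_inner_right, ampliate_tmk, ampliate_tmk, inner_tmk, inner_tmk,
    ← X.adjoint.comm, X.adjoint_inner_right]

lemma ampliate_adjoint_apply (X : Intertwiner K L) (y : tensorRep E L) :
    (X.adjoint.ampliate E).toCLM y = ((X.ampliate E).toCLM†) y :=
  DFunLike.congr_fun (ampliate_adjoint E X) y

/-- Quadratic inequalities between intertwiners are preserved by ampliation. -/
lemma ampliate_quadratic_le (Y : Intertwiner K N) (Z : Intertwiner K L) {a b c : ℝ}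
    (h : ∀ x, a * ‖Y.toCLM x‖ ^ 2 + b * ‖x‖ ^ 2 ≤ c * ‖Z.toCLM x‖ ^ 2) (x : tensorRep E K) :
    a * ‖(Y.ampliate E).toCLM x‖ ^ 2 + b * ‖x‖ ^ 2 ≤ c * ‖(Z.ampliate E).toCLM x‖ ^ 2 := by
  refine tmk_sum_induction (p := fun x =>
    a * ‖(Y.ampliate E).toCLM x‖ ^ 2 + b * ‖x‖ ^ 2 ≤ c * ‖(Z.ampliate E).toCLM x‖ ^ 2)
    (isClosed_le (by fun_prop) (by fun_prop)) (fun n ξ g => ?_) x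
  -- Factoring the Gram matrix as `S* S` turns the squared norm of a sum of elementary tensors into
  -- a sum of squared norms in `K`. Intertwiners commute with the entries `π(S k i)`, so the
  -- hypothesis applies to each summand.
  obtain ⟨S, hS⟩ := exists_gram_factor (M := M) ξ
  simp only [map_sum, ampliate_tmk]
  rw [norm_sum_tmk ξ hS, norm_sum_tmk ξ hS, norm_sum_tmk ξ hS, Finset.mul_sum,
    Finset.mul_sum, Finset.mul_sum, ← Finset.sum_add_distrib]
  refine Finset.sum_le_sum fun k _ => ?_
  have := h (∑ i, K.π (S k i) (g i))
  simpa only [map_sum, Y.comm, Z.comm] using this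

/-! ### Descending along a nondegenerate correspondence -/

variable {E}

/-- `π(⟨E, E⟩)` acts nondegenerately on `E ⊗ K`. -/
lemma Correspondence.InnerNondegenerate.eq_zero (hE : E.InnerNondegenerate) {v : tensorRep E K}
    (hv : ∀ ξ η : E, (tensorRep E K).π (rip M ξ η) v = 0) : v = 0 := by
  refine tmk_inner_ext fun ζ h => ?_
  rw [inner_zero_right]
  have hζ : ζ ∈ (Submodule.span ℂ
      {y : E | ∃ ξ η ζ : E, y = E.lact (rip M ξ η) ζ}).topologicalClosure := by
    rw [hE]; trivial
  -- The functional `ζ ↦ ⟨v, ζ ⊗ h⟩` kills the vectors `φ(⟨ξ, η⟩) ζ`, since the action moves to `v`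
  -- as that of `⟨η, ξ⟩`; by density it is zero.
  have hle : Submodule.span ℂ {y : E | ∃ ξ η ζ : E, y = E.lact (rip M ξ η) ζ} ≤
      LinearMap.ker ((innerSL ℂ v) ∘L tmkLeft E h).toLinearMap := by
    refine Submodule.span_le.2 ?_
    rintro _ ⟨ξ, η, ζ, rfl⟩
    change inner ℂ v (tmk (E.lact (rip M ξ η) ζ) h) = 0
    rw [← π_tmk, ← star_rip, ← (tensorRep E K).inner_π, hv, inner_zero_left]
  have h1 := Submodule.topologicalClosure_minimal _ hle
    (ContinuousLinearMap.isClosed_ker ((innerSL ℂ v) ∘L tmkLeft E h)) hζ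
  exact inner_eq_zero_symm.1 h1

/-- The matrix coefficient `⟨u, π(⟨ξ, η⟩) v⟩` is the inner product of `ξ ⊗ u` and `η ⊗ v`. -/
lemma π_rip_eq_zero {v : K} (hv : ∀ ξ : E, tmk ξ v = 0) (ξ η : E) :
    K.π (rip M ξ η) v = 0 := by
  refine ext_inner_left ℂ fun u => ?_
  rw [← inner_tmk, hv, inner_zero_right, inner_zero_right]

/-- A self-adjoint operator in the commutant of a representation `K` is positive if `I_E ⊗ A` is
positive on elementary tensors and `π(⟨E, E⟩)` is nondegenerate on `K`. -/
lemma nonneg_of_ampliate_nonneg {A : K →L[ℂ] K} (hA : IsSelfAdjoint A)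
    (hcomm : ∀ a, Commute A (K.π a))
    (hK : ∀ v : K, (∀ ξ η : E, K.π (rip M ξ η) v = 0) → v = 0)
    (hpos : ∀ (ξ : E) (x : K), 0 ≤ (inner ℂ x (K.π (rip M ξ ξ) (A x))).re) : 0 ≤ A := by
  -- The aim is to show that the negative part vanishes. It and its square root commute with the
  -- representation by functional calculus, so they can be moved across `π(⟨ξ, ξ⟩)`.
  set B := A⁻ with hB
  have hB0 : 0 ≤ B := CFC.negPart_nonneg A
  have hBsa : IsSelfAdjoint B := IsSelfAdjoint.of_nonneg hB0
  have hBc (a) : Commute B (K.π a) := (hcomm a).cfcₙ_real _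
  set r := CFC.sqrt B with hr
  have hrsa : IsSelfAdjoint r := IsSelfAdjoint.of_nonneg (CFC.sqrt_nonneg B)
  have hrr : r * r = B := CFC.sqrt_mul_sqrt_self B hB0
  have hrc (a) : Commute r (K.π a) := (hBc a).cfcₙ_nnreal _
  have hrB : Commute r B := (by rw [← hrr]; exact (Commute.refl r).mul_right (Commute.refl r))
  have hBAB : B * A * B = -(B * B * B) := by
    conv_lhs => rw [← CFC.posPart_sub_negPart A hA]
    rw [mul_sub, sub_mul, CFC.negPart_mul_posPart]; simp [hB]
  have hsaB (x y : K) : inner ℂ (B x) y = inner ℂ x (B y) := by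
    conv_lhs => rw [← hBsa.adjoint_eq, ContinuousLinearMap.adjoint_inner_left]
  have hsar (x y : K) : inner ℂ (r x) y = inner ℂ x (r y) := by
    conv_lhs => rw [← hrsa.adjoint_eq, ContinuousLinearMap.adjoint_inner_left]
  have hcB (a) (x : K) : B (K.π a x) = K.π a (B x) := DFunLike.congr_fun (hBc a).eq x
  have hcr (a) (x : K) : r (K.π a x) = K.π a (r x) := DFunLike.congr_fun (hrc a).eq x
  -- Positivity tested at `B x`, with `B A B = -B³`, reads `0 ≤ -‖ξ ⊗ r B x‖²`; thus `ξ ⊗ r B x = 0`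
  -- for every `ξ`, and nondegeneracy applies.
  have hvz (x : K) : r (B x) = 0 := by
    refine hK _ (π_rip_eq_zero fun ξ => ?_)
    have h1 := hpos ξ (B x)
    have h2 : B (A (B x)) = -(B (r (r (B x)))) := by
      have h3 := DFunLike.congr_fun hBAB x
      have h4 := DFunLike.congr_fun hrr (B x)
      change r (r (B x)) = B (B x) at h4
      rw [h4]
      exact h3
    have h5 : inner ℂ (B x) (K.π (rip M ξ ξ) (A (B x)))
        = -inner ℂ (tmk ξ (r (B x))) (tmk ξ (r (B x))) := by
      have h6 : r (B x) = B (r x) := DFunLike.congr_fun hrB.eq x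
      rw [hsaB, hcB, h2, map_neg, inner_neg_right, inner_tmk, ← hcB, ← hsaB, ← hcr, ← hsar]
    rw [h5] at h1
    have h7 : (inner ℂ (tmk ξ (r (B x))) (tmk ξ (r (B x)))).re
        = ‖(tmk ξ (r (B x)))‖ ^ 2 := inner_self_eq_norm_sq (𝕜 := ℂ) _
    rw [Complex.neg_re, h7] at h1
    have h8 : ‖(tmk ξ (r (B x)))‖ ^ 2 = 0 := le_antisymm (by linarith) (by positivity)
    simpa using h8
  have hBz : B = 0 := by
    ext x
    have h1 : B (B x) = 0 := by
      have h4 := DFunLike.congr_fun hrr (B x)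
      change r (r (B x)) = B (B x) at h4
      rw [← h4, hvz, map_zero]
    have h2 : inner ℂ (B x) (B x) = 0 := by rw [hsaB, h1, inner_zero_right]
    simpa using h2
  rw [← CFC.posPart_sub_negPart A hA, ← hB, hBz, sub_zero]
  exact CFC.posPart_nonneg A

/-- A lower bound of `I_E ⊗ Y` on `E ⊗ K` is a lower bound of `Y`. -/
lemma norm_sq_le_of_ampliate (hK : ∀ v : K, (∀ ξ η : E, K.π (rip M ξ η) v = 0) → v = 0)
    (Y : Intertwiner K L) {c : ℝ}
    (h : ∀ x : tensorRep E K, c * ‖x‖ ^ 2 ≤ ‖(Y.ampliate E).toCLM x‖ ^ 2) (x : K) :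
    c * ‖x‖ ^ 2 ≤ ‖Y.toCLM x‖ ^ 2 := by
  have hcomp (x y : K) : inner ℂ x ((Y.adjoint.comp Y).toCLM y) = inner ℂ (Y.toCLM x) (Y.toCLM y) :=
    Y.adjoint_inner_right _ _
  -- The bound to prove is positivity of `Y* Y - c`, an operator in the commutant; the hypothesis at
  -- `ξ ⊗ x` is its positivity after ampliation.
  set A : K →L[ℂ] K := (Y.adjoint.comp Y).toCLM - (c : ℂ) • ContinuousLinearMap.id ℂ K
  have hAx (x : K) : A x = (Y.adjoint.comp Y).toCLM x - (c : ℂ) • x := rfl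
  have hform (x y : K) : inner ℂ x (A y)
      = inner ℂ (Y.toCLM x) (Y.toCLM y) - c * inner ℂ x y := by
    rw [hAx, inner_sub_right, inner_smul_right, hcomp]
  have hAπ (a : M) (x : K) : A (K.π a x) = K.π a (A x) := by
    rw [hAx, hAx, (Y.adjoint.comp Y).comm, map_sub, map_smul]
  have hA0 : 0 ≤ A := by
    refine nonneg_of_ampliate_nonneg (E := E) ?_ ?_ hK ?_
    · rw [ContinuousLinearMap.isSelfAdjoint_iff_isSymmetric]
      intro x y
      change inner ℂ (A x) y = inner ℂ x (A y)
      rw [← inner_conj_symm, hform, hform, map_sub, map_mul, inner_conj_symm, inner_conj_symm,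
        Complex.conj_ofReal]
    · intro a
      ext x
      exact hAπ a x
    · intro ξ x
      have h1 := h (tmk ξ x)
      rw [ampliate_tmk] at h1
      have h2 : inner ℂ x (K.π (rip M ξ ξ) (A x))
          = inner ℂ (tmk ξ (Y.toCLM x)) (tmk ξ (Y.toCLM x)) - c * inner ℂ (tmk ξ x) (tmk ξ x) := by
        rw [← hAπ, hform, Y.comm, inner_tmk, inner_tmk]
      rw [h2, Complex.sub_re, Complex.re_ofReal_mul, re_inner_self, re_inner_self]
      exact sub_nonneg.2 h1
  have h1 := ((ContinuousLinearMap.nonneg_iff_isPositive A).1 hA0).re_inner_nonneg_right x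
  rw [hform, RCLike.re_eq_complex_re, Complex.sub_re, Complex.re_ofReal_mul, re_inner_self,
    re_inner_self] at h1
  exact sub_nonneg.1 h1

end Ampliation

section SingleRep

variable {M : Type u} [NonUnitalCStarAlgebra M] [PartialOrder M] [StarOrderedRing M]

/-! ### Cauchy duals of intertwiners -/

section CauchyDual

variable {K : HilbertRep.{u, w} M} {L : HilbertRep.{u, w'} M}

/-- `Y` is the Cauchy dual `X (X* X)⁻¹` of `X`. -/
structure Intertwiner.IsDual (X Y : Intertwiner K L) : Prop where
  left_inv : ∀ x, Y.adjoint.toCLM (X.toCLM x) = x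
  adj_comm : ∀ x, X.toCLM (Y.adjoint.toCLM x) = Y.toCLM (X.adjoint.toCLM x)

lemma Intertwiner.IsDual.ampliate {X Y : Intertwiner K L} (h : X.IsDual Y)
    (E : Correspondence.{u, v} M) : (X.ampliate E).IsDual (Y.ampliate E) where
  left_inv x := by
    refine (DFunLike.congr_fun (ampliate_adjoint E Y).symm _).trans ?_
    rw [← ampliate_comp_apply]
    refine (ampliate_congr E (Y := Intertwiner.id K) h.left_inv x).trans ?_
    rw [ampliate_id]; rfl
  adj_comm x := by
    have h1 := DFunLike.congr_fun (ampliate_adjoint E Y) x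
    have h2 := DFunLike.congr_fun (ampliate_adjoint E X) x
    change (X.ampliate E).toCLM (((Y.ampliate E).toCLM†) x)
      = (Y.ampliate E).toCLM (((X.ampliate E).toCLM†) x)
    rw [← h1, ← h2, ← ampliate_comp_apply, ← ampliate_comp_apply]
    exact ampliate_congr E h.adj_comm x

/-- A lower bound makes `X* X` invertible. Its inverse `D` is again self-adjoint and intertwining,
so `X D` is the required dual. -/
lemma Intertwiner.exists_isDual (X : Intertwiner K L) {c : ℝ} (hc : 0 < c)
    (h : ∀ x, c * ‖x‖ ^ 2 ≤ ‖X.toCLM x‖ ^ 2) : ∃ Y : Intertwiner K L, X.IsDual Y := by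
  set C := X.adjoint.comp X with hC
  have hCin (x y : K) : inner ℂ (C.toCLM x) y = inner ℂ (X.toCLM x) (X.toCLM y) :=
    X.adjoint_inner_left _ _
  have hCsa (x y : K) : inner ℂ (C.toCLM x) y = inner ℂ x (C.toCLM y) := by
    rw [hCin, ← X.adjoint_inner_right]; rfl
  have hu : IsUnit C.toCLM := by
    refine ContinuousLinearMap.isUnit_of_forall_le_norm_inner_map _ (c := ⟨c, hc.le⟩) hc fun x => ?_
    rw [hCin, inner_self_eq_norm_sq_to_K]
    rw [norm_pow, RCLike.norm_ofReal, abs_norm, mul_comm]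
    exact h x
  obtain ⟨D, hCD, hDC⟩ := isUnit_iff_exists.1 hu
  have hCD' (x : K) : C.toCLM (D x) = x := DFunLike.congr_fun hCD x
  have hDC' (x : K) : D (C.toCLM x) = x := DFunLike.congr_fun hDC x
  have hDsa (x y : K) : inner ℂ (D x) y = inner ℂ x (D y) := by
    conv_lhs => rw [← hCD' y, ← hCsa, hCD']
  let D' : Intertwiner K K := ⟨D, fun a x => by
    conv_lhs => rw [← hCD' x, ← C.comm, hDC']⟩
  have hadj (y : L) : (X.comp D').adjoint.toCLM y = D (X.adjoint.toCLM y) := by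
    refine ext_inner_left ℂ fun x => ?_
    rw [Intertwiner.adjoint_inner_right, ← hDsa, X.adjoint_inner_right]; rfl
  refine ⟨X.comp D', fun x => ?_, fun x => ?_⟩
  · rw [hadj]; exact hDC' x
  · rw [hadj]; rfl

end CauchyDual

/-! ### Concavity of intertwiners `E ⊗ H → H` -/

section Concave

variable {E : Correspondence.{u, v} M} {H : HilbertRep.{u, w} M}

/-- Concavity of an operator `X : E ⊗ H → H`. -/
def Intertwiner.IsConcave (X : Intertwiner (tensorRep E H) H) : Prop :=
  ∀ x : tensorRep E (tensorRep E H),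
    ‖X.toCLM ((X.ampliate E).toCLM x)‖ ^ 2 + ‖x‖ ^ 2 ≤ 2 * ‖(X.ampliate E).toCLM x‖ ^ 2

/-- If `X` satisfies `‖(I ⊗ X) ζ + κ‖² ≤ 2 (‖ζ‖² + ‖X κ‖²)`, then its Cauchy dual is concave. -/
lemma Intertwiner.IsDual.isConcave {X Y : Intertwiner (tensorRep E H) H} (h : X.IsDual Y)
    (hX : ∀ (ζ : tensorRep E (tensorRep E H)) (κ : tensorRep E H),
      ‖(X.ampliate E).toCLM ζ + κ‖ ^ 2 ≤ 2 * (‖ζ‖ ^ 2 + ‖X.toCLM κ‖ ^ 2)) : Y.IsConcave := by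
  intro x
  -- The inequality is used at `ζ = x` and `κ = Y* Y y`. Then `X κ = Y y`, so its right side is `2A`
  -- with `A = ‖x‖² + ‖Y y‖²`, while the pairing of `(I ⊗ X) x + κ` with `y` is also `A`.
  -- Cauchy–Schwarz gives `A² ≤ 2 A ‖y‖²`.
  set y := (Y.ampliate E).toCLM x with hy
  set κ := Y.adjoint.toCLM (Y.toCLM y) with hκ
  have hXκ : X.toCLM κ = Y.toCLM y := by
    rw [hκ, h.adj_comm]
    congr 1
    refine ext_inner_left ℂ fun z => ?_
    rw [X.adjoint_inner_right, ← Y.adjoint_inner_left, h.left_inv]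
  have h1 : inner ℂ ((X.ampliate E).toCLM x) y = inner ℂ x x := by
    rw [hy, ← Intertwiner.adjoint_inner_left, (h.ampliate E).left_inv]
  have h2 : inner ℂ κ y = inner ℂ (Y.toCLM y) (Y.toCLM y) := by
    rw [hκ, Y.adjoint_inner_left]
  set A := ‖x‖ ^ 2 + ‖Y.toCLM y‖ ^ 2 with hA
  have h3 : (inner ℂ ((X.ampliate E).toCLM x + κ) y).re = A := by
    rw [inner_add_left, h1, h2, Complex.add_re, re_inner_self, re_inner_self]
  have h4 := hX x κ
  rw [hXκ, ← hA] at h4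
  have h5 : A ≤ ‖(X.ampliate E).toCLM x + κ‖ * ‖y‖ := by
    rw [← h3]
    exact (Complex.re_le_norm _).trans (norm_inner_le_norm _ _)
  have hA0 : 0 ≤ A := by positivity
  have h6 : A ^ 2 ≤ 2 * A * ‖y‖ ^ 2 := by
    calc A ^ 2 ≤ (‖(X.ampliate E).toCLM x + κ‖ * ‖y‖) ^ 2 := by gcongr
      _ = ‖(X.ampliate E).toCLM x + κ‖ ^ 2 * ‖y‖ ^ 2 := by ring
      _ ≤ 2 * A * ‖y‖ ^ 2 := by gcongr
  have h7 : A ≤ 2 * ‖y‖ ^ 2 := by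
    rcases hA0.eq_or_lt with h0 | h0
    · rw [← h0]; positivity
    · refine le_of_mul_le_mul_left ?_ h0
      nlinarith
  rw [add_comm]
  exact h7

end Concave

/-! ### The tower `E^{⊗n} ⊗ H` -/

section IteratedTower

variable (E : Correspondence.{u, v} M) (H : HilbertRep.{u, max v w} M)

/-- The space `E^{⊗n} ⊗ H`. -/
noncomputable def towerRep : ℕ → HilbertRep.{u, max v w} M
  | 0 => H
  | n + 1 => tensorRep E (towerRep n)

variable {E H}

/-- The operator `I_{E^{⊗n}} ⊗ X : E^{⊗(n+1)} ⊗ H → E^{⊗n} ⊗ H`. -/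
noncomputable def towerMap (X : Intertwiner (tensorRep E H) H) :
    ∀ n, Intertwiner (towerRep.{u, v, w} E H (n + 1)) (towerRep.{u, v, w} E H n)
  | 0 => X
  | n + 1 => (towerMap X n).ampliate E

/-- The operators `I_{E^{⊗n}} ⊗ X` as a tower. -/
noncomputable def towerOp (X : Intertwiner (tensorRep E H) H) (n : ℕ) :
    towerRep.{u, v, w} E H (n + 1) →L[ℂ] towerRep.{u, v, w} E H n := (towerMap X n).toCLM

lemma isCauchyDual_tower {X Y : Intertwiner (tensorRep E H) H} (h : X.IsDual Y) :
    IsCauchyDual (G := fun n => towerRep.{u, v, w} E H n) (towerOp X) (towerOp Y) := by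
  have key (n) : (towerMap.{u, v, w} X n).IsDual (towerMap.{u, v, w} Y n) := by
    induction n with
    | zero => exact h
    | succ n ih => exact ih.ampliate E
  exact ⟨fun n => (key n).left_inv, fun n => (key n).adj_comm⟩

/-- Passing from one level to the next is one ampliation, which preserves the quadratic inequality
with coefficients `1, 1, 2`. -/
lemma towerConcave {X : Intertwiner (tensorRep E H) H} (h : X.IsConcave) :
    TowerConcave (G := fun n => towerRep.{u, v, w} E H n) (towerOp X) := by
  intro n
  induction n with
  | zero => exact h
  | succ n ih =>
    intro (x : tensorRep E (towerRep.{u, v, w} E H (n + 1 + 1)))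
    have h1 := ampliate_quadratic_le E ((towerMap.{u, v, w} X n).comp (towerMap X (n + 1)))
      (towerMap.{u, v, w} X (n + 1)) (a := 1) (b := 1) (c := 2) (fun x => by
        rw [one_mul, one_mul]; exact ih x) x
    rw [one_mul, one_mul, ampliate_comp_apply] at h1
    exact h1

/-- The bound with constant `n/(n+1)` at level `n` descends to `X`, one tensor factor at a time. All
these bounds for the single operator `X` force expansivity, which then ampliates back to every
level. The descent needs nondegeneracy only on spaces of the form `E ⊗ K`, where it follows from
that of `E`. -/
lemma towerExpansive (hE : E.InnerNondegenerate) {X : Intertwiner (tensorRep E H) H}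
    (h : X.IsConcave) : TowerExpansive (G := fun n => towerRep.{u, v, w} E H n) (towerOp X) := by
  have hdesc (c : ℝ) (n : ℕ) : (∀ x, c * ‖x‖ ^ 2 ≤ ‖(towerMap.{u, v, w} X n).toCLM x‖ ^ 2) →
      ∀ x, c * ‖x‖ ^ 2 ≤ ‖X.toCLM x‖ ^ 2 := by
    induction n with
    | zero => exact id
    | succ n ih =>
      exact fun hn => ih (norm_sq_le_of_ampliate (E := E)
        (fun v hv => hE.eq_zero (K := towerRep.{u, v, w} E H n) hv) (towerMap.{u, v, w} X n) hn)
  have h0 (x : tensorRep E H) : ‖x‖ ^ 2 ≤ ‖X.toCLM x‖ ^ 2 := by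
    by_contra! hlt
    have hn (n : ℕ) : (n : ℝ) * (‖x‖ ^ 2 - ‖X.toCLM x‖ ^ 2) ≤ ‖X.toCLM x‖ ^ 2 := by
      have hpos : (0 : ℝ) < n + 1 := by positivity
      have h1 := hdesc (n / (n + 1)) n (fun y => by
        rw [div_mul_eq_mul_div, div_le_iff₀ hpos, mul_comm _ ((n : ℝ) + 1)]
        exact (towerConcave.{u, v, w} h).almost_expansive n y) x
      rw [div_mul_eq_mul_div, div_le_iff₀ hpos] at h1
      linarith
    obtain ⟨n, hn'⟩ := exists_nat_gt (‖X.toCLM x‖ ^ 2 / (‖x‖ ^ 2 - ‖X.toCLM x‖ ^ 2))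
    rw [div_lt_iff₀ (sub_pos.2 hlt)] at hn'
    linarith [hn n]
  intro n
  induction n with
  | zero => exact h0
  | succ n ih =>
    intro (x : tensorRep E (towerRep.{u, v, w} E H (n + 1)))
    have h1 := ampliate_quadratic_le E (towerMap.{u, v, w} X n) (towerMap.{u, v, w} X n)
      (a := 0) (b := 1) (c := 1) (fun x => by
        rw [zero_mul, zero_add, one_mul, one_mul]; exact ih x) x
    rw [zero_mul, zero_add, one_mul, one_mul] at h1
    exact h1

/-- The operator `E^{⊗n} ⊗ H → H` obtained from `X` by iteration. -/
noncomputable def towerIter (X : Intertwiner (tensorRep E H) H) :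
    ∀ n, Intertwiner (towerRep.{u, v, w} E H n) H
  | 0 => Intertwiner.id H
  | n + 1 => X.comp ((towerIter X n).ampliate E)

/-- Two bracketings of the same product: the recursive definition adds the outermost factor, whereas
the composition along the tower absorbs the innermost factor first. -/
lemma towerIter_succ (X : Intertwiner (tensorRep E H) H) (n : ℕ)
    (x : towerRep.{u, v, w} E H (n + 1)) :
    (towerIter.{u, v, w} X (n + 1)).toCLM x
      = (towerIter.{u, v, w} X n).toCLM ((towerMap.{u, v, w} X n).toCLM x) := by
  induction n with
  | zero =>
    change X.toCLM (((Intertwiner.id H).ampliate E).toCLM x) = X.toCLM x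
    rw [ampliate_id]; rfl
  | succ n ih =>
    change tensorRep E (towerRep.{u, v, w} E H (n + 1)) at x
    change X.toCLM (((towerIter.{u, v, w} X (n + 1)).ampliate E).toCLM x) =
      X.toCLM (((towerIter.{u, v, w} X n).ampliate E).toCLM
        (((towerMap.{u, v, w} X n).ampliate E).toCLM x))
    rw [← ampliate_comp_apply]
    exact congrArg _ (ampliate_congr E (Y := (towerIter.{u, v, w} X n).comp
      (towerMap.{u, v, w} X n)) ih x)

lemma towerComp_towerOp (X : Intertwiner (tensorRep E H) H) (n : ℕ)
    (x : towerRep.{u, v, w} E H n) :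
    towerComp (G := fun n => towerRep.{u, v, w} E H n) (towerOp X) n x
      = (towerIter.{u, v, w} X n).toCLM x := by
  induction n with
  | zero => rfl
  | succ n ih => exact (ih _).trans (towerIter_succ X n x).symm

/-- The elementary tensors `ξ₁ ⊗ ⋯ ⊗ ξₙ ⊗ h`, `h ∈ W`. -/
def elemTensors (E : Correspondence.{u, v} M) {H : HilbertRep.{u, max v w} M} (W : Set H) :
    ∀ n, Set (towerRep.{u, v, w} E H n)
  | 0 => W
  | n + 1 => {y | ∃ ξ : E, ∃ x ∈ elemTensors E W n, y = tmk ξ x}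

lemma mem_ker_of_mem_elemTensors (X : Intertwiner (tensorRep E H) H) (n : ℕ)
    {t : towerRep.{u, v, w} E H n} (ht : t ∈ elemTensors E {h | X.adjoint.toCLM h = 0} n) :
    (towerMap X n).adjoint.toCLM t = 0 := by
  induction n with
  | zero => exact ht
  | succ n ih =>
    obtain ⟨ξ, x, hx, rfl⟩ := ht
    refine (ampliate_adjoint_apply E (towerMap.{u, v, w} X n) _).symm.trans ?_
    rw [ampliate_tmk, ih hx]
    exact map_zero (tmkRight ξ _)

/-- The kernel of `(I_E ⊗ Y)*` is spanned by the tensors `ξ ⊗ h` with `Y* h = 0`. -/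
lemma inner_eq_zero_of_ker_ampliate {K : HilbertRep.{u, w} M} {L : HilbertRep.{u, w'} M}
    (Y : Intertwiner K L) {z : tensorRep E L}
    (hz : ∀ (ξ : E) (h : L), Y.adjoint.toCLM h = 0 → inner ℂ (tmk ξ h) z = 0)
    {v : tensorRep E L} (hv : (Y.ampliate E).adjoint.toCLM v = 0) : inner ℂ v z = 0 := by
  set S : Submodule ℂ (tensorRep E L) := (Submodule.span ℂ
    {y | ∃ (ξ : E) (h : L), Y.adjoint.toCLM h = 0 ∧ y = tmk ξ h}).topologicalClosure with hS
  have hSc : IsClosed (S : Set (tensorRep E L)) := Submodule.isClosed_topologicalClosure _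
  have : CompleteSpace S := hSc.completeSpace_coe
  have hmem (ξ : E) (h : L) (hh : Y.adjoint.toCLM h = 0) : tmk ξ h ∈ S :=
    Submodule.le_topologicalClosure _ (Submodule.subset_span ⟨ξ, h, hh, rfl⟩)
  have hker : S ≤ LinearMap.ker (Y.ampliate E).adjoint.toCLM.toLinearMap := by
    refine Submodule.topologicalClosure_minimal _ (Submodule.span_le.2 ?_)
      (ContinuousLinearMap.isClosed_ker _)
    rintro _ ⟨ξ, h, hh, rfl⟩
    refine (ampliate_adjoint_apply E Y _).symm.trans ?_
    rw [ampliate_tmk, hh, ← tmkRight_apply, map_zero]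
  have hvS : v ∈ S := by
    -- The vector `d` is in the kernel and orthogonal to `S`. It is therefore orthogonal to `ξ ⊗ h`
    -- both for `h` in the range of `Y`, where `ξ ⊗ Y x = (I ⊗ Y)(ξ ⊗ x)`, and for `h` in `ker Y*`,
    -- where `ξ ⊗ h ∈ S`. These two kinds of `h` fill `L` up to closure.
    set d := v - S.starProjection v with hd
    have hdk : (Y.ampliate E).adjoint.toCLM d = 0 := by
      rw [hd, map_sub, hv, zero_sub, neg_eq_zero]
      exact hker (S.starProjection_apply_mem v)
    have hdo : d ∈ Sᗮ := S.sub_starProjection_mem_orthogonal v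
    have hd0 : d = 0 := by
      refine tmk_inner_ext fun ξ h => ?_
      rw [inner_zero_right]
      set B : Submodule ℂ L := LinearMap.ker ((innerSL ℂ d) ∘L tmkRight ξ L).toLinearMap with hB
      have hBc : IsClosed (B : Set L) := ContinuousLinearMap.isClosed_ker _
      have hran : (LinearMap.range Y.toCLM.toLinearMap).topologicalClosure ≤ B := by
        refine Submodule.topologicalClosure_minimal _ ?_ hBc
        rintro _ ⟨x, rfl⟩
        change inner ℂ d (tmk ξ (Y.toCLM x)) = 0
        rw [← ampliate_tmk, ← Intertwiner.adjoint_inner_left, hdk, inner_zero_left]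
      have horth : (LinearMap.range Y.toCLM.toLinearMap)ᗮ ≤ B := by
        intro h hh
        refine inner_eq_zero_symm.1 (Submodule.inner_right_of_mem_orthogonal (hmem ξ h ?_) hdo)
        refine ext_inner_left ℂ fun x => ?_
        rw [Y.adjoint_inner_right, inner_zero_right]
        exact Submodule.inner_right_of_mem_orthogonal (LinearMap.mem_range_self _ x) hh
      have htop : (⊤ : Submodule ℂ L) ≤ B := by
        rw [← Submodule.sup_orthogonal_of_hasOrthogonalProjection
          (K := (LinearMap.range Y.toCLM.toLinearMap).topologicalClosure)]
        refine sup_le hran ?_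
        rwa [Submodule.orthogonal_closure]
      exact inner_eq_zero_symm.1 (htop (Submodule.mem_top (x := h)))
    rw [sub_eq_zero.1 (hd.symm.trans hd0)]
    exact S.starProjection_apply_mem v
  have hle : S ≤ LinearMap.ker (innerSL ℂ z).toLinearMap := by
    refine Submodule.topologicalClosure_minimal _ (Submodule.span_le.2 ?_)
      (ContinuousLinearMap.isClosed_ker _)
    rintro _ ⟨ξ, h, hh, rfl⟩
    exact inner_eq_zero_symm.1 (hz ξ h hh)
  exact inner_eq_zero_symm.1 (hle hvS)

/-- The kernel at level `n` is generated by elementary tensors ending in `ker X*`. The induction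
removes the outer factor `ξ` by applying the adjoint of the creation operator of `ξ` to `z`. -/
lemma inner_eq_zero_of_mem_ker (X : Intertwiner (tensorRep E H) H) (n : ℕ)
    {z : towerRep.{u, v, w} E H n}
    (hz : ∀ t ∈ elemTensors.{u, v, w} E {h | X.adjoint.toCLM h = 0} n, inner ℂ t z = 0)
    {y : towerRep.{u, v, w} E H n} (hy : (towerMap X n).adjoint.toCLM y = 0) :
    inner ℂ y z = 0 := by
  induction n with
  | zero => exact hz y hy
  | succ n ih =>
    change tensorRep E (towerRep.{u, v, w} E H n) at z
    refine inner_eq_zero_of_ker_ampliate (towerMap.{u, v, w} X n) (fun ξ h hh => ?_) hy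
    have h1 := ih (z := ((tmkRight ξ (towerRep.{u, v, w} E H n))†) z) (fun t ht => by
      rw [ContinuousLinearMap.adjoint_inner_right]
      exact hz _ ⟨ξ, t, ht, rfl⟩) hh
    rwa [ContinuousLinearMap.adjoint_inner_right] at h1

/-- This brings the kernels of the ampliated operators back to the wandering subspace `ker X*` of
`H`. -/
lemma orthoKernels_towerOp_iff (X : Intertwiner (tensorRep E H) H) (z : H) :
    OrthoKernels (G := fun n => towerRep.{u, v, w} E H n) (towerOp X) z ↔
      ∀ n, ∀ t ∈ elemTensors.{u, v, w} E {h | X.adjoint.toCLM h = 0} n,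
        inner ℂ ((towerIter X n).toCLM t) z = 0 := by
  constructor
  · intro h n t ht
    have := h n t (mem_ker_of_mem_elemTensors X n ht)
    rwa [towerComp_towerOp] at this
  · intro h n y hy
    rw [towerComp_towerOp]
    refine (Intertwiner.adjoint_inner_right _ _ _).symm.trans ?_
    refine inner_eq_zero_of_mem_ker X n (fun t ht => ?_) hy
    rw [Intertwiner.adjoint_inner_right]
    exact h n t ht

/-- The Wold decomposition for an intertwiner `X : E ⊗ H → H`. -/
theorem inAllRanges_towerOp_iff (hE : E.InnerNondegenerate) {X : Intertwiner (tensorRep E H) H}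
    (hX : X.IsConcave ∨ ∀ (ζ : tensorRep E (tensorRep E H)) (κ : tensorRep E H),
      ‖(X.ampliate E).toCLM ζ + κ‖ ^ 2 ≤ 2 * (‖ζ‖ ^ 2 + ‖X.toCLM κ‖ ^ 2)) (z : H) :
    InAllRanges (G := fun n => towerRep.{u, v, w} E H n) (towerOp X) z ↔
      OrthoKernels (G := fun n => towerRep.{u, v, w} E H n) (towerOp X) z := by
  rcases hX with hX | hX
  · have he := towerExpansive.{u, v, w} hE hX
    obtain ⟨Y, hY⟩ := X.exists_isDual one_pos fun x => by rw [one_mul]; exact he 0 x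
    exact (isCauchyDual_tower.{u, v, w} hY).inAllRanges_iff (towerConcave.{u, v, w} hX) he z
  -- Taking `ζ = 0` in the inequality gives `‖κ‖² ≤ 2 ‖X κ‖²`, whence the constant `1/2`. Here the
  -- dual `Y`, not `X`, is the concave operator.
  · obtain ⟨Y, hY⟩ := X.exists_isDual (c := 1 / 2) (by norm_num) fun x => by
      have := hX 0 x
      rw [map_zero, zero_add, norm_zero] at this
      linarith
    have hYc := hY.isConcave hX
    exact (isCauchyDual_tower.{u, v, w} hY).inAllRanges_iff' (towerConcave.{u, v, w} hYc)
      (towerExpansive.{u, v, w} hE hYc) z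

end IteratedTower

end SingleRep

/-! ### Lifting a representation to a larger universe -/

section Lift

/-- A tower is a family in one universe, but `E ⊗ H` lives in a larger one than `H`; replacing `H`
by a unitarily equivalent lift makes level `0` fit. -/
noncomputable instance uliftInnerProductSpace {V : Type w} [NormedAddCommGroup V]
    [InnerProductSpace ℂ V] : InnerProductSpace ℂ (ULift.{v} V) where
  inner x y := inner ℂ x.down y.down
  norm_sq_eq_re_inner x := InnerProductSpace.norm_sq_eq_re_inner x.down
  conj_inner_symm x y := inner_conj_symm x.down y.down
  add_left x y z := inner_add_left x.down y.down z.down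
  smul_left x y c := inner_smul_left x.down y.down c

variable {M : Type u} [NonUnitalCStarAlgebra M] [PartialOrder M] [StarOrderedRing M]

/-- The lift of a representation to a larger universe. -/
noncomputable def HilbertRep.lift (H : HilbertRep.{u, w} M) : HilbertRep.{u, max v w} M where
  carrier := ULift.{v} H
  instCompleteSpace :=
    (LinearIsometryEquiv.ulift ℂ H).toIsometryEquiv.completeSpace
  π :=
    { toFun := fun a => (LinearIsometryEquiv.ulift ℂ H).symm.toContinuousLinearEquiv.toContinuousLinearMap ∘L
        H.π a ∘L (LinearIsometryEquiv.ulift ℂ H).toContinuousLinearEquiv.toContinuousLinearMap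
      map_smul' := fun c a => by ext x; simp
      map_zero' := by ext x; simp
      map_add' := fun a b => by ext x; simp
      map_mul' := fun a b => by ext x; simp
      map_star' := fun a => by
        refine ContinuousLinearMap.ext fun x => ext_inner_left ℂ fun y => ?_
        rw [ContinuousLinearMap.star_eq_adjoint, ContinuousLinearMap.adjoint_inner_right]
        exact (H.inner_π a y.down x.down).symm }

variable (H : HilbertRep.{u, w} M)

/-- The canonical unitary from a representation to its lift. -/
noncomputable def liftUp : Intertwiner H (HilbertRep.lift.{u, v, w} H) where
  toCLM := (LinearIsometryEquiv.ulift ℂ H).symm.toContinuousLinearEquiv.toContinuousLinearMap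
  comm _ _ := rfl

/-- The canonical unitary from the lift of a representation. -/
noncomputable def liftDown : Intertwiner (HilbertRep.lift.{u, v, w} H) H where
  toCLM := (LinearIsometryEquiv.ulift ℂ H).toContinuousLinearEquiv.toContinuousLinearMap
  comm _ _ := rfl

end Lift

/-! ### Transport of intertwiners along unitaries -/

section Unitary

variable {M : Type u} [NonUnitalCStarAlgebra M] [PartialOrder M] [StarOrderedRing M]
variable {K : HilbertRep.{u, w} M} {L : HilbertRep.{u, w'} M}

/-- `U` is a unitary intertwiner with inverse `V`. -/
structure Intertwiner.IsUnitary (U : Intertwiner K L) (V : Intertwiner L K) : Prop where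
  norm_eq : ∀ x, ‖U.toCLM x‖ = ‖x‖
  left_inv : ∀ x, V.toCLM (U.toCLM x) = x
  right_inv : ∀ x, U.toCLM (V.toCLM x) = x

lemma isUnitary_lift (H : HilbertRep.{u, w} M) :
    (liftUp.{u, v, w} H).IsUnitary (liftDown.{u, v, w} H) where
  norm_eq _ := rfl
  left_inv _ := rfl
  right_inv _ := rfl

namespace Intertwiner.IsUnitary

variable {U : Intertwiner K L} {V : Intertwiner L K}

lemma ampliate (h : U.IsUnitary V) (E : Correspondence.{u, v} M) :
    (U.ampliate E).IsUnitary (V.ampliate E) where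
  norm_eq x := by
    have h1 := ampliate_quadratic_le E U U (a := 0) (b := 1) (c := 1)
      (fun x => by simp [h.norm_eq]) x
    have h2 := ampliate_quadratic_le E U (Intertwiner.id K) (a := 1) (b := 0) (c := 1)
      (fun x => by simp [h.norm_eq, Intertwiner.id]) x
    rw [zero_mul, zero_add, one_mul, one_mul] at h1
    rw [ampliate_id, zero_mul, add_zero, one_mul, one_mul] at h2
    exact le_antisymm (le_of_sq_le_sq h2 (norm_nonneg _)) (le_of_sq_le_sq h1 (norm_nonneg _))
  left_inv x := by
    rw [← ampliate_comp_apply, ampliate_congr E (Y := Intertwiner.id K) h.left_inv, ampliate_id]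
    rfl
  right_inv x := by
    rw [← ampliate_comp_apply, ampliate_congr E (Y := Intertwiner.id L) h.right_inv, ampliate_id]
    rfl

lemma inner_map (h : U.IsUnitary V) (x y : K) :
    inner ℂ (U.toCLM x) (U.toCLM y) = inner ℂ x y :=
  LinearIsometry.inner_map_map ⟨U.toCLM.toLinearMap, h.norm_eq⟩ x y

end Intertwiner.IsUnitary

variable {E : Correspondence.{u, v} M}

/-- The operator `U X (I_E ⊗ U)⁻¹`. -/
noncomputable def Intertwiner.conj (U : Intertwiner K L) (V : Intertwiner L K)
    (X : Intertwiner (tensorRep E K) K) : Intertwiner (tensorRep E L) L :=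
  U.comp (X.comp (V.ampliate E))

variable {U : Intertwiner K L} {V : Intertwiner L K} (X : Intertwiner (tensorRep E K) K)

lemma conj_apply (h : U.IsUnitary V) (x : tensorRep E K) :
    (Intertwiner.conj U V X).toCLM ((U.ampliate E).toCLM x) = U.toCLM (X.toCLM x) := by
  change U.toCLM (X.toCLM ((V.ampliate E).toCLM ((U.ampliate E).toCLM x))) = _
  rw [(h.ampliate E).left_inv]

lemma ampliate_conj_apply (h : U.IsUnitary V) (x : tensorRep E (tensorRep E K)) :
    ((Intertwiner.conj U V X).ampliate E).toCLM (((U.ampliate E).ampliate E).toCLM x)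
      = (U.ampliate E).toCLM ((X.ampliate E).toCLM x) := by
  rw [← ampliate_comp_apply, ← ampliate_comp_apply]
  exact ampliate_congr E (conj_apply X h) x

variable {X}

lemma conj_isConcave (h : U.IsUnitary V) (hX : X.IsConcave) : (Intertwiner.conj U V X).IsConcave := by
  intro x
  obtain ⟨y, rfl⟩ : ∃ y, ((U.ampliate E).ampliate E).toCLM y = x :=
    ⟨_, ((h.ampliate E).ampliate E).right_inv x⟩
  rw [ampliate_conj_apply X h, conj_apply X h, h.norm_eq, (h.ampliate E).norm_eq,
    ((h.ampliate E).ampliate E).norm_eq]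
  exact hX y

lemma conj_shimorin (h : U.IsUnitary V)
    (hX : ∀ (ζ : tensorRep E (tensorRep E K)) (κ : tensorRep E K),
      ‖(X.ampliate E).toCLM ζ + κ‖ ^ 2 ≤ 2 * (‖ζ‖ ^ 2 + ‖X.toCLM κ‖ ^ 2))
    (ζ : tensorRep E (tensorRep E L)) (κ : tensorRep E L) :
    ‖((Intertwiner.conj U V X).ampliate E).toCLM ζ + κ‖ ^ 2
      ≤ 2 * (‖ζ‖ ^ 2 + ‖(Intertwiner.conj U V X).toCLM κ‖ ^ 2) := by
  obtain ⟨y, rfl⟩ : ∃ y, ((U.ampliate E).ampliate E).toCLM y = ζ :=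
    ⟨_, ((h.ampliate E).ampliate E).right_inv ζ⟩
  obtain ⟨z, rfl⟩ : ∃ z, (U.ampliate E).toCLM z = κ := ⟨_, (h.ampliate E).right_inv κ⟩
  rw [ampliate_conj_apply X h, conj_apply X h, h.norm_eq, ((h.ampliate E).ampliate E).norm_eq,
    ← map_add, (h.ampliate E).norm_eq]
  exact hX y z

lemma conj_adjoint_eq_zero_iff (h : U.IsUnitary V) (x : K) :
    (Intertwiner.conj U V X).adjoint.toCLM (U.toCLM x) = 0 ↔ X.adjoint.toCLM x = 0 := by
  have key (y : tensorRep E K) :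
      inner ℂ ((U.ampliate E).toCLM y) ((Intertwiner.conj U V X).adjoint.toCLM (U.toCLM x))
        = inner ℂ y (X.adjoint.toCLM x) := by
    rw [Intertwiner.adjoint_inner_right, conj_apply X h, h.inner_map, X.adjoint_inner_right]
  constructor
  · intro h0
    refine ext_inner_left ℂ fun y => ?_
    rw [← key, h0, inner_zero_right, inner_zero_right]
  · intro h0
    refine ext_inner_left ℂ fun y => ?_
    rw [← (h.ampliate E).right_inv y, key, h0, inner_zero_right, inner_zero_right]

end Unitary

/-! ### Analyticity in terms of the orbit of the wandering subspace -/

section Analytic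

variable {M : Type u} [NonUnitalCStarAlgebra M] [PartialOrder M] [StarOrderedRing M]
variable {E : Correspondence.{u, v} M} {H : HilbertRep.{u, w} M} (R : CBCovRep E H)

lemma tilde_tmk (ξ : E) (h : H) : R.tilde.toCLM (tmk ξ h) = R.T ξ h := R.tilde_htmul ξ h

/-- The vectors `T(ξ₁) ⋯ T(ξₙ) h` with `h ∈ W`. -/
def CBCovRep.orbit (W : Set H) : ℕ → Set H
  | 0 => W
  | n + 1 => {y | ∃ ξ : E, ∃ x ∈ CBCovRep.orbit W n, y = R.T ξ x}

/-- The operator `T̃` on the lift of `H`. -/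
noncomputable def CBCovRep.liftTilde :
    Intertwiner (tensorRep E (HilbertRep.lift.{u, v, w} H)) (HilbertRep.lift.{u, v, w} H) :=
  Intertwiner.conj (liftUp H) (liftDown H) R.tilde

variable (E H) in
/-- The canonical unitary from `E^{⊗(n+1)} ⊗ H` to the corresponding space of the lift. -/
noncomputable def iterSpaceUp : ∀ n, Intertwiner (CBCovRep.iterSpace E H n)
    (towerRep.{u, v, w} E (HilbertRep.lift.{u, v, w} H) (n + 1))
  | 0 => (liftUp.{u, v, w} H).ampliate E
  | n + 1 => (iterSpaceUp n).ampliate E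

lemma iterSpaceUp_surjective (n : ℕ) : Function.Surjective (iterSpaceUp E H n).toCLM := by
  suffices h : ∃ V, (iterSpaceUp E H n).IsUnitary V from fun x => ⟨_, h.choose_spec.right_inv x⟩
  induction n with
  | zero => exact ⟨_, (isUnitary_lift H).ampliate E⟩
  | succ n ih =>
    obtain ⟨V, hV⟩ := ih
    exact ⟨_, hV.ampliate E⟩

/-- The indices differ by one: `R.iter n` has `n + 1` tensor factors, whereas the tower begins with
no factor at all. -/
lemma towerIter_liftTilde (n : ℕ) (y : CBCovRep.iterSpace E H n) :
    (towerIter.{u, v, w} R.liftTilde (n + 1)).toCLM ((iterSpaceUp E H n).toCLM y)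
      = (liftUp.{u, v, w} H).toCLM ((R.iter n).toCLM y) := by
  induction n with
  | zero =>
    change R.liftTilde.toCLM (((Intertwiner.id _).ampliate E).toCLM
      (((liftUp.{u, v, w} H).ampliate E).toCLM y)) = _
    rw [ampliate_id]
    exact conj_apply R.tilde (isUnitary_lift H) y
  | succ n ih =>
    change tensorRep E (CBCovRep.iterSpace E H n) at y
    change R.liftTilde.toCLM (((towerIter.{u, v, w} R.liftTilde (n + 1)).ampliate E).toCLM
      (((iterSpaceUp E H n).ampliate E).toCLM y)) = _
    rw [← ampliate_comp_apply]
    have h1 := ampliate_congr E (X := (towerIter.{u, v, w} R.liftTilde (n + 1)).comp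
      (iterSpaceUp E H n)) (Y := (liftUp.{u, v, w} H).comp (R.iter n)) ih y
    rw [h1, ampliate_comp_apply]
    exact conj_apply R.tilde (isUnitary_lift H) _

/-- The additional level `0` of the tower imposes no condition, since the empty composition is the
identity. -/
lemma isAnalytic_iff_inAllRanges : R.IsAnalytic ↔ ∀ z : H,
    InAllRanges (G := fun n => towerRep.{u, v, w} E (HilbertRep.lift.{u, v, w} H) n)
      (towerOp R.liftTilde) ((liftUp.{u, v, w} H).toCLM z) → z = 0 := by
  have key (z : H) : InAllRanges
      (G := fun n => towerRep.{u, v, w} E (HilbertRep.lift.{u, v, w} H) n)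
      (towerOp R.liftTilde) ((liftUp.{u, v, w} H).toCLM z) ↔
        z ∈ ⋂ n : ℕ, Set.range (R.iter n).toCLM := by
    rw [Set.mem_iInter]
    constructor
    · intro h n
      obtain ⟨x, hx⟩ := h (n + 1)
      obtain ⟨y, rfl⟩ := iterSpaceUp_surjective n x
      rw [towerComp_towerOp, towerIter_liftTilde] at hx
      refine ⟨y, ?_⟩
      have := congrArg (liftDown.{u, v, w} H).toCLM hx
      rwa [(isUnitary_lift H).left_inv, (isUnitary_lift H).left_inv] at this
    · intro h n
      cases n with
      | zero => exact ⟨_, rfl⟩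
      | succ n =>
        obtain ⟨y, rfl⟩ := h n
        exact ⟨(iterSpaceUp E H n).toCLM y,
          (towerComp_towerOp _ _ _).trans (towerIter_liftTilde R n y)⟩
  simp only [key, CBCovRep.IsAnalytic]
  constructor
  · intro h z hz
    rwa [h] at hz
  · intro h
    refine Set.eq_singleton_iff_unique_mem.2 ⟨?_, h⟩
    exact Set.mem_iInter.2 fun n => ⟨0, map_zero _⟩

lemma mem_range_orthogonal_iff (z : H) :
    z ∈ (LinearMap.range R.tilde.toCLM.toLinearMap)ᗮ ↔ R.tilde.adjoint.toCLM z = 0 := by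
  rw [ContinuousLinearMap.orthogonal_range]; rfl

/-- This translates the generators found in the lifted tower into vectors `T(ξ₁) ⋯ T(ξ_n) w` of `H`.
-/
lemma towerIter_image_elemTensors (n : ℕ) :
    (towerIter.{u, v, w} R.liftTilde n).toCLM ''
        elemTensors.{u, v, w} E {h | R.liftTilde.adjoint.toCLM h = 0} n
      = (liftUp.{u, v, w} H).toCLM ''
        R.orbit ((LinearMap.range R.tilde.toCLM.toLinearMap)ᗮ : Submodule ℂ H) n := by
  induction n with
  | zero =>
    ext x
    change x ∈ id '' {h : HilbertRep.lift.{u, v, w} H | R.liftTilde.adjoint.toCLM h = 0} ↔ _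
    rw [Set.image_id]
    constructor
    · intro hx
      refine ⟨(liftDown.{u, v, w} H).toCLM x, ?_, (isUnitary_lift H).right_inv x⟩
      exact (mem_range_orthogonal_iff R _).2
        ((conj_adjoint_eq_zero_iff (isUnitary_lift.{u, v, w} H) _).1 hx)
    · rintro ⟨y, hy, rfl⟩
      exact (conj_adjoint_eq_zero_iff (isUnitary_lift.{u, v, w} H) y).2
        ((mem_range_orthogonal_iff R y).1 hy)
  | succ n ih =>
    have h1 (ξ : E) (x : towerRep.{u, v, w} E (HilbertRep.lift.{u, v, w} H) n) :
        (towerIter.{u, v, w} R.liftTilde (n + 1)).toCLM (tmk ξ x)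
          = R.liftTilde.toCLM (tmk ξ ((towerIter.{u, v, w} R.liftTilde n).toCLM x)) := by
      change R.liftTilde.toCLM (((towerIter.{u, v, w} R.liftTilde n).ampliate E).toCLM
        (tmk ξ x)) = _
      rw [ampliate_tmk]
    have h2 (ξ : E) (y : H) : R.liftTilde.toCLM (tmk ξ ((liftUp.{u, v, w} H).toCLM y))
        = (liftUp.{u, v, w} H).toCLM (R.T ξ y) := by
      rw [← ampliate_tmk, ← tilde_tmk]
      exact conj_apply R.tilde (isUnitary_lift H) _
    apply Set.Subset.antisymm
    · rintro _ ⟨_, ⟨ξ, x, hx, rfl⟩, rfl⟩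
      obtain ⟨y, hy, hyx⟩ := ih.subset ⟨x, hx, rfl⟩
      exact ⟨R.T ξ y, ⟨ξ, y, hy, rfl⟩, by rw [h1, ← h2, hyx]⟩
    · rintro _ ⟨_, ⟨ξ, y, hy, rfl⟩, rfl⟩
      obtain ⟨x, hx, hxy⟩ := ih.superset ⟨y, hy, rfl⟩
      exact ⟨tmk ξ x, ⟨ξ, x, hx, rfl⟩, by rw [h1, hxy, h2]⟩

/-- A concave representation (or one satisfying the dual inequality) is analytic if and only if its
wandering subspace is generating. -/
theorem isAnalytic_iff_orbit (hE : E.InnerNondegenerate)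
    (hR : R.IsConcave ∨ R.ShimorinInequality) : R.IsAnalytic ↔
      ∀ z : H, (∀ n, ∀ w ∈ R.orbit ((LinearMap.range R.tilde.toCLM.toLinearMap)ᗮ : Submodule ℂ H) n,
        inner ℂ w z = 0) → z = 0 := by
  rw [isAnalytic_iff_inAllRanges]
  have hconj := hR.imp (fun h => conj_isConcave (X := R.tilde) (isUnitary_lift.{u, v, w} H) h)
    (fun h => conj_shimorin (X := R.tilde) (isUnitary_lift.{u, v, w} H) h)
  -- The Wold decomposition is an equivalence for each vector, so the two vanishing statements can
  -- be compared one `z` at a time.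
  refine forall_congr' fun z => imp_congr_left ?_
  refine (inAllRanges_towerOp_iff hE hconj _).trans ((orthoKernels_towerOp_iff _ _).trans ?_)
  refine forall_congr' fun n => ?_
  have h1 := towerIter_image_elemTensors R n
  constructor
  · intro h w hw
    obtain ⟨t, ht, htw⟩ := h1.superset ⟨w, hw, rfl⟩
    rw [← (isUnitary_lift.{u, v, w} H).inner_map, ← htw]
    exact h t ht
  · intro h t ht
    obtain ⟨w, hw, htw⟩ := h1.subset ⟨t, ht, rfl⟩
    refine (congrArg (fun x => inner ℂ x ((liftUp.{u, v, w} H).toCLM z)) htw.symm).trans ?_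
    exact ((isUnitary_lift.{u, v, w} H).inner_map w z).trans (h w hw)

end Analytic

section Multi

variable {M : Type u} [NonUnitalCStarAlgebra M] [PartialOrder M] [StarOrderedRing M]

/-! ### The flip unitaries -/

lemma CorrIso.adjoint_ampliate {E : Correspondence.{u, v} M} {F : Correspondence.{u, v'} M}
    (t : CorrIso E F) (K : HilbertRep.{u, w} M) : (t.ampliate K†) = t.symm.ampliate K := by
  refine htensor_ext fun η g => inner_ext fun ξ h => ?_
  rw [ContinuousLinearMap.adjoint_inner_right, CorrIso.ampliate_htmul, CorrIso.ampliate_htmul,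
    inner_htmul, inner_htmul]
  congr 4
  rw [← t.rip_map]
  exact congrArg _ (t.toEquiv.apply_symm_apply η).symm

variable {k : ℕ} {P : ProductSystem.{u, v} M k}

/-- The associators are unitary and `t_ij` is the inverse of `t_ji`, so the two flips are adjoint to
each other. -/
lemma ProductSystem.inner_flip (i j : Fin k) (K : HilbertRep.{u, w} M)
    (x : tensorRep (P.E i) (tensorRep (P.E j) K)) (y : tensorRep (P.E j) (tensorRep (P.E i) K)) :
    inner ℂ (P.flip i j K x) y = inner ℂ x (P.flip j i K y) := by
  have h1 := LinearIsometryEquiv.inner_map_eq_flip (assoc (P.E j) (P.E i) K)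
    ((P.t i j).ampliate K ((assoc (P.E i) (P.E j) K).symm x)) y
  have h2 := LinearIsometryEquiv.inner_map_eq_flip (assoc (P.E i) (P.E j) K).symm x
    ((P.t j i).ampliate K ((assoc (P.E j) (P.E i) K).symm y))
  refine h1.trans (Eq.trans ?_ h2)
  rw [← ContinuousLinearMap.adjoint_inner_right, CorrIso.adjoint_ampliate, ← P.t_symm j i]

namespace ProductSystem.Rep

variable (R : Rep.{u, v, w} P)

lemma tilde_tmk (i : Fin k) (ξ : P.E i) (h : R.H) :
    (R.tilde i).toCLM (tmk ξ h) = (R.rep i).T ξ h :=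
  CovRep.tilde_tmk (R.rep i) ξ h

lemma tilde_comm (i j : Fin k) (x : tensorRep (P.E i) (tensorRep (P.E j) R.H)) :
    (R.tilde i).toCLM (((R.tilde j).ampliate (P.E i)).toCLM x)
      = (R.tilde j).toCLM (((R.tilde i).ampliate (P.E j)).toCLM (P.flip i j R.H x)) :=
  DFunLike.congr_fun (R.comm i j) x

/-! ### Double commutation of a pair -/

/-- Double commutation for a pair of indices. -/
def CommutesDoubly (i j : Fin k) : Prop := ∀ x : tensorRep (P.E i) R.H,
  (R.tilde j).adjoint.toCLM ((R.tilde i).toCLM x) = ((R.tilde i).ampliate (P.E j)).toCLM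
    (P.flip i j R.H (((R.tilde j).adjoint.ampliate (P.E i)).toCLM x))

lemma isDoublyCommuting_iff : R.IsDoublyCommuting ↔ ∀ i j, i ≠ j → R.CommutesDoubly i j :=
  forall_congr' fun _ => forall_congr' fun _ => imp_congr_right fun _ => DFunLike.ext_iff

variable {R} in
-- The relation for `(j, i)` is the adjoint of the one for `(i, j)`. This is why (b) is only needed
-- for `i < j`.
lemma CommutesDoubly.symm {i j : Fin k} (h : R.CommutesDoubly i j) : R.CommutesDoubly j i := by
  intro x
  refine ext_inner_left ℂ fun y => ?_
  rw [Intertwiner.adjoint_inner_right, ← Intertwiner.adjoint_inner_left, h, ampliate_adjoint,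
    ampliate_adjoint, ← ContinuousLinearMap.adjoint_inner_right, ProductSystem.inner_flip,
    ContinuousLinearMap.adjoint_inner_left]

/-- Apply `T̃⁽ʲ⁾*` to the commutation relation and use double commutation on vectors of the form `(I
⊗ T̃⁽ʲ⁾) x`. -/
lemma intertwines_of_commutesDoubly {i j : Fin k} (h : R.CommutesDoubly i j) :
    R.Intertwines i j := by
  refine ContinuousLinearMap.ext fun x => ?_
  change ((R.tilde i).ampliate (P.E j)).toCLM (P.flip i j R.H
      ((((R.tilde j).adjoint.comp (R.tilde j)).ampliate (P.E i)).toCLM x)) =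
    (R.tilde j).adjoint.toCLM ((R.tilde j).toCLM
      (((R.tilde i).ampliate (P.E j)).toCLM (P.flip i j R.H x)))
  rw [← tilde_comm, h, ampliate_comp_apply]

/-! ### Words -/

lemma words_mono (l : List (Fin k)) {K K' : Set R.H} (h : K ⊆ K') : R.words l K ⊆ R.words l K' := by
  induction l with
  | nil => exact h
  | cons i l ih =>
    rintro _ ⟨ξ, x, hx, rfl⟩
    exact ⟨ξ, x, ih hx, rfl⟩

lemma words_append (l l' : List (Fin k)) (K : Set R.H) :
    R.words (l ++ l') K = R.words l (R.words l' K) := by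
  induction l with
  | nil => rfl
  | cons i l ih =>
    change {y | ∃ ξ : P.E i, ∃ x ∈ R.words (l ++ l') K, y = (R.rep i).T ξ x} = _
    rw [ih]; rfl

lemma words_replicate (i : Fin k) (n : ℕ) (K : Set R.H) :
    R.words (List.replicate n i) K = (R.rep i).orbit K n := by
  induction n with
  | zero => rfl
  | succ n ih =>
    change {y | ∃ ξ : P.E i, ∃ x ∈ R.words (List.replicate n i) K, y = (R.rep i).T ξ x} = _
    rw [ih]; rfl

lemma exists_of_mem_words (l : List (Fin k)) {K : Set R.H} {y : R.H} (h : y ∈ R.words l K) :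
    ∃ x ∈ K, y ∈ R.words l {x} := by
  induction l generalizing y with
  | nil => exact ⟨y, h, rfl⟩
  | cons i l ih =>
    obtain ⟨ξ, z, hz, rfl⟩ := h
    obtain ⟨x, hx, hzx⟩ := ih hz
    exact ⟨x, hx, ξ, z, hzx, rfl⟩

/-- Each letter acts by bounded linear operators, which pass through closed spans. -/
lemma words_topologicalClosure_span (l : List (Fin k)) (S : Set R.H) :
    R.words l ((Submodule.span ℂ S).topologicalClosure : Submodule ℂ R.H) ⊆
      ((Submodule.span ℂ (R.words l S)).topologicalClosure : Submodule ℂ R.H) := by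
  induction l with
  | nil => exact subset_rfl
  | cons i l ih =>
    rintro _ ⟨ξ, x, hx, rfl⟩
    have hle : (Submodule.span ℂ (R.words l S)).topologicalClosure ≤
        (Submodule.span ℂ (R.words (i :: l) S)).topologicalClosure.comap
          ((R.rep i).T ξ).toLinearMap := by
      refine Submodule.topologicalClosure_minimal _ (Submodule.span_le.2 fun y hy => ?_)
        ((Submodule.isClosed_topologicalClosure _).preimage ((R.rep i).T ξ).continuous)
      exact Submodule.le_topologicalClosure _ (Submodule.subset_span ⟨ξ, y, hy, rfl⟩)
    exact hle (ih hx)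

lemma word_singleton (i : Fin k) (m : Fin k → ℕ) : word {i} m = List.replicate (m i) i := by
  simp [word]

lemma words_subset_bracket (α : Finset (Fin k)) (m : Fin k → ℕ) (K : Submodule ℂ R.H) :
    R.words (word α m) K ⊆ R.bracket α K := fun _ hx =>
  Submodule.le_topologicalClosure _ ((le_iSup (fun m => R.L α m K) m)
    (Submodule.le_topologicalClosure _ (Submodule.subset_span hx)))

lemma bracket_le {α : Finset (Fin k)} {K V : Submodule ℂ R.H} (hV : IsClosed (V : Set R.H))
    (h : ∀ m, R.words (word α m) K ⊆ V) : R.bracket α K ≤ V :=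
  Submodule.topologicalClosure_minimal _ (iSup_le fun m =>
    Submodule.topologicalClosure_minimal _ (Submodule.span_le.2 (h m)) hV) hV

lemma isClosed_bracket (α : Finset (Fin k)) (K : Submodule ℂ R.H) :
    IsClosed (R.bracket α K : Set R.H) :=
  Submodule.isClosed_topologicalClosure _

lemma orbit_subset_bracket (i : Fin k) (n : ℕ) (K : Submodule ℂ R.H) :
    (R.rep i).orbit K n ⊆ R.bracket {i} K := by
  have h := R.words_subset_bracket {i} (fun _ => n) K
  rwa [word_singleton, words_replicate] at h

lemma bracket_singleton_le {i : Fin k} {K V : Submodule ℂ R.H} (hV : IsClosed (V : Set R.H))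
    (h : ∀ n, (R.rep i).orbit K n ⊆ V) : R.bracket {i} K ≤ V :=
  R.bracket_le hV fun m => by
    rw [word_singleton, words_replicate]
    exact h _

lemma T_mem_bracket (i : Fin k) (K : Submodule ℂ R.H) (ξ : P.E i) {x : R.H}
    (hx : x ∈ R.bracket {i} K) : (R.rep i).T ξ x ∈ R.bracket {i} K := by
  have h : R.bracket {i} K ≤ (R.bracket {i} K).comap ((R.rep i).T ξ).toLinearMap :=
    R.bracket_singleton_le ((R.isClosed_bracket {i} K).preimage ((R.rep i).T ξ).continuous)
      fun n y hy => R.orbit_subset_bracket i (n + 1) K ⟨ξ, y, hy, rfl⟩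
  exact h hx

/-! ### The subspaces `𝒲_α` -/

lemma mem_W {α : Finset (Fin k)} {x : R.H} :
    x ∈ R.W α ↔ ∀ i ∈ α, (R.tilde i).adjoint.toCLM x = 0 := by
  simp only [W, Submodule.mem_iInf]
  exact forall₂_congr fun i _ => mem_range_orthogonal_iff (R.rep i) x

lemma isClosed_W (α : Finset (Fin k)) : IsClosed (R.W α : Set R.H) := by
  simp only [W, Submodule.coe_iInf]
  exact isClosed_biInter fun i _ => Submodule.isClosed_orthogonal _

lemma W_empty : R.W ∅ = ⊤ := by simp [W]

lemma W_singleton (i : Fin k) :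
    R.W {i} = (LinearMap.range (R.rep i).tilde.toCLM.toLinearMap)ᗮ := by simp [W, tilde]

lemma mem_W_insert_erase {α : Finset (Fin k)} {i : Fin k} (hi : i ∈ α) {x : R.H} :
    x ∈ R.W α ↔ x ∈ R.W {i} ∧ x ∈ R.W (α.erase i) := by
  simp only [mem_W, Finset.mem_singleton, forall_eq, Finset.mem_erase]
  refine ⟨fun h => ⟨h i hi, fun j hj => h j hj.2⟩, fun h j hj => ?_⟩
  rcases eq_or_ne j i with rfl | hne
  · exact h.1
  · exact h.2 j ⟨hne, hj⟩

/-- A nonempty word starts with some letter `j ∈ α`, so its vectors lie in the range of `T̃⁽ʲ⁾`,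
which is orthogonal to `𝒲_α`. No commutation is needed. -/
lemma isWandering_W (α : Finset (Fin k)) : R.IsWandering α (R.W α) where
  isClosed := R.isClosed_W α
  invariant a x hx := R.mem_W.2 fun i hi => by
    rw [(R.tilde i).adjoint.comm, R.mem_W.1 hx i hi, map_zero]
  ortho m hm := by
    obtain ⟨i, hi, hmi⟩ := hm
    have hmem : i ∈ word α m := List.mem_flatMap.2
      ⟨i, (Finset.mem_sort _).2 hi, List.mem_replicate.2 ⟨hmi, rfl⟩⟩
    obtain ⟨j, l, hjl⟩ := List.exists_cons_of_ne_nil (List.ne_nil_of_mem hmem)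
    have hj : j ∈ α := by
      have : j ∈ word α m := by rw [hjl]; exact List.mem_cons_self
      obtain ⟨j', hj', hjj⟩ := List.mem_flatMap.1 this
      rw [List.eq_of_mem_replicate hjj]
      exact (Finset.mem_sort _).1 hj'
    refine Submodule.IsOrtho.symm ?_
    rw [Submodule.isOrtho_iff_le]
    refine Submodule.topologicalClosure_minimal _ (Submodule.span_le.2 ?_)
      (Submodule.isClosed_orthogonal _)
    rw [hjl]
    rintro _ ⟨ξ, x, -, rfl⟩
    refine (Submodule.mem_orthogonal _ _).2 fun w hw => ?_
    rw [← tilde_tmk, ← Intertwiner.adjoint_inner_left, R.mem_W.1 hw j hj, inner_zero_left]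

/-- Double commutation moves `T̃⁽ʲ⁾*` past `T⁽ⁱ⁾(ξ)` onto `x`, which it kills. -/
lemma T_mem_W {i : Fin k} {β : Finset (Fin k)} (h : ∀ j ∈ β, R.CommutesDoubly i j) (ξ : P.E i)
    {x : R.H} (hx : x ∈ R.W β) : (R.rep i).T ξ x ∈ R.W β :=
  R.mem_W.2 fun j hj => by
    rw [← tilde_tmk, h j hj, ampliate_tmk, R.mem_W.1 hx j hj, ← tmkRight_apply]
    simp only [map_zero]

/-- Plain commutation suffices: `T⁽ⁱ⁾(ξ)` maps the range of each `T̃⁽ʲ⁾` into itself, so its adjoint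
preserves the orthogonal complements. Together with `T_mem_W`, this makes `𝒲_β` reducing. -/
lemma adjoint_T_mem_W (i : Fin k) (β : Finset (Fin k)) (ξ : P.E i) {x : R.H} (hx : x ∈ R.W β) :
    ((R.rep i).T ξ†) x ∈ R.W β :=
  R.mem_W.2 fun j hj => by
    refine ext_inner_left ℂ fun y => ?_
    rw [Intertwiner.adjoint_inner_right, ContinuousLinearMap.adjoint_inner_right, ← tilde_tmk,
      ← ampliate_tmk, tilde_comm, ← Intertwiner.adjoint_inner_right, R.mem_W.1 hx j hj,
      inner_zero_right, inner_zero_right]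

/-- The projection onto a reducing subspace commutes with the operator. -/
lemma starProjection_comm {V : Type*} [NormedAddCommGroup V] [InnerProductSpace ℂ V]
    [CompleteSpace V] {S : Submodule ℂ V} [S.HasOrthogonalProjection] {A : V →L[ℂ] V}
    (h : ∀ x ∈ S, A x ∈ S) (h' : ∀ x ∈ S, (A†) x ∈ S) (x : V) :
    S.starProjection (A x) = A (S.starProjection x) := by
  refine Submodule.eq_starProjection_of_mem_of_inner_eq_zero (h _ (S.starProjection_apply_mem x))
    fun w hw => ?_
  rw [← map_sub, ← ContinuousLinearMap.adjoint_inner_right]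
  exact Submodule.inner_left_of_mem_orthogonal (h' w hw) (S.sub_starProjection_mem_orthogonal x)

/-- `[𝒲_α]_{T⁽ⁱ⁾} = 𝒲_{α ∖ {i}}` if `T⁽ⁱ⁾` is doubly commuting with the other `T⁽ʲ⁾`, `j ∈ α`, and its
wandering subspace is generating. -/
lemma bracket_W_eq {α : Finset (Fin k)} {i : Fin k} (hi : i ∈ α)
    (hdc : ∀ j ∈ α.erase i, R.CommutesDoubly i j)
    (hgen : ∀ z : R.H, (∀ n, ∀ w ∈ (R.rep i).orbit (R.W {i}) n, inner ℂ w z = 0) → z = 0) :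
    R.bracket {i} (R.W α) = R.W (α.erase i) := by
  set β := α.erase i with hβ
  have : CompleteSpace (R.W β) := (R.isClosed_W β).completeSpace_coe
  refine le_antisymm (R.bracket_singleton_le (R.isClosed_W β) fun n => ?_) fun x hx => ?_
  · induction n with
    | zero => exact fun x hx => ((R.mem_W_insert_erase hi).1 hx).2
    | succ n ih =>
      rintro _ ⟨ξ, x, hx, rfl⟩
      exact R.T_mem_W hdc ξ (ih hx)
  · set p := (R.W β).starProjection with hp
    have hcomm (ξ : P.E i) (x : R.H) : p ((R.rep i).T ξ x) = (R.rep i).T ξ (p x) :=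
      starProjection_comm (fun _ hx => R.T_mem_W hdc ξ hx)
        (fun _ hx => R.adjoint_T_mem_W i β ξ hx) x
    -- Since `p` is self-adjoint and commutes with every `T⁽ⁱ⁾(ξ)`, it preserves the orthogonal
    -- complement of their ranges.
    have hpW {w : R.H} (hw : w ∈ R.W {i}) : p w ∈ R.W α := by
      refine (R.mem_W_insert_erase hi).2 ⟨R.mem_W.2 fun j hj => ?_,
        (R.W β).starProjection_apply_mem w⟩
      obtain rfl := Finset.mem_singleton.1 hj
      refine tmk_inner_ext fun ξ h => ?_
      rw [Intertwiner.adjoint_inner_right, tilde_tmk, ← Submodule.inner_starProjection_left_eq_right,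
        ← hp, hcomm, ← tilde_tmk, ← Intertwiner.adjoint_inner_right,
        R.mem_W.1 hw j (Finset.mem_singleton_self j), inner_zero_right, inner_zero_right]
    have horb (n : ℕ) : ∀ w ∈ (R.rep i).orbit (R.W {i}) n, p w ∈ (R.rep i).orbit (R.W α) n := by
      induction n with
      | zero => exact fun w hw => hpW hw
      | succ n ih =>
        rintro _ ⟨ξ, w, hw, rfl⟩
        exact ⟨ξ, p w, ih w hw, hcomm ξ w⟩
    -- The vectors that `p` sends into the bracket form a closed subspace containing the orbit of
    -- `𝒲_{i}`, hence all of `H`; and `p` fixes `x`.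
    set S := (R.bracket {i} (R.W α)).comap p.toLinearMap with hS
    have hSc : IsClosed (S : Set R.H) := (R.isClosed_bracket _ _).preimage p.continuous
    have : CompleteSpace S := hSc.completeSpace_coe
    have hStop : S = ⊤ := by
      rw [← Submodule.orthogonal_eq_bot_iff, Submodule.eq_bot_iff]
      intro z hz
      exact hgen z fun n w hw => Submodule.inner_right_of_mem_orthogonal
        (R.orbit_subset_bracket i n _ (horb n w hw) : w ∈ S) hz
    have hxS : x ∈ S := by rw [hStop]; trivial
    have hpx : p x = x := Submodule.starProjection_eq_self_iff.2 hx
    change p x ∈ R.bracket {i} (R.W α) at hxS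
    rwa [hpx] at hxS

/-- The words over a list of letters with arbitrary multiplicities, applied to `𝒲_α`. -/
def allWords (α : Finset (Fin k)) (l : List (Fin k)) : Set R.H :=
  ⋃ m : Fin k → ℕ, R.words (l.flatMap fun i => List.replicate (m i) i) (R.W α)

/-- Each new letter `a` enlarges `𝒲_{α∖l}` to `[𝒲_{α∖l}]_{T⁽ᵃ⁾} = 𝒲_{α∖(a::l)}`, with `a` acting on
the left of the earlier words. Once `l` exhausts `α`, the left side is `𝒲_∅ = H`. -/
lemma W_sdiff_le {α : Finset (Fin k)}
    (hα : ∀ β ⊆ α, ∀ i ∈ β, R.bracket {i} (R.W β) = R.W (β.erase i)) (l : List (Fin k))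
    (hl : l.Nodup) (hlα : ∀ i ∈ l, i ∈ α) :
    R.W (α \ l.toFinset) ≤ (Submodule.span ℂ (R.allWords α l)).topologicalClosure := by
  induction l with
  | nil =>
    refine le_trans (fun x hx => ?_) (Submodule.le_topologicalClosure _)
    rw [List.toFinset_nil, Finset.sdiff_empty] at hx
    exact Submodule.subset_span (Set.mem_iUnion.2 ⟨0, hx⟩)
  | cons a l ih =>
    obtain ⟨hal, hnd⟩ := List.nodup_cons.1 hl
    have ih' := ih hnd fun i hi => hlα i (List.mem_cons_of_mem _ hi)
    have hmem : a ∈ α \ l.toFinset :=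
      Finset.mem_sdiff.2 ⟨hlα a List.mem_cons_self, fun h => hal (List.mem_toFinset.1 h)⟩
    rw [List.toFinset_cons, Finset.sdiff_insert, ← hα _ Finset.sdiff_subset a hmem]
    refine R.bracket_singleton_le (Submodule.isClosed_topologicalClosure _) fun n => ?_
    rw [← words_replicate]
    refine ((R.words_mono _ ih').trans (R.words_topologicalClosure_span _ _)).trans ?_
    refine Submodule.topologicalClosure_mono (Submodule.span_mono fun y hy => ?_)
    obtain ⟨x, hx, hyx⟩ := R.exists_of_mem_words _ hy
    obtain ⟨m, hm⟩ := Set.mem_iUnion.1 hx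
    -- Changing the multiplicity of `a` does not affect the rest of the word, because `a ∉ l`.
    refine Set.mem_iUnion.2 ⟨Function.update m a n, ?_⟩
    have hfm : (l.flatMap fun i => List.replicate (Function.update m a n i) i)
        = l.flatMap fun i => List.replicate (m i) i := by
      refine List.flatMap_congr fun i hi => ?_
      rw [Function.update_of_ne]
      rintro rfl
      exact hal hi
    rw [List.flatMap_cons, hfm, Function.update_self, words_append]
    exact R.words_mono _ (Set.singleton_subset_iff.2 hm) hyx

lemma bracket_W_eq_top {α : Finset (Fin k)}
    (hα : ∀ β ⊆ α, ∀ i ∈ β, R.bracket {i} (R.W β) = R.W (β.erase i)) :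
    R.bracket α (R.W α) = ⊤ := by
  have h := R.W_sdiff_le hα (α.sort (· ≤ ·)) (Finset.sort_nodup _ _)
    fun i hi => (Finset.mem_sort _).1 hi
  rw [Finset.sort_toFinset, Finset.sdiff_self, W_empty] at h
  refine top_le_iff.1 (h.trans (Submodule.topologicalClosure_minimal _ (Submodule.span_le.2 ?_)
    (R.isClosed_bracket _ _)))
  exact Set.iUnion_subset fun m => R.words_subset_bracket α m _

/-! ### Recovering double commutation -/

/-- For fixed `ξ`, the two sides are compared on `ξ ⊗ x` with `x` in the closed range of `T̃⁽ʲ⁾` or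
in its complement `𝒲_{j}`. On the range, the intertwining relation and commutation give equality; on
`𝒲_{j}`, both sides vanish by `hW`. -/
lemma commutesDoubly_of_intertwines {i j : Fin k} (h : R.Intertwines i j)
    (hW : ∀ (ξ : P.E i), ∀ x ∈ R.W {j}, (R.rep i).T ξ x ∈ R.W {j}) : R.CommutesDoubly i j := by
  set A := (R.tilde j).adjoint.toCLM ∘L (R.tilde i).toCLM with hA
  set B := ((R.tilde i).ampliate (P.E j)).toCLM ∘L P.flip i j R.H ∘L
    ((R.tilde j).adjoint.ampliate (P.E i)).toCLM with hB
  suffices hAB : A = B from fun x => DFunLike.congr_fun hAB x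
  have hBa (x) : B x = ((R.tilde i).ampliate (P.E j)).toCLM
    (P.flip i j R.H (((R.tilde j).adjoint.ampliate (P.E i)).toCLM x)) := rfl
  have hAa (x) : A x = (R.tilde j).adjoint.toCLM ((R.tilde i).toCLM x) := rfl
  refine tmk_ext fun ξ x => ?_
  set S : Submodule ℂ R.H := LinearMap.ker ((A - B) ∘L tmkRight ξ R.H).toLinearMap with hS
  have hSc : IsClosed (S : Set R.H) := ContinuousLinearMap.isClosed_ker _
  have hmem (y : R.H) : y ∈ S ↔ A (tmk ξ y) = B (tmk ξ y) := by
    rw [← sub_eq_zero]; rfl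
  have hran : (LinearMap.range (R.tilde j).toCLM.toLinearMap).topologicalClosure ≤ S := by
    refine Submodule.topologicalClosure_minimal _ ?_ hSc
    rintro _ ⟨y, rfl⟩
    refine (hmem _).2 ?_
    change A (tmk ξ ((R.tilde j).toCLM y)) = B (tmk ξ ((R.tilde j).toCLM y))
    have h1 : ((R.tilde i).ampliate (P.E j)).toCLM (P.flip i j R.H
        ((((R.tilde j).adjoint.comp (R.tilde j)).ampliate (P.E i)).toCLM (tmk ξ y))) =
      (R.tilde j).adjoint.toCLM ((R.tilde j).toCLM
        (((R.tilde i).ampliate (P.E j)).toCLM (P.flip i j R.H (tmk ξ y)))) :=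
      DFunLike.congr_fun h (tmk ξ y)
    rw [← ampliate_tmk, hAa, hBa, tilde_comm, ← h1, ampliate_comp_apply]
  have horth : (LinearMap.range (R.tilde j).toCLM.toLinearMap)ᗮ ≤ S := by
    intro w hw
    have hwj : w ∈ R.W {j} := by rw [W_singleton]; exact hw
    have h0 := R.mem_W.1 hwj j (Finset.mem_singleton_self j)
    refine (hmem _).2 ?_
    rw [hAa, hBa, tilde_tmk, R.mem_W.1 (hW ξ w hwj) j (Finset.mem_singleton_self j), ampliate_tmk,
      h0, ← tmkRight_apply]
    simp only [map_zero]
  have htop : (⊤ : Submodule ℂ R.H) ≤ S := by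
    rw [← Submodule.sup_orthogonal_of_hasOrthogonalProjection
      (K := (LinearMap.range (R.tilde j).toCLM.toLinearMap).topologicalClosure)]
    refine sup_le hran ?_
    rwa [Submodule.orthogonal_closure]
  exact (hmem x).1 (htop Submodule.mem_top)

lemma isAnalytic_iff_generating (hP : ∀ i, (P.E i).InnerNondegenerate)
    (hR : ∀ i, (R.rep i).IsConcave ∨ (R.rep i).ShimorinInequality) (i : Fin k) :
    (R.rep i).IsAnalytic ↔
      ∀ z : R.H, (∀ n, ∀ w ∈ (R.rep i).orbit (R.W {i}) n, inner ℂ w z = 0) → z = 0 := by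
  rw [W_singleton]
  exact isAnalytic_iff_orbit (R.rep i) (hP i) (hR i)

end ProductSystem.Rep

end Multi

end CovRep

/-! ### The main equivalence -/

theorem theorem4p6 {M : Type u} [NonUnitalCStarAlgebra M] [PartialOrder M] [StarOrderedRing M]
    {k : ℕ} (P : CovRep.ProductSystem.{u, v} M k) (hP : ∀ i, (P.E i).InnerNondegenerate)
    (R : CovRep.ProductSystem.Rep.{u, v, w} P)
    (hR : ∀ i, (R.rep i).IsConcave ∨ (R.rep i).ShimorinInequality) :
    (R.IsDoublyCommuting ∧ ∀ i, (R.rep i).IsAnalytic) ↔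
      (∀ α : Finset (Fin k), α.Nonempty →
        R.IsGeneratingWandering α (R.W α) ∧
          (2 ≤ α.card → ∀ i ∈ α, R.bracket {i} (R.W α) = R.W (α.erase i))) ∧
      ∀ i j : Fin k, i < j → R.Intertwines i j := by
  rw [R.isDoublyCommuting_iff]
  simp only [R.isAnalytic_iff_generating hP hR]
  constructor
  · rintro ⟨hdc, hgen⟩
    have hbr (β : Finset (Fin k)) (i) (hi : i ∈ β) :
        R.bracket {i} (R.W β) = R.W (β.erase i) :=
      R.bracket_W_eq hi (fun j hj => hdc i j (Finset.ne_of_mem_erase hj).symm) (hgen i)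
    exact ⟨fun α _ => ⟨⟨R.isWandering_W α, R.bracket_W_eq_top fun β _ => hbr β⟩, fun _ => hbr α⟩,
      fun i j hij => R.intertwines_of_commutesDoubly (hdc i j hij.ne)⟩
  · rintro ⟨hα, hint⟩
    have hlt (i j : Fin k) (hij : i < j) : R.CommutesDoubly i j := by
      refine R.commutesDoubly_of_intertwines (hint i j hij) fun ξ x hx => ?_
      -- For the pair, (a) identifies `𝒲_{j}` with `[𝒲_{i,j}]_{T⁽ⁱ⁾}`, which is invariant under
      -- `T⁽ⁱ⁾` by construction.
      have h1 := (hα {i, j} ⟨i, by simp⟩).2 (Finset.card_pair hij.ne).ge i (by simp)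
      have h2 : ({i, j} : Finset (Fin k)).erase i = {j} := by
        rw [Finset.erase_insert]; simpa using hij.ne
      rw [h2] at h1
      rw [← h1] at hx ⊢
      exact R.T_mem_bracket i _ ξ hx
    refine ⟨fun i j hij => ?_, fun i z hz => ?_⟩
    · rcases hij.lt_or_gt with h | h
      · exact hlt i j h
      · exact (hlt j i h).symm
    -- For singletons, (a) is the generating property that characterises analyticity: `z` is
    -- orthogonal to `[𝒲_{i}]_{T⁽ⁱ⁾} = H`, hence to itself.
    · have htop := (hα {i} (Finset.singleton_nonempty i)).1.2
      have hle : R.bracket {i} (R.W {i}) ≤ LinearMap.ker (innerSL ℂ z).toLinearMap :=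
        R.bracket_singleton_le (ContinuousLinearMap.isClosed_ker _) fun n w hw =>
          inner_eq_zero_symm.1 (hz n w hw)
      rw [htop] at hle
      exact inner_self_eq_zero.1 (hle (Submodule.mem_top (x := z)))
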